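/- Let $w$ be a symmetric $n\times n$ matrix with nonnegative rational entries. The Quantum Max Cut Hamiltonian of $w$ is the operator on $n$ qubits \[H_w=\sum_{1\le i<j\le n} w_{ij}H_{ij},\] where $H_{ij}$ is the projection onto the singlet state $\frac{|01\rangle-|10\rangle}{\sqrt2}$ on qubits $i$ and $j$, tensored with the identity on the other qubits. Call $w$ bipartite if $[n]$ can be partitioned into two sets $A$ and $B$ such that $w_{ij}=0$ whenever $i\ne j$ lie both in $A$ or both in $B$. Let $\lambda_{\max}(H_w)$ denote the maximum eigenvalue of $H_w$, i.e. the maximum of $\operatorname{tr}(\rho H_w)$ over all density matrices $\rho$. Then there is a deterministic classical algorithm which, given a bipartite $w$ (with entries written in binary; the partition is not given), runs in time polynomial in the bit length of $w$ and outputs a classical description of an $n$-qubit (mixed) state $\rho$ with \[\operatorname{tr}(\rho H_w)\ \ge\ \frac{1+\sqrt5}{4}\,\lambda_{\max}(H_w).\] Here time is measured on a random access machine with logarithmic cost. The description consists of a partition of the qubits into blocks together with, for each block, the list of all entries of a density matrix on that block, the real and imaginary part of each entry being an algebraic number given by an integer polynomial and a rational interval that isolates one of its roots; $\rho$ is the tensor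 product of the density matrices of the blocks. -/

import Mathlib

noncomputable section

/-! ## Random access machines with logarithmic cost

Programs are structured programs over natural-number variables and natural-number arrays with
computed addresses. Every operation is charged the bit lengths of the numbers it handles
(including addresses), so the cost of a run is its time on a random access machine under the
logarithmic cost criterion. -/

namespace RAM

/-- The contents of the registers and of the arrays. -/
structure Store where
  var : ℕ → ℕ
  arr : ℕ → ℕ → ℕ

/-- Arithmetic operations; `sub` is truncated at zero, `div` is the integer quotient. -/
inductive Op
  | add | sub | mul | div

def Op.eval : Op → ℕ → ℕ → ℕ
  | .add, a, b => a + b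
  | .sub, a, b => a - b
  | .mul, a, b => a * b
  | .div, a, b => a / b

/-- Expressions: constants, registers, array cells at a computed address, operations. -/
inductive Expr
  | const (c : ℕ)
  | var (x : ℕ)
  | read (k : ℕ) (e : Expr)
  | op (o : Op) (e f : Expr)

def Expr.eval (s : Store) : Expr → ℕ
  | .const c => c
  | .var x => s.var x
  | .read k e => s.arr k (e.eval s)
  | .op o e f => o.eval (e.eval s) (f.eval s)

/-- Logarithmic cost: each node costs one plus the bit length of its value. -/
def Expr.cost (s : Store) : Expr → ℕ
  | .const c => 1 + c.size
  | .var x => 1 + (s.var x).size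
  | .read k e => 1 + ((Expr.read k e).eval s).size + e.cost s
  | .op o e f => 1 + ((Expr.op o e f).eval s).size + e.cost s + f.cost s

/-- Programs. Conditions are true when the value of the expression is nonzero. -/
inductive Cmd
  | skip
  | assign (x : ℕ) (e : Expr)
  | write (k : ℕ) (i e : Expr)
  | seq (c d : Cmd)
  | cond (e : Expr) (c d : Cmd)
  | loop (e : Expr) (c : Cmd)

def Store.setVar (s : Store) (x v : ℕ) : Store :=
  { s with var := Function.update s.var x v }

def Store.setArr (s : Store) (k i v : ℕ) : Store :=
  { s with arr := Function.update s.arr k (Function.update (s.arr k) i v) }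

/-- `Exec c s t s'`: started in `s`, the program `c` halts in `s'` at total cost `t`. -/
inductive Exec : Cmd → Store → ℕ → Store → Prop
  | skip (s : Store) : Exec .skip s 1 s
  | assign (s : Store) (x : ℕ) (e : Expr) :
      Exec (.assign x e) s (1 + e.cost s) (s.setVar x (e.eval s))
  | write (s : Store) (k : ℕ) (i e : Expr) :
      Exec (.write k i e) s (1 + i.cost s + e.cost s) (s.setArr k (i.eval s) (e.eval s))
  | seq {c d : Cmd} {s s' s'' : Store} {t t' : ℕ} :
      Exec c s t s' → Exec d s' t' s'' → Exec (.seq c d) s (t + t') s''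
  | cond_true {e : Expr} {c d : Cmd} {s s' : Store} {t : ℕ} :
      e.eval s ≠ 0 → Exec c s t s' → Exec (.cond e c d) s (1 + e.cost s + t) s'
  | cond_false {e : Expr} {c d : Cmd} {s s' : Store} {t : ℕ} :
      e.eval s = 0 → Exec d s t s' → Exec (.cond e c d) s (1 + e.cost s + t) s'
  | loop_true {e : Expr} {c : Cmd} {s s' s'' : Store} {t t' : ℕ} :
      e.eval s ≠ 0 → Exec c s t s' → Exec (.loop e c) s' t' s'' →
        Exec (.loop e c) s (1 + e.cost s + t + t') s''
  | loop_false {e : Expr} {c : Cmd} {s : Store} :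
      e.eval s = 0 → Exec (.loop e c) s (1 + e.cost s) s

/-- Programs are deterministic. -/
theorem Exec.det {c : Cmd} {s s₁ s₂ : Store} {t₁ t₂ : ℕ}
    (h₁ : Exec c s t₁ s₁) (h₂ : Exec c s t₂ s₂) : t₁ = t₂ ∧ s₁ = s₂ := by
  induction h₁ generalizing t₂ s₂ with
  | skip => cases h₂; exact ⟨rfl, rfl⟩
  | assign => cases h₂; exact ⟨rfl, rfl⟩
  | write => cases h₂; exact ⟨rfl, rfl⟩
  | seq _ _ ih ih' =>
    cases h₂ with
    | seq a b =>
      obtain ⟨rfl, rfl⟩ := ih a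
      obtain ⟨rfl, rfl⟩ := ih' b
      exact ⟨rfl, rfl⟩
  | cond_true he _ ih =>
    cases h₂ with
    | cond_true _ a => obtain ⟨rfl, rfl⟩ := ih a; exact ⟨rfl, rfl⟩
    | cond_false h _ => exact absurd h he
  | cond_false he _ ih =>
    cases h₂ with
    | cond_true h _ => exact absurd he h
    | cond_false _ a => obtain ⟨rfl, rfl⟩ := ih a; exact ⟨rfl, rfl⟩
  | loop_true he _ _ ih ih' =>
    cases h₂ with
    | loop_true _ a b =>
      obtain ⟨rfl, rfl⟩ := ih a
      obtain ⟨rfl, rfl⟩ := ih' b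
      exact ⟨rfl, rfl⟩
    | loop_false h => exact absurd h he
  | loop_false he =>
    cases h₂ with
    | loop_true h _ _ => exact absurd he h
    | loop_false _ => exact ⟨rfl, rfl⟩

/-- Initially array 0 holds the input, register 0 its length, and everything else is zero. -/
def initStore (input : List ℕ) : Store where
  var x := if x = 0 then input.length else 0
  arr k i := if k = 0 then input.getD i 0 else 0

/-- The output is the content of array 1 up to the length held in register 1. -/
def Store.output (s : Store) : List ℕ :=
  (List.range (s.var 1)).map (s.arr 1)

/-- Total bit length of a list of numbers (with one delimiter for each). -/
def bitLength (l : List ℕ) : ℕ :=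
  (l.map fun a => a.size + 1).sum

/-- On the given input the program `c` halts with the given output at cost `t`, where delivering
the output is charged its bit length. -/
def Computes (c : Cmd) (input output : List ℕ) (t : ℕ) : Prop :=
  ∃ t₀ s, Exec c (initStore input) t₀ s ∧ s.output = output ∧ t = t₀ + bitLength output

end RAM

/-! ## Encodings as lists of natural numbers written in binary -/

namespace Enc

/-- Sign and absolute value. -/
def int (z : ℤ) : List ℕ :=
  [if z < 0 then 1 else 0, z.natAbs]

def rat (q : ℚ) : List ℕ :=
  int q.num ++ [q.den]

/-- The length followed by the codes of the elements. -/
def list {α : Type*} (f : α → List ℕ) (l : List α) : List ℕ :=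
  l.length :: l.flatMap f

/-- The dimension followed by the entries in row-major order. -/
def matrix {n : ℕ} (w : Matrix (Fin n) (Fin n) ℚ) : List ℕ :=
  n :: (List.finRange n).flatMap fun i => (List.finRange n).flatMap fun j => rat (w i j)

end Enc

/-! ## Quantum states and Hamiltonians on `n` qubits -/

namespace Quantum

open scoped ComplexOrder

/-- Operators on `k` qubits, as matrices in the computational basis. -/
abbrev Operator (k : ℕ) := Matrix (Fin k → Fin 2) (Fin k → Fin 2) ℂ

/-- Density matrices, i.e. (mixed) states. -/
def IsState {k : ℕ} (ρ : Operator k) : Prop :=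
  ρ.PosSemidef ∧ ρ.trace = 1

/-- The energy `tr (ρ H)`, which is real for Hermitian `ρ` and `H`. -/
def energy {k : ℕ} (ρ H : Operator k) : ℝ :=
  (ρ * H).trace.re

/-- The maximum eigenvalue of a Hermitian operator. -/
def lambdaMax {k : ℕ} (H : Operator k) : ℝ :=
  sSup (spectrum ℝ H)

/-- The singlet `(|01⟩ - |10⟩) / √2`. -/
def singlet : Fin 2 × Fin 2 → ℂ := fun p =>
  if p = (0, 1) then 1 / (√2 : ℝ) else if p = (1, 0) then -1 / (√2 : ℝ) else 0

/-- The projection onto the singlet on qubits `i ≠ j`, tensored with the identity on the rest. -/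
def singletProj {n : ℕ} (i j : Fin n) : Operator n := Matrix.of fun x y =>
  if ∀ k, k ≠ i → k ≠ j → x k = y k then
    singlet (x i, x j) * star (singlet (y i, y j)) else 0

/-- The Quantum Max Cut Hamiltonian `∑_{i<j} w_{ij} H_{ij}`. -/
def qmcHamiltonian {n : ℕ} (w : Matrix (Fin n) (Fin n) ℚ) : Operator n :=
  ∑ i, ∑ j with i < j, (w i j : ℂ) • singletProj i j

/-- Interaction matrices: symmetric with nonnegative (rational) entries. -/
def IsInteraction {n : ℕ} (w : Matrix (Fin n) (Fin n) ℚ) : Prop :=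
  w.IsSymm ∧ ∀ i j, 0 ≤ w i j

/-- The qubits split into `A` and its complement with no interaction inside either part. -/
def IsBipartite {n : ℕ} (w : Matrix (Fin n) (Fin n) ℚ) : Prop :=
  ∃ A : Set (Fin n), ∀ i j, i ≠ j → (i ∈ A ↔ j ∈ A) → w i j = 0

/-! ### Classical descriptions of states -/

/-- A real algebraic number, given by an integer polynomial (coefficients in increasing degree)
and a rational interval that isolates one of its roots. -/
structure AlgReal where
  coeffs : List ℤ
  lo : ℚ
  hi : ℚ

def AlgReal.polyEval (a : AlgReal) (x : ℝ) : ℝ :=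
  a.coeffs.foldr (fun c r => (c : ℝ) + x * r) 0

/-- `x` is the only root of the polynomial in the interval. -/
def AlgReal.Represents (a : AlgReal) (x : ℝ) : Prop :=
  ∀ y : ℝ, ((a.lo : ℝ) ≤ y ∧ y ≤ a.hi ∧ a.polyEval y = 0) ↔ y = x

/-- A complex algebraic number, given by its real and imaginary parts. -/
structure AlgComplex where
  re : AlgReal
  im : AlgReal

def AlgComplex.Represents (a : AlgComplex) (z : ℂ) : Prop :=
  a.re.Represents z.re ∧ a.im.Represents z.im

/-- A group of qubits, with the list (row-major) of all entries of a density matrix on it. -/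
structure Block (n : ℕ) where
  qubits : List (Fin n)
  entries : List AlgComplex

/-- The position of a basis state of `k` qubits: its bits read as a binary number. -/
def basisIndex {k : ℕ} (x : Fin k → Fin 2) : ℕ :=
  (finFunctionFinEquiv x : ℕ)

/-- The list of entries of the block is the list of entries of the density matrix `K`. -/
def Block.Describes {n : ℕ} (b : Block n) (K : Operator b.qubits.length) : Prop :=
  IsState K ∧ b.entries.length = 4 ^ b.qubits.length ∧
    ∀ x y, ∃ c, b.entries[basisIndex x * 2 ^ b.qubits.length + basisIndex y]? = some c ∧
      c.Represents (K x y)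

/-- A description of a state: a list of blocks. -/
abbrev Description (n : ℕ) := List (Block n)

/-- The blocks partition the `n` qubits, and `ρ` is the tensor product of their states. -/
def Describes {n : ℕ} (D : Description n) (ρ : Operator n) : Prop :=
  (D.flatMap Block.qubits).Perm (List.finRange n) ∧
    ∃ K : (b : Fin D.length) → Operator (D.get b).qubits.length,
      (∀ b, (D.get b).Describes (K b)) ∧
      ∀ x y, ρ x y = ∏ b, K b (fun a => x ((D.get b).qubits.get a))
        (fun a => y ((D.get b).qubits.get a))

end Quantum

namespace Enc

open Quantum

def algReal (a : AlgReal) : List ℕ :=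
  list int a.coeffs ++ rat a.lo ++ rat a.hi

def algComplex (a : AlgComplex) : List ℕ :=
  algReal a.re ++ algReal a.im

def block {n : ℕ} (b : Block n) : List ℕ :=
  list (fun q : Fin n => [(q : ℕ)]) b.qubits ++ list algComplex b.entries

def description {n : ℕ} (D : Description n) : List ℕ :=
  list block D

/-! The code of a description determines the description. -/

/-- Codes can be read off the front of a longer list unambiguously. -/
def Readable {α : Type*} (f : α → List ℕ) : Prop :=
  ∀ a b s t, f a ++ s = f b ++ t → a = b ∧ s = t

theorem readable_int : Readable int := by
  intro a b s t h
  simp only [int, List.cons_append, List.nil_append, List.cons.injEq] at h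
  obtain ⟨h1, h2, h3⟩ := h
  refine ⟨?_, h3⟩
  split_ifs at h1 <;> omega

theorem readable_rat : Readable rat := by
  intro a b s t h
  simp only [rat, List.append_assoc] at h
  obtain ⟨h1, h2⟩ := readable_int _ _ _ _ h
  simp only [List.cons_append, List.nil_append, List.cons.injEq] at h2
  exact ⟨Rat.ext h1 h2.1, h2.2⟩

theorem readable_list {α : Type*} {f : α → List ℕ} (hf : Readable f) : Readable (list f) := by
  intro a
  induction a with
  | nil =>
    intro b s t h
    cases b with
    | nil => simpa [list] using h
    | cons y b => simp [list] at h
  | cons x a ih =>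
    intro b s t h
    cases b with
    | nil => simp [list] at h
    | cons y b =>
      simp only [list, List.length_cons, List.flatMap_cons, List.cons_append, List.append_assoc,
        List.cons.injEq, Nat.add_right_cancel_iff] at h
      obtain ⟨rfl, h2⟩ := hf _ _ _ _ h.2
      obtain ⟨rfl, h4⟩ := ih b s t (by simp [list, h.1, h2])
      exact ⟨rfl, h4⟩

theorem readable_algReal : Readable algReal := by
  rintro ⟨a, b, c⟩ ⟨a', b', c'⟩ s t h
  simp only [algReal, List.append_assoc] at h
  obtain ⟨rfl, h1⟩ := readable_list readable_int _ _ _ _ h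
  obtain ⟨rfl, h2⟩ := readable_rat _ _ _ _ h1
  obtain ⟨rfl, h3⟩ := readable_rat _ _ _ _ h2
  exact ⟨rfl, h3⟩

theorem readable_algComplex : Readable algComplex := by
  rintro ⟨a, b⟩ ⟨a', b'⟩ s t h
  simp only [algComplex, List.append_assoc] at h
  obtain ⟨rfl, h1⟩ := readable_algReal _ _ _ _ h
  obtain ⟨rfl, h2⟩ := readable_algReal _ _ _ _ h1
  exact ⟨rfl, h2⟩

theorem readable_block {n : ℕ} : Readable (block (n := n)) := by
  rintro ⟨a, b⟩ ⟨a', b'⟩ s t h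
  simp only [block, List.append_assoc] at h
  have hq : Readable (fun q : Fin n => [(q : ℕ)]) := by
    intro a b s t h
    simpa [Fin.ext_iff] using h
  obtain ⟨rfl, h1⟩ := readable_list hq _ _ _ _ h
  obtain ⟨rfl, h2⟩ := readable_list readable_algComplex _ _ _ _ h1
  exact ⟨rfl, h2⟩

theorem description_injective {n : ℕ} : Function.Injective (description (n := n)) := by
  intro D D' h
  exact (readable_list readable_block D D' [] [] (by simpa [description] using h)).1

end Enc

/-- `c` is a polynomial-time `α`-approximation algorithm for the Hamiltonians `H w`, where `w`
ranges over the rational matrices in the family `F`: given `w`, in time polynomial in the bit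
length of `w` it outputs a description of a state of energy at least `α * lambdaMax (H w)`. -/
def IsPolyTimeApproxAlgorithm (α : ℝ)
    (F : (n : ℕ) → Matrix (Fin n) (Fin n) ℚ → Prop)
    (H : (n : ℕ) → Matrix (Fin n) (Fin n) ℚ → Quantum.Operator n) (c : RAM.Cmd) : Prop :=
  ∃ p : Polynomial ℕ, ∀ (n : ℕ) (w : Matrix (Fin n) (Fin n) ℚ), F n w →
    ∃ (t : ℕ) (D : Quantum.Description n) (ρ : Quantum.Operator n),
      RAM.Computes c (Enc.matrix w) (Enc.description D) t ∧
      t ≤ p.eval (RAM.bitLength (Enc.matrix w)) ∧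
      Quantum.Describes D ρ ∧ Quantum.IsState ρ ∧
      α * Quantum.lambdaMax (H n w) ≤ Quantum.energy ρ (H n w)

end

/-! The singlet weights of the edges of a star, that is, minus the expectations of the exchanges of
its ends, add up to at most 1. Charging each edge to the vertex weights of a dual solution of the
maximum weight matching problem, which has no integrality gap on a bipartite graph, turns this into
`λ_max ≤ (W + M) / 2`, where `W` is the total weight and `M` the weight of a maximum matching. The
Hungarian method finds the matching together with the dual solution.

Put the unmatched qubits into the basis states of their colours and every matched pair into the
tilted singlet `cos θ |01⟩ - sin θ |10⟩`. A matched edge then has energy `(1 + sin 2θ) / 2`, any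
other edge at least `(1 + cos² 2θ) / 4`. The upper bound allots 1 to a matched edge and 1 / 2 to any
other, so both lose the same factor if `s = sin 2θ` satisfies `s = 1 - s²`. Then
`s = (√5 - 1) / 2`, and the factor is `(1 + s) / 2 = (1 + √5) / 4`.
-/

noncomputable section

open Function

namespace RAM

namespace Store

@[simp] theorem setVar_arr (s : Store) (x v : ℕ) : (s.setVar x v).arr = s.arr := rfl

@[simp] theorem setVar_var (s : Store) (x v y : ℕ) :
    (s.setVar x v).var y = if y = x then v else s.var y := by
  simp [setVar, update_apply]

@[simp] theorem setArr_var (s : Store) (k i v : ℕ) : (s.setArr k i v).var = s.var := rfl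

@[simp] theorem setArr_arr (s : Store) (k i v l : ℕ) :
    (s.setArr k i v).arr l = if l = k then update (s.arr k) i v else s.arr l := by
  simp [setArr, update_apply]

end Store

namespace Expr

instance (c : ℕ) : OfNat Expr c := ⟨.const c⟩
instance : Add Expr := ⟨.op .add⟩
instance : Sub Expr := ⟨.op .sub⟩
instance : Mul Expr := ⟨.op .mul⟩
instance : Div Expr := ⟨.op .div⟩

variable (s : Store) (e f : Expr)

@[simp] theorem eval_const (c : ℕ) : (const c).eval s = c := rfl
@[simp] theorem eval_ofNat (c : ℕ) : (ofNat(c) : Expr).eval s = c := rfl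
@[simp] theorem eval_var (x : ℕ) : (var x).eval s = s.var x := rfl
@[simp] theorem eval_read (k : ℕ) : (read k e).eval s = s.arr k (e.eval s) := rfl
@[simp] theorem eval_add : (e + f).eval s = e.eval s + f.eval s := rfl
@[simp] theorem eval_sub : (e - f).eval s = e.eval s - f.eval s := rfl
@[simp] theorem eval_mul : (e * f).eval s = e.eval s * f.eval s := rfl
@[simp] theorem eval_div : (e / f).eval s = e.eval s / f.eval s := rfl

/-- Expressions whose values exceed the numbers in the store by a bounded number of input lengths
only: the second factor of every product is read from the input. -/
def Tame : Expr → Prop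
  | .const _ => True
  | .var _ => True
  | .read _ e => e.Tame
  | .op o e f => e.Tame ∧ f.Tame ∧ (o = .mul → ∃ g, f = .read 0 g)

@[simp] theorem tame_const (c : ℕ) : (const c).Tame := trivial
@[simp] theorem tame_ofNat (c : ℕ) : (ofNat(c) : Expr).Tame := trivial
@[simp] theorem tame_var (x : ℕ) : (var x).Tame := trivial
@[simp] theorem tame_read (k : ℕ) (e : Expr) : (read k e).Tame ↔ e.Tame := Iff.rfl

@[simp] theorem tame_add (e f : Expr) : (e + f).Tame ↔ e.Tame ∧ f.Tame := by
  change (op .add e f).Tame ↔ _; simp [Tame]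

@[simp] theorem tame_sub (e f : Expr) : (e - f).Tame ↔ e.Tame ∧ f.Tame := by
  change (op .sub e f).Tame ↔ _; simp [Tame]

@[simp] theorem tame_div (e f : Expr) : (e / f).Tame ↔ e.Tame ∧ f.Tame := by
  change (op .div e f).Tame ↔ _; simp [Tame]

@[simp] theorem tame_mul_read (e f : Expr) : (e * read 0 f).Tame ↔ e.Tame ∧ f.Tame := by
  change (op .mul e (read 0 f)).Tame ↔ _; simp [Tame]

end Expr

/-- Programs all of whose loops run once for each `x < n`, where `n` is the first input number. -/
inductive Prog
  | skip
  | assign (x : ℕ) (e : Expr)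
  | write (k : ℕ) (i e : Expr)
  | seq (c d : Prog)
  | ite (e : Expr) (c d : Prog)
  | loop (x : ℕ) (c : Prog)

namespace Prog

/-- The state transformation computed by a program. -/
def run : Prog → Store → Store
  | skip, s => s
  | assign x e, s => s.setVar x (e.eval s)
  | write k i e, s => s.setArr k (i.eval s) (e.eval s)
  | seq c d, s => d.run (c.run s)
  | ite e c d, s => if e.eval s = 0 then d.run s else c.run s
  | loop x c, s => (fun s => (c.run s).setVar x ((c.run s).var x + 1))^[s.arr 0 0] (s.setVar x 0)

/-- The translation into programs of the random access machine. -/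
def compile : Prog → Cmd
  | skip => .skip
  | assign x e => .assign x e
  | write k i e => .write k i e
  | seq c d => .seq c.compile d.compile
  | ite e c d => .cond e c.compile d.compile
  | loop x c => .seq (.assign x 0)
      (.loop (.read 0 0 - .var x) (.seq c.compile (.assign x (.var x + 1))))

/-- The registers a program may change. -/
def modVars : Prog → List ℕ
  | skip => []
  | assign x _ => [x]
  | write _ _ _ => []
  | seq c d => c.modVars ++ d.modVars
  | ite _ c d => c.modVars ++ d.modVars
  | loop x c => x :: c.modVars

/-- The arrays a program may change. -/
def modArrs : Prog → List ℕ
  | skip => []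
  | assign _ _ => []
  | write k _ _ => [k]
  | seq c d => c.modArrs ++ d.modArrs
  | ite _ c d => c.modArrs ++ d.modArrs
  | loop _ c => c.modArrs

/-- Programs that run in polynomial time: expressions are tame, the input is never changed, and
neither are loop counters by the bodies of their loops. -/
def Tame : Prog → Prop
  | skip => True
  | assign _ e => e.Tame
  | write k i e => k ≠ 0 ∧ i.Tame ∧ e.Tame
  | seq c d => c.Tame ∧ d.Tame
  | ite e c d => e.Tame ∧ c.Tame ∧ d.Tame
  | loop x c => x ∉ c.modVars ∧ c.Tame

@[simp] theorem run_skip (s : Store) : skip.run s = s := rfl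

@[simp] theorem run_assign (x : ℕ) (e : Expr) (s : Store) :
    (assign x e).run s = s.setVar x (e.eval s) := rfl

@[simp] theorem run_write (k : ℕ) (i e : Expr) (s : Store) :
    (write k i e).run s = s.setArr k (i.eval s) (e.eval s) := rfl

@[simp] theorem run_ite (e : Expr) (c d : Prog) (s : Store) :
    (ite e c d).run s = if e.eval s = 0 then d.run s else c.run s := rfl

theorem run_var (c : Prog) (s : Store) {x : ℕ} (h : x ∉ c.modVars) :
    (c.run s).var x = s.var x := by
  induction c generalizing s with
  | skip => rfl
  | assign y e => simp_all [modVars]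
  | write k i e => simp
  | seq c d ihc ihd => simp_all [modVars, run]
  | ite e c d ihc ihd =>
    simp only [modVars, List.mem_append, not_or] at h
    rw [run_ite]
    split_ifs
    exacts [ihd s h.2, ihc s h.1]
  | loop y c ih =>
    simp only [modVars, List.mem_cons, not_or] at h
    have round : Semiconj (fun s : Store => s.var x)
        (fun s => (c.run s).setVar y ((c.run s).var y + 1)) id := fun s => by simp [h.1, ih s h.2]
    exact (round.iterate_right _ _).trans (by simp [h.1])

theorem run_arr (c : Prog) (s : Store) {k : ℕ} (h : k ∉ c.modArrs) :
    (c.run s).arr k = s.arr k := by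
  induction c generalizing s with
  | skip => rfl
  | assign y e => simp
  | write l i e => simp_all [modArrs]
  | seq c d ihc ihd => simp_all [modArrs, run]
  | ite e c d ihc ihd =>
    simp only [modArrs, List.mem_append, not_or] at h
    rw [run_ite]
    split_ifs
    exacts [ihd s h.2, ihc s h.1]
  | loop y c ih =>
    have round : Semiconj (fun s : Store => s.arr k)
        (fun s => (c.run s).setVar y ((c.run s).var y + 1)) id := fun s => ih s h
    exact (round.iterate_right _ _).trans (by simp)

theorem Tame.zero_notMem_modArrs {c : Prog} (h : c.Tame) : 0 ∉ c.modArrs := by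
  induction c with
  | skip | assign => simp [modArrs]
  | write k i e => simpa [modArrs] using h.1.symm
  | seq c d ihc ihd => simp [modArrs, ihc h.1, ihd h.2]
  | ite e c d ihc ihd => simp [modArrs, ihc h.2.1, ihd h.2.2]
  | loop x c ih => exact ih h.2

end Prog

/-! ### The running time of tame programs -/

open Polynomial

/-- All numbers in the store have at most `B` bits, those of the input at most `X` bits, and the
first input number is less than `X`. -/
structure Store.Within (s : Store) (X B : ℕ) : Prop where
  head_lt : s.arr 0 0 < X
  input : ∀ i, (s.arr 0 i).size ≤ X
  var : ∀ x, (s.var x).size ≤ B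
  arr : ∀ k i, (s.arr k i).size ≤ B

namespace Store.Within

variable {s : Store} {X B B' : ℕ}

theorem mono (h : s.Within X B) (hB : B ≤ B') : s.Within X B' :=
  ⟨h.head_lt, h.input, fun x => (h.var x).trans hB, fun k i => (h.arr k i).trans hB⟩

theorem setVar (h : s.Within X B) (x : ℕ) {v : ℕ} (hv : v.size ≤ B) :
    (s.setVar x v).Within X B := by
  refine ⟨h.head_lt, h.input, fun y => ?_, h.arr⟩
  rw [setVar_var]
  split_ifs
  exacts [hv, h.var y]

theorem setArr (h : s.Within X B) {k : ℕ} (hk : k ≠ 0) (i : ℕ) {v : ℕ} (hv : v.size ≤ B) :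
    (s.setArr k i v).Within X B := by
  refine ⟨by simpa [hk.symm] using h.head_lt, by simpa [hk.symm] using h.input, h.var,
    fun l j => ?_⟩
  rw [setArr_arr]
  split_ifs
  · rw [update_apply]
    split_ifs
    exacts [hv, h.arr k j]
  · exact h.arr l j

end Store.Within

theorem size_mul_le (a b : ℕ) : (a * b).size ≤ a.size + b.size := by
  rw [Nat.size_le, pow_add]
  exact Nat.mul_lt_mul'' a.lt_size_self b.lt_size_self

theorem size_add_le {a b B : ℕ} (ha : a.size ≤ B) (hb : b.size ≤ B) : (a + b).size ≤ B + 1 := by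
  rw [Nat.size_le] at *
  omega

theorem Op.size_eval_le {o : Op} (ho : o ≠ .mul) {a b B : ℕ} (ha : a.size ≤ B) (hb : b.size ≤ B) :
    (o.eval a b).size ≤ B + 1 := by
  cases o with
  | add => exact size_add_le ha hb
  | sub => exact (Nat.size_le_size (Nat.sub_le a b)).trans (by omega)
  | mul => exact absurd rfl ho
  | div => exact (Nat.size_le_size (Nat.div_le_self a b)).trans (by omega)

theorem Expr.Tame.exists_polynomial {e : Expr} (he : e.Tame) :
    ∃ p : ℕ[X], ∀ {s : Store} {X B : ℕ}, s.Within X B →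
      (e.eval s).size ≤ B + p.eval X ∧ e.cost s ≤ p.eval X * (B + 1) := by
  induction e with
  | const c =>
    refine ⟨C (1 + c.size), fun {s X B} _ => ?_⟩
    simp only [eval_const, cost, Polynomial.eval_C]
    exact ⟨by omega, Nat.le_mul_of_pos_right _ B.succ_pos⟩
  | var x =>
    refine ⟨1, fun {s X B} h => ?_⟩
    have hx := h.var x
    simp only [eval_var, cost, Polynomial.eval_one]
    omega
  | read k e ih =>
    obtain ⟨p, hp⟩ := ih he
    refine ⟨p + 1, fun {s X B} h => ?_⟩
    have hk := h.arr k (e.eval s)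
    have hcost := (hp h).2
    simp only [cost, eval_read, Polynomial.eval_add, Polynomial.eval_one, add_mul]
    omega
  | op o e f ihe ihf =>
    obtain ⟨he, hf, hmul⟩ := he
    obtain ⟨p, hp⟩ := ihe he
    obtain ⟨q, hq⟩ := ihf hf
    refine ⟨2 * p + 2 * q + X + 1, fun {s X B} h => ?_⟩
    obtain ⟨hpv, hpc⟩ := hp h
    obtain ⟨hqv, hqc⟩ := hq h
    have hvalue : ((Expr.op o e f).eval s).size ≤ B + (p.eval X + q.eval X + X) := by
      by_cases ho : o = .mul
      · obtain ⟨g, rfl⟩ := hmul ho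
        have := size_mul_le (e.eval s) (s.arr 0 (g.eval s))
        have := h.input (g.eval s)
        subst ho
        simp only [eval, Op.eval]
        omega
      · have hX := h.head_lt
        exact (Op.size_eval_le ho (B := B + (p.eval X + q.eval X)) (by omega) (by omega)).trans
          (by omega)
    simp only [cost, Polynomial.eval_add, Polynomial.eval_mul, Polynomial.eval_ofNat,
      Polynomial.eval_X, Polynomial.eval_one]
    constructor
    · omega
    · nlinarith [Nat.zero_le ((p.eval X + q.eval X + X) * B)]

/-- On every store within the bounds `X` and `B`, the program `c` halts with the result given by `f`
at cost at most `K * (B + 1)`, and all bit lengths grow by at most `K`. -/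
def Cmd.RunsWithin (c : Cmd) (f : Store → Store) (X K : ℕ) : Prop :=
  ∀ ⦃s : Store⦄ ⦃B : ℕ⦄, s.Within X B →
    ∃ t, Exec c s t (f s) ∧ t ≤ K * (B + 1) ∧ (f s).Within X (B + K)

namespace Cmd.RunsWithin

variable {c d : Cmd} {f g : Store → Store} {X K L E : ℕ}

theorem seq (hc : c.RunsWithin f X K) (hd : d.RunsWithin g X L) :
    (Cmd.seq c d).RunsWithin (g ∘ f) X (K + L + L * K) := by
  intro s B hs
  obtain ⟨t, hexec, ht, hs'⟩ := hc hs
  obtain ⟨t', hexec', ht', hs''⟩ := hd hs'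
  exact ⟨t + t', .seq hexec hexec', by nlinarith [Nat.zero_le (L * K * B)],
    hs''.mono (by nlinarith [Nat.zero_le (L * K)])⟩

theorem cond {e : Expr} (he : ∀ {s : Store} {B : ℕ}, s.Within X B → e.cost s ≤ E * (B + 1))
    (hc : c.RunsWithin f X K) (hd : d.RunsWithin g X L) :
    (Cmd.cond e c d).RunsWithin (fun s => if e.eval s = 0 then g s else f s) X
      (K + L + E + 1) := by
  intro s B hs
  have hcost := he hs
  dsimp only
  split_ifs with h
  · obtain ⟨t, hexec, ht, hs'⟩ := hd hs
    exact ⟨_, .cond_false h hexec, by nlinarith, hs'.mono (by omega)⟩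
  · obtain ⟨t, hexec, ht, hs'⟩ := hc hs
    exact ⟨_, .cond_true h hexec, by nlinarith, hs'.mono (by omega)⟩

theorem exec_loop {e : Expr} (he : ∀ {s : Store} {B : ℕ}, s.Within X B → e.cost s ≤ E * (B + 1))
    (hc : c.RunsWithin f X K) (hstep : ∀ s, e.eval (f s) = e.eval s - 1) {s : Store} {B : ℕ}
    (hs : s.Within X B) :
    ∃ t, Exec (.loop e c) s t (f^[e.eval s] s) ∧
      t ≤ (e.eval s + 1) * ((K + E + 1) * (B + e.eval s * K + 1)) ∧
      (f^[e.eval s] s).Within X (B + e.eval s * K) := by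
  generalize hm : e.eval s = m
  induction m generalizing s B with
  | zero =>
    have hcost := he hs
    exact ⟨_, .loop_false hm, by nlinarith, by simpa using hs⟩
  | succ m ih =>
    obtain ⟨t, hexec, ht, hs'⟩ := hc hs
    obtain ⟨t', hexec', ht', hs''⟩ := ih hs' (by rw [hstep, hm, Nat.add_sub_cancel])
    have hcost := he hs
    have hB : B + K + m * K = B + (m + 1) * K := by ring
    refine ⟨_, .loop_true (by omega) hexec hexec', ?_, by
      simpa only [iterate_succ_apply, hB] using hs''⟩
    rw [hB] at ht'
    have hround : 1 + e.cost s + t ≤ (K + E + 1) * (B + (m + 1) * K + 1) := by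
      nlinarith [Nat.zero_le ((K + E + 1) * ((m + 1) * K))]
    linarith

/-- The bit lengths grow by the same amount in each of the fewer than `X` rounds, so loops preserve
polynomial bounds. -/
theorem loop {e : Expr} (he : ∀ {s : Store} {B : ℕ}, s.Within X B → e.cost s ≤ E * (B + 1))
    (hlt : ∀ {s : Store} {B : ℕ}, s.Within X B → e.eval s < X) (hc : c.RunsWithin f X K)
    (hstep : ∀ s, e.eval (f s) = e.eval s - 1) :
    (Cmd.loop e c).RunsWithin (fun s => f^[e.eval s] s) X
      (X * ((K + E + 1) * (X * K + 1))) := by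
  intro s B hs
  obtain ⟨t, hexec, ht, hs'⟩ := hc.exec_loop he hstep hs
  have hm : e.eval s < X := hlt hs
  have hmK : e.eval s * K ≤ X * K := Nat.mul_le_mul_right K hm.le
  refine ⟨t, hexec, ?_, hs'.mono (Nat.add_le_add_left ?_ B)⟩
  · calc
      t ≤ (e.eval s + 1) * ((K + E + 1) * (B + e.eval s * K + 1)) := ht
      _ ≤ X * ((K + E + 1) * ((X * K + 1) * (B + 1))) := by
        gcongr
        · exact hm
        · nlinarith [Nat.zero_le (X * K * B)]
      _ = X * ((K + E + 1) * (X * K + 1)) * (B + 1) := by ring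
  · calc
      e.eval s * K ≤ X * (K * 1) := by simpa using hmK
      _ ≤ X * ((K + E + 1) * (X * K + 1)) := by gcongr <;> omega

end Cmd.RunsWithin

namespace Prog

theorem runsWithin_assign (x : ℕ) {e : Expr} (he : e.Tame) :
    ∃ p : ℕ[X], ∀ X, (Cmd.assign x e).RunsWithin (fun s => s.setVar x (e.eval s)) X (p.eval X) := by
  obtain ⟨p, hp⟩ := he.exists_polynomial
  refine ⟨p + 1, fun X s B hs => ⟨_, .assign s x e, ?_, ?_⟩⟩
  · have hcost := (hp hs).2
    simp only [eval_add, eval_one]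
    linarith
  · have hvalue := (hp hs).1
    simp only [eval_add, eval_one]
    exact (hs.mono (by omega)).setVar x (by omega)

theorem runsWithin_write {k : ℕ} (hk : k ≠ 0) {i e : Expr} (hi : i.Tame) (he : e.Tame) :
    ∃ p : ℕ[X], ∀ X, (Cmd.write k i e).RunsWithin (fun s => s.setArr k (i.eval s) (e.eval s)) X
      (p.eval X) := by
  obtain ⟨p, hp⟩ := hi.exists_polynomial
  obtain ⟨q, hq⟩ := he.exists_polynomial
  refine ⟨p + q + 1, fun X s B hs => ⟨_, .write s k i e, ?_, ?_⟩⟩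
  · have hcosti := (hp hs).2
    have hcoste := (hq hs).2
    simp only [eval_add, eval_one]
    linarith
  · have hvalue := (hq hs).1
    simp only [eval_add, eval_one]
    exact (hs.mono (by omega)).setArr hk _ (by omega)

theorem runsWithin_loop (x : ℕ) {c : Prog} (hx : x ∉ c.modVars) (hc : c.Tame)
    (h : ∃ p : ℕ[X], ∀ X, c.compile.RunsWithin c.run X (p.eval X)) :
    ∃ p : ℕ[X], ∀ X, (loop x c).compile.RunsWithin (loop x c).run X (p.eval X) := by
  obtain ⟨p, hp⟩ := h
  obtain ⟨q, hq⟩ := runsWithin_assign x (e := .var x + 1) (by simp)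
  obtain ⟨z, hz⟩ := runsWithin_assign x (e := 0) (by simp)
  obtain ⟨r, hr⟩ := Expr.Tame.exists_polynomial (e := .read 0 0 - .var x) (by simp)
  let k : ℕ[X] := p + q + q * p
  let l : ℕ[X] := X * ((k + r + 1) * (X * k + 1))
  have hcounter (s : Store) : (c.run s).var x = s.var x := run_var c s hx
  have hinput (s : Store) : (c.run s).arr 0 = s.arr 0 := run_arr c s hc.zero_notMem_modArrs
  have hrounds (Y : ℕ) := ((hp Y).seq (hq Y)).loop (fun h => (hr h).2)
    (fun h => lt_of_le_of_lt (Nat.sub_le _ _) h.head_lt)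
    (fun s => by simp [hcounter, hinput]; omega)
  refine ⟨z + l + l * z, fun Y => ?_⟩
  convert (hz Y).seq (hrounds Y) using 1
  · rfl
  · funext s
    simp only [run, comp_apply, Expr.eval_sub, Expr.eval_read, Expr.eval_ofNat, Store.setVar_arr,
      Expr.eval_var, Store.setVar_var, if_true, Nat.sub_zero]
    rfl
  · simp [k, l]

theorem Tame.runsWithin {c : Prog} (hc : c.Tame) :
    ∃ p : ℕ[X], ∀ X, c.compile.RunsWithin c.run X (p.eval X) := by
  induction c with
  | skip => exact ⟨1, fun X s B hs => ⟨1, .skip s, by simp, hs.mono (by omega)⟩⟩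
  | assign x e => exact runsWithin_assign x hc
  | write k i e => exact runsWithin_write hc.1 hc.2.1 hc.2.2
  | seq c d ihc ihd =>
    obtain ⟨p, hp⟩ := ihc hc.1
    obtain ⟨q, hq⟩ := ihd hc.2
    exact ⟨p + q + q * p, fun X => by
      simp only [Polynomial.eval_add, Polynomial.eval_mul]
      exact (hp X).seq (hq X)⟩
  | ite e c d ihc ihd =>
    obtain ⟨r, hr⟩ := Expr.Tame.exists_polynomial (e := e) hc.1
    obtain ⟨p, hp⟩ := ihc hc.2.1
    obtain ⟨q, hq⟩ := ihd hc.2.2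
    exact ⟨p + q + r + 1, fun X => by
      simp only [Polynomial.eval_add, Polynomial.eval_one]
      exact Cmd.RunsWithin.cond (fun h => (hr h).2) (hp X) (hq X)⟩
  | loop x c ih => exact runsWithin_loop x hc.1 hc.2 (ih hc.2)

end Prog

end RAM

/-! ### The Hungarian method -/

namespace Assignment

variable {ι κ : Type*}

/-- `m` is a matching of the rows in `R` to columns, given by the row `m j` matched to the column
`j`, if any. -/
structure IsMatching (m : κ → Option ι) (R : Set ι) : Prop where
  exists_iff : ∀ i, (∃ j, m j = some i) ↔ i ∈ R
  inj : ∀ {i j j'}, m j = some i → m j' = some i → j = j'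

/-- The matching `m` is tight for the dual solution `u`, `v` of the assignment problem with weights
`a`. -/
def Tight (a : ι → κ → ℕ) (u : ι → ℕ) (v : κ → ℕ) (m : κ → Option ι) : Prop :=
  ∀ i j, m j = some i → a i j = u i + v j

/-- `p` is a matching of the rows in `R`, and complementary slackness with the dual solution `u`,
`v` certifies that its weight is maximal. -/
structure Optimal (R : Set ι) (a : ι → κ → ℕ) (u : ι → ℕ) (v : κ → ℕ) (p : κ → Option ι) :
    Prop where
  le : ∀ i j, a i j ≤ u i + v j
  free : ∀ j, p j = none → v j = 0
  matching : IsMatching p R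
  tight : Tight a u v p

/-- The search for a path from the row `r` augmenting the matching `p`: `S` and `T` are the rows
and columns reached, and `m i` is the matching obtained from `p` by matching `r` and exposing the
row `i` of `S` along an alternating path. -/
structure Search (R : Set ι) (r : ι) (a : ι → κ → ℕ) (p : κ → Option ι) (u : ι → ℕ) (v : κ → ℕ)
    (S : Set ι) (T : Set κ) (m : ι → κ → Option ι) : Prop where
  le : ∀ i j, a i j ≤ u i + v j
  free : ∀ j, p j = none → v j = 0
  matching : IsMatching p R
  notMem : r ∉ R
  matched : ∀ j ∈ T, p j ≠ none
  mem_iff : ∀ i, i ∈ S ↔ i = r ∨ ∃ j ∈ T, p j = some i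
  exposed : ∀ i ∈ S, IsMatching (m i) (insert r R \ {i})
  tight : ∀ i ∈ S, Tight a u v (m i)
  eq_none_iff : ∀ i ∈ S, ∀ j, m i j = none ↔ p j = none
  outside : ∀ i ∈ S, ∀ j ∉ T, m i j = p j
  inside : ∀ i ∈ S, ∀ j ∈ T, ∀ k, m i j = some k → k ∈ S

/-- `(i, j)` is a pair of least slack `δ` among the rows in `S` and the columns outside `T`. -/
structure MinSlack (a : ι → κ → ℕ) (u : ι → ℕ) (v : κ → ℕ) (S : Set ι) (T : Set κ)
    (i : ι) (j : κ) (δ : ℕ) : Prop where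
  row_mem : i ∈ S
  col_notMem : j ∉ T
  eq : δ = u i + v j - a i j
  le : ∀ i' ∈ S, ∀ j' ∉ T, δ ≤ u i' + v j' - a i' j'

section IsMatching

variable {m : κ → Option ι} {R : Set ι}

theorem IsMatching.update [DecidableEq κ] (h : IsMatching m R) {i : ι} (hi : i ∉ R) (j : κ) :
    IsMatching (update m j (some i)) (insert i (R \ {k | m j = some k})) where
  exists_iff k := by
    simp only [update_apply, Set.mem_insert_iff, Set.mem_sdiff, Set.mem_ofPred_eq]
    constructor
    · rintro ⟨l, hl⟩
      split_ifs at hl with hlj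
      · exact .inl (Option.some.inj hl).symm
      · exact .inr ⟨(h.exists_iff k).1 ⟨l, hl⟩, fun hjk => hlj (h.inj hl hjk)⟩
    · rintro (rfl | ⟨hk, hjk⟩)
      · exact ⟨j, if_pos rfl⟩
      · obtain ⟨l, hl⟩ := (h.exists_iff k).2 hk
        exact ⟨l, by rwa [if_neg]; rintro rfl; exact hjk hl⟩
  inj {k l l'} hl hl' := by
    have hne : ∀ l, m l ≠ some i := fun l hl => hi ((h.exists_iff i).1 ⟨l, hl⟩)
    simp only [update_apply] at hl hl'
    split_ifs at hl hl' with hlj hlj' hlj'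
    · rw [hlj, hlj']
    · exact absurd (hl'.trans hl.symm) (hne l')
    · exact absurd (hl.trans hl'.symm) (hne l)
    · exact h.inj hl hl'

theorem IsMatching.exists_eq_none [Finite ι] (hcard : Nat.card ι ≤ Nat.card κ)
    (h : IsMatching m R) {r : ι} (hr : r ∉ R) : ∃ j, m j = none := by
  by_contra! hm
  choose f hf using fun j => Option.ne_none_iff_exists'.1 (hm j)
  have hinj : Injective f := fun j j' hjj' => h.inj (hf j) (by rw [hf j', hjj'])
  obtain ⟨j, hj⟩ := (hinj.bijective_of_nat_card_le hcard).surjective r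
  exact hr ((h.exists_iff r).1 ⟨j, by rw [hf, hj]⟩)

end IsMatching

theorem Tight.update [DecidableEq κ] {a : ι → κ → ℕ} {u : ι → ℕ} {v : κ → ℕ} {m : κ → Option ι}
    (h : Tight a u v m) {i : ι} {j : κ} (hij : a i j = u i + v j) :
    Tight a u v (update m j (some i)) := by
  intro k l hl
  rw [update_apply] at hl
  split_ifs at hl with hlj
  · obtain rfl := Option.some.inj hl
    rwa [hlj]
  · exact h k l hl

variable {R : Set ι} {r : ι} {a : ι → κ → ℕ} {p : κ → Option ι} {u : ι → ℕ} {v : κ → ℕ}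
  {S : Set ι} {T : Set κ} {m : ι → κ → Option ι}

theorem Optimal.search (h : Optimal R a u v p) (hr : r ∉ R) (hm : m r = p) :
    Search R r a p u v {r} ∅ m where
  le := h.le
  free := h.free
  matching := h.matching
  notMem := hr
  matched _ hj := hj.elim
  mem_iff i := by simp
  exposed i hi := by
    obtain rfl := hi
    simpa only [hm, Set.insert_sdiff_of_mem, Set.mem_singleton_iff,
      Set.sdiff_singleton_eq_self hr] using h.matching
  tight i hi := by
    obtain rfl := hi
    exact hm ▸ h.tight
  eq_none_iff i hi j := by
    obtain rfl := hi
    rw [hm]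
  outside i hi j _ := by
    obtain rfl := hi
    rw [hm]
  inside _ _ _ hj := hj.elim

/-- Strong duality. -/
theorem Optimal.sum_eq [Fintype ι] [Fintype κ] (h : Optimal Set.univ a u v p) :
    ∑ j, (p j).elim 0 (a · j) = ∑ i, u i + ∑ j, v j := by
  have hcol : ∀ j, (p j).elim 0 (a · j) = (p j).elim 0 u + v j := by
    intro j
    cases hj : p j with
    | none => simp [h.free j hj]
    | some i => exact h.tight i j hj
  have hrow : ∑ j, (p j).elim 0 u = ∑ i, u i := by
    choose q hq using fun i => (h.matching.exists_iff i).2 (Set.mem_univ i)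
    have hinj : Injective q := fun i i' hii' => Option.some.inj (by rw [← hq, ← hq, hii'])
    refine (Finset.sum_of_injOn q hinj.injOn (fun _ _ => Finset.mem_univ _) (fun j _ hj => ?_)
      fun i _ => by simp [hq]).symm
    cases hi : p j with
    | none => rfl
    | some i => exact (hj ⟨i, by simp, h.matching.inj (hq i) hi⟩).elim
  rw [Finset.sum_congr rfl fun j _ => hcol j, Finset.sum_add_distrib, hrow]

namespace Search

theorem mem_insert (h : Search R r a p u v S T m) {i : ι} (hi : i ∈ S) : i ∈ insert r R := by
  obtain rfl | ⟨j, -, hj⟩ := (h.mem_iff i).1 hi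
  exacts [.inl rfl, .inr ((h.matching.exists_iff i).1 ⟨j, hj⟩)]

theorem notMem_of_notMem (h : Search R r a p u v S T m) {j : κ} (hj : j ∉ T) {k : ι}
    (hk : p j = some k) : k ∉ S := by
  intro hkS
  obtain rfl | ⟨j', hj', hk'⟩ := (h.mem_iff k).1 hkS
  · exact h.notMem ((h.matching.exists_iff k).1 ⟨j, hk⟩)
  · exact hj (h.matching.inj hk hk' ▸ hj')

section MinSlack

variable [Finite ι]

theorem exists_free (hcard : Nat.card ι ≤ Nat.card κ) (h : Search R r a p u v S T m) :
    ∃ j ∉ T, p j = none := by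
  obtain ⟨j, hj⟩ := h.matching.exists_eq_none hcard h.notMem
  exact ⟨j, fun hT => h.matched j hT hj, hj⟩

theorem ncard_lt [Finite κ] (hcard : Nat.card ι ≤ Nat.card κ) (h : Search R r a p u v S T m) :
    T.ncard < Nat.card κ := by
  obtain ⟨j, hj, -⟩ := h.exists_free hcard
  exact Set.ncard_lt_card fun hT => hj (hT ▸ Set.mem_univ j)

variable {i : ι} {j : κ} {δ : ℕ}

theorem le_of_minSlack (hcard : Nat.card ι ≤ Nat.card κ) (h : Search R r a p u v S T m)
    (hδ : MinSlack a u v S T i j δ) {k : ι} (hk : k ∈ S) : δ ≤ u k := by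
  obtain ⟨l, hl, hfree⟩ := h.exists_free hcard
  have := hδ.le k hk l hl
  have := h.free l hfree
  omega

open Classical in
/-- Decreasing the dual variables of `S` and increasing those of `T` by the least slack makes the
chosen pair tight. -/
theorem dualUpdate (hcard : Nat.card ι ≤ Nat.card κ) (h : Search R r a p u v S T m)
    (hδ : MinSlack a u v S T i j δ) {u' : ι → ℕ} {v' : κ → ℕ}
    (hu : ∀ k, u' k = if k ∈ S then u k - δ else u k)
    (hv : ∀ l, v' l = if l ∈ T then v l + δ else v l) :
    Search R r a p u' v' S T m ∧ a i j = u' i + v' j := by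
  have hle {k : ι} (hk : k ∈ S) : δ ≤ u k := h.le_of_minSlack hcard hδ hk
  refine ⟨{ h with
    le := fun k l => ?_, free := fun l hl => ?_, tight := fun i hi k l hl => ?_ }, ?_⟩
  · have := h.le k l
    rw [hu, hv]
    split_ifs with hk hl hl
    · have := hle hk
      omega
    · have := hle hk
      have := hδ.le k hk l hl
      omega
    all_goals omega
  · rw [hv, if_neg fun hT => h.matched l hT hl, h.free l hl]
  · rw [hu, hv, h.tight i hi k l hl]
    by_cases hT : l ∈ T
    · have hk := h.inside i hi l hT k hl
      have := hle hk
      rw [if_pos hT, if_pos hk]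
      omega
    · rw [if_neg hT, if_neg (h.notMem_of_notMem hT (h.outside i hi l hT ▸ hl))]
  · rw [hu, hv, if_pos hδ.row_mem, if_neg hδ.col_notMem]
    have := h.le i j
    have := hle hδ.row_mem
    have := hδ.eq
    omega

end MinSlack

variable {i k : ι} {j : κ}

theorem isMatching_update_exposed [DecidableEq κ] (h : Search R r a p u v S T m) (hi : i ∈ S)
    (hki : k ≠ i) (hmij : m i j = some k) :
    IsMatching (update (m i) j (some i)) (insert r R \ {k}) := by
  convert (h.exposed i hi).update (i := i) (by simp) j using 1
  ext l
  have := h.mem_insert hi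
  simp only [hmij]
  grind

theorem mem_of_update_exposed [DecidableEq κ] (h : Search R r a p u v S T m) (hi : i ∈ S)
    {j' : κ} (hj' : j' ∈ insert j T) {l : ι} (hl : update (m i) j (some i) j' = some l) :
    l ∈ S := by
  rw [update_apply] at hl
  split_ifs at hl with hjj'
  · exact Option.some.inj hl ▸ hi
  · exact h.inside i hi j' (hj'.resolve_left hjj') l hl

/-- Exchanging `i` for its partner `k` in the matching that exposes `i` exposes `k`. -/
theorem grow [DecidableEq ι] [DecidableEq κ] (h : Search R r a p u v S T m) (hi : i ∈ S)
    (hj : j ∉ T) (hij : a i j = u i + v j) (hk : p j = some k) :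
    Search R r a p u v (insert k S) (insert j T)
      (update m k (update (m i) j (some i))) := by
  have hkS : k ∉ S := h.notMem_of_notMem hj hk
  have hmij : m i j = some k := (h.outside i hi j hj).trans hk
  have hold {l : ι} (hl : l ∈ S) :
      update m k (update (m i) j (some i)) l = m l := update_of_ne (by rintro rfl; exact hkS hl) _ _
  refine { h with
    matched := ?_, mem_iff := fun l => ?_, exposed := ?_, tight := ?_, eq_none_iff := ?_,
    outside := ?_, inside := ?_ }
  · rintro l (rfl | hl)
    exacts [by simp [hk], h.matched l hl]
  · simp only [Set.mem_insert_iff, exists_eq_or_imp, h.mem_iff l, hk, Option.some.injEq]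
    tauto
  · rintro l (rfl | hl)
    · simpa only [update_self] using
        h.isMatching_update_exposed hi (by rintro rfl; exact hkS hi) hmij
    · simpa only [hold hl] using h.exposed l hl
  · rintro l (rfl | hl)
    · simpa only [update_self] using (h.tight i hi).update hij
    · simpa only [hold hl] using h.tight l hl
  · rintro l (rfl | hl) j'
    · rw [update_self, update_apply]
      split_ifs with hj'
      · simp [hj', hk]
      · exact h.eq_none_iff i hi j'
    · rw [hold hl]
      exact h.eq_none_iff l hl j'
  · rintro l (rfl | hl) j' hj'
    · rw [update_self, update_of_ne (fun e => hj' (.inl e))]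
      exact h.outside i hi j' fun hT => hj' (.inr hT)
    · rw [hold hl]
      exact h.outside l hl j' fun hT => hj' (.inr hT)
  · rintro l (rfl | hl) j' hj' k' hk'
    · rw [update_self] at hk'
      exact .inr (h.mem_of_update_exposed hi hj' hk')
    · rw [hold hl] at hk'
      obtain rfl | hT := hj'
      · rw [h.outside l hl _ hj, hk] at hk'
        exact .inl (Option.some.inj hk').symm
      · exact .inr (h.inside l hl j' hT k' hk')

theorem augment [DecidableEq κ] (h : Search R r a p u v S T m) (hi : i ∈ S)
    (hij : a i j = u i + v j) (hj : p j = none) :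
    Optimal (insert r R) a u v (update (m i) j (some i)) where
  le := h.le
  free l hl := by
    rw [update_apply] at hl
    split_ifs at hl
    exact h.free l ((h.eq_none_iff i hi l).1 hl)
  matching := by
    convert (h.exposed i hi).update (i := i) (by simp) j using 1
    have := h.mem_insert hi
    simp [(h.eq_none_iff i hi j).2 hj, Set.insert_eq_of_mem this]
  tight := (h.tight i hi).update hij

end Search

end Assignment

namespace RAM

/-! ### Loops -/

namespace Prog

/-- The stores `s` and `t` differ only in registers and arrays that the program `c` may change. -/
structure Frame (c : Prog) (s t : Store) : Prop where
  var : ∀ {x}, x ∉ c.modVars → t.var x = s.var x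
  arr : ∀ {k}, k ∉ c.modArrs → t.arr k = s.arr k

theorem frame_run (c : Prog) (s : Store) : c.Frame s (c.run s) := ⟨run_var c s, run_arr c s⟩

theorem Frame.of_loop_body {x : ℕ} {c : Prog} {s t u : Store} (h : (loop x c).Frame s t)
    (h' : (loop x c).Frame t u) : (loop x c).Frame s u :=
  ⟨fun hy => (h'.var hy).trans (h.var hy), fun hk => (h'.arr hk).trans (h.arr hk)⟩

section Loop

variable {x y : ℕ} {c : Prog} {s : Store} {n : ℕ}

theorem run_loop_induct (hn : s.arr 0 0 = n) (P : ℕ → Store → Prop)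
    (hP : ∀ m t v, P m t → P m (t.setVar x v)) (start : P 0 s)
    (step : ∀ (i : Fin n) (t : Store), (loop x c).Frame s t → t.var x = i → P i t →
      P (i + 1) (c.run t))
    (hx : x ∉ c.modVars := by decide) :
    P n ((loop x c).run s) := by
  have key : ∀ m ≤ n, ∃ t, t = (fun s => (c.run s).setVar x ((c.run s).var x + 1))^[m]
      (s.setVar x 0) ∧ (loop x c).Frame s t ∧ t.var x = m ∧ P m t := by
    intro m hm
    induction m with
    | zero =>
      refine ⟨_, rfl, ⟨fun hy => ?_, fun _ => rfl⟩, by simp, hP _ _ _ start⟩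
      simp_all [modVars]
    | succ m ih =>
      obtain ⟨t, ht, hf, hv, h⟩ := ih (by omega)
      refine ⟨_, rfl, ?_, ?_, ?_⟩ <;> rw [iterate_succ_apply', ← ht]
      · refine ⟨fun hy => ?_, fun hk => (run_arr c t hk).trans (hf.arr hk)⟩
        obtain ⟨hyx, hyc⟩ := not_or.1 (List.mem_cons.not.1 hy)
        rw [Store.setVar_var, if_neg hyx, run_var c t hyc, hf.var hy]
      · simp [run_var c t hx, hv]
      · exact hP _ _ _ (step ⟨m, hm⟩ t hf hv h)
  obtain ⟨t, ht, -, -, h⟩ := key n le_rfl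
  rwa [run, hn, ← ht]

theorem run_loop_forall (hn : s.arr 0 0 = n) (Inv : Store → Prop) (Q : Fin n → Store → Prop)
    (hInv : ∀ t v, Inv t → Inv (t.setVar x v)) (hQ : ∀ i t v, Q i t → Q i (t.setVar x v))
    (start : Inv s)
    (body : ∀ (i : Fin n) (t : Store), (loop x c).Frame s t → t.var x = i → Inv t →
      Inv (c.run t) ∧ Q i (c.run t) ∧ ∀ i' ≠ i, Q i' t → Q i' (c.run t))
    (hx : x ∉ c.modVars := by decide) :
    Inv ((loop x c).run s) ∧ ∀ i, Q i ((loop x c).run s) := by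
  have main := run_loop_induct hn (fun m t => Inv t ∧ ∀ i : Fin n, i < m → Q i t)
    (fun m t v h => ⟨hInv t v h.1, fun i hi => hQ i t v (h.2 i hi)⟩)
    ⟨start, fun i hi => absurd hi (by simp)⟩ (fun i t ht hi h => ?_) hx
  · exact ⟨main.1, fun i => main.2 i i.2⟩
  · obtain ⟨hI', hi', hother⟩ := body i t ht hi h.1
    refine ⟨hI', fun i' hlt => ?_⟩
    by_cases hne : i' = i
    · exact hne ▸ hi'
    · exact hother i' hne (h.2 i' (by omega))

theorem run_loop_loop_forall (hn : s.arr 0 0 = n) (Inv : Store → Prop)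
    (Q : Fin n → Fin n → Store → Prop)
    (hInvx : ∀ t v, Inv t → Inv (t.setVar x v)) (hInvy : ∀ t v, Inv t → Inv (t.setVar y v))
    (hQx : ∀ i j t v, Q i j t → Q i j (t.setVar x v))
    (hQy : ∀ i j t v, Q i j t → Q i j (t.setVar y v))
    (start : Inv s)
    (body : ∀ (i j : Fin n) (t : Store), (loop x (loop y c)).Frame s t → t.var x = i →
      t.var y = j → Inv t → Inv (c.run t) ∧ Q i j (c.run t) ∧
        ∀ i' j', (i', j') ≠ (i, j) → Q i' j' t → Q i' j' (c.run t))
    (hx : x ∉ (loop y c).modVars := by decide) (hy : y ∉ c.modVars := by decide)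
    (h0 : 0 ∉ c.modArrs := by decide) :
    Inv ((loop x (loop y c)).run s) ∧ ∀ i j, Q i j ((loop x (loop y c)).run s) := by
  obtain ⟨hxy, -⟩ := not_or.1 (List.mem_cons.not.1 hx)
  refine run_loop_forall hn Inv (fun i t => ∀ j, Q i j t) hInvx
    (fun i t v h j => hQx i j t v (h j)) start (fun i t ht hi hI => ?_) hx
  have main := run_loop_forall (x := y) (c := c) (s := t)
    (by rw [ht.arr h0, hn])
    (fun u => u.var x = i ∧ Inv u ∧ ∀ i' ≠ i, (∀ j, Q i' j t) → ∀ j, Q i' j u) (Q i)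
    (fun u v ⟨h1, h2, h3⟩ => ⟨by simpa [hxy] using h1, hInvy u v h2,
      fun i' hi' h j => hQy i' j u v (h3 i' hi' h j)⟩)
    (hQy i) ⟨hi, hI, fun _ _ h => h⟩ (fun j u hu hj hu' => ?_) hy
  · exact ⟨main.1.2.1, main.2, main.1.2.2⟩
  · obtain ⟨hui, huI, hother⟩ := hu'
    have hfr : (loop x (loop y c)).Frame s u :=
      ht.of_loop_body ⟨fun h => hu.var fun h' => h (List.mem_cons_of_mem _ h'), hu.arr⟩
    obtain ⟨hI', hij, hrest⟩ := body i j u hfr hui hj huI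
    refine ⟨⟨?_, hI', fun i' hi' h j' => hrest i' j' (by simp [hi']) (hother i' hi' h j')⟩, hij,
      fun j' hj' => hrest i j' (by simp [hj'])⟩
    rw [run_var c u fun h => hx (List.mem_cons_of_mem _ h), hui]

theorem run_loop_map (hn : s.arr 0 0 = n) (k : ℕ) (g : Fin n → ℕ) (hg : Injective g)
    (f : Fin n → ℕ → ℕ)
    (body : ∀ (i : Fin n) (t : Store), (loop x c).Frame s t → t.var x = i →
      (∀ l, (∀ i, l ≠ g i) → t.arr k l = s.arr k l) →
      (c.run t).arr k = update (t.arr k) (g i) (f i (t.arr k (g i))))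
    (hx : x ∉ c.modVars := by decide) :
    (∀ i, ((loop x c).run s).arr k (g i) = f i (s.arr k (g i))) ∧
      ∀ l, (∀ i, l ≠ g i) → ((loop x c).run s).arr k l = s.arr k l := by
  have main := run_loop_induct hn
    (fun m t => (∀ i : Fin n, i < m → t.arr k (g i) = f i (s.arr k (g i))) ∧
      (∀ i : Fin n, m ≤ i → t.arr k (g i) = s.arr k (g i)) ∧
      ∀ l, (∀ i, l ≠ g i) → t.arr k l = s.arr k l)
    (fun _ _ _ h => h) ⟨fun i hi => absurd hi (by simp), fun _ _ => rfl, fun _ _ => rfl⟩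
    (fun i t ht hi h => ?_) hx
  · exact ⟨fun i => main.1 i i.2, main.2.2⟩
  · obtain ⟨hdone, htodo, hrest⟩ := h
    rw [body i t ht hi hrest, htodo i le_rfl]
    refine ⟨fun i' hlt => ?_, fun i' hle => ?_, fun l hl => ?_⟩
    · obtain rfl | hne := eq_or_ne i' i
      · rw [update_self]
      · rw [update_of_ne (hg.ne hne), hdone i' (by omega)]
    · rw [update_of_ne (hg.ne (by omega)), htodo i' (by omega)]
    · rw [update_of_ne (hl i), hrest l hl]

end Loop

end Prog

/-! ### The registers and arrays of the algorithm -/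

namespace Reg

abbrev i : ℕ := 2
abbrev j : ℕ := 3
abbrev k : ℕ := 4
abbrev root : ℕ := 5
abbrev step : ℕ := 6
abbrev done : ℕ := 7
abbrev found : ℕ := 8
abbrev slack : ℕ := 9
abbrev row : ℕ := 10
abbrev col : ℕ := 11
abbrev partner : ℕ := 12
abbrev source : ℕ := 13
abbrev target : ℕ := 14
abbrev differ : ℕ := 15
abbrev multiple : ℕ := 16
abbrev blocks : ℕ := 17

end Reg

namespace Arr

abbrev comp : ℕ := 2
abbrev colour : ℕ := 3
abbrev weight : ℕ := 4
abbrev rowDual : ℕ := 5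
abbrev colDual : ℕ := 6
abbrev matching : ℕ := 7
abbrev rows : ℕ := 8
abbrev cols : ℕ := 9
/-- Row `i` of this array is the matching exposing the row `i` in `Assignment.Search`. -/
abbrev exposing : ℕ := 10
abbrev mate : ℕ := 11

end Arr

theorem matPos_inj {n : ℕ} {i j i' j' : Fin n} :
    (i : ℕ) * n + j = i' * n + j' ↔ i = i' ∧ j = j' := by
  refine ⟨fun h => ?_, by rintro ⟨rfl, rfl⟩; rfl⟩
  have hpos : 0 < n := j.pos
  have hi : (i : ℕ) = i' := by
    simpa [Nat.mul_comm _ n, Nat.mul_add_div hpos, Nat.div_eq_of_lt] using congrArg (· / n) h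
  exact ⟨Fin.ext hi, Fin.ext (by simpa [hi] using h)⟩

namespace Store

/-- The first `n` entries of array `k`. -/
def vec (s : Store) (k : ℕ) {n : ℕ} (i : Fin n) : ℕ := s.arr k i

/-- The first `n * n` entries of array `k`, read as a matrix in row-major order. -/
def mat (s : Store) (k : ℕ) {n : ℕ} (i j : Fin n) : ℕ := s.arr k (i * n + j)

theorem vec_setArr (s : Store) (k : ℕ) {n : ℕ} (i : Fin n) (v : ℕ) :
    (s.setArr k i v).vec k = update (s.vec k) i v := by
  ext i'
  simp [vec, update_apply, Fin.val_inj]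

theorem mat_setArr (s : Store) (k : ℕ) {n : ℕ} (i j : Fin n) (v : ℕ) :
    (s.setArr k (i * n + j) v).mat k = update (s.mat k) i (update (s.mat k i) j v) := by
  ext i' j'
  obtain rfl | hi := eq_or_ne i' i
  · simp [mat, update_apply, Fin.val_inj]
  · rw [update_of_ne hi, mat, setArr_arr, if_pos rfl,
      update_of_ne fun h => hi (matPos_inj.1 h).1, mat]

end Store

namespace Prog

variable {c : Prog} {s t : Store} {n : ℕ}

theorem Frame.vec (h : c.Frame s t) (k : ℕ) (hk : k ∉ c.modArrs := by decide) :
    (t.vec k : Fin n → ℕ) = s.vec k := by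
  ext
  rw [Store.vec, h.arr hk, Store.vec]

theorem Frame.mat (h : c.Frame s t) (k : ℕ) (hk : k ∉ c.modArrs := by decide) :
    (t.mat k : Fin n → Fin n → ℕ) = s.mat k := by
  ext
  rw [Store.mat, h.arr hk, Store.mat]

end Prog

/-- The absolute value of the numerator of entry `(i, j)` of the `n × n` matrix encoded by `x`. -/
def entryNum (x : ℕ → ℕ) {n : ℕ} (i j : Fin n) : ℕ := x (3 * (i * n + j) + 2)

/-- The denominator of entry `(i, j)` of the `n × n` matrix encoded by `x`. -/
def entryDen (x : ℕ → ℕ) {n : ℕ} (i j : Fin n) : ℕ := x (3 * (i * n + j) + 3)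

namespace Expr

variable (s : Store) (e f : Expr)

/-- Nonzero if and only if the values differ. -/
def ne : Expr := (e - f) + (f - e)

/-- The position of entry `(e, f)` of an `n × n` matrix in row-major order. -/
def idx : Expr := e * read 0 0 + f

/-- The absolute value of the numerator of the entry at a position of the input matrix. -/
def numer : Expr := read 0 (e + e + e + 2)

/-- The denominator of the entry at a position of the input matrix. -/
def denom : Expr := read 0 (e + e + e + 3)

@[simp] theorem eval_ne_eq_zero : (ne e f).eval s = 0 ↔ e.eval s = f.eval s := by
  simp only [ne, eval_add, eval_sub]; omega

@[simp] theorem eval_idx : (idx e f).eval s = e.eval s * s.arr 0 0 + f.eval s := rfl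

@[simp] theorem eval_numer : (numer e).eval s = s.arr 0 (3 * e.eval s + 2) := by
  simp only [numer, eval_read, eval_add, eval_ofNat]; congr 1; omega

@[simp] theorem eval_denom : (denom e).eval s = s.arr 0 (3 * e.eval s + 3) := by
  simp only [denom, eval_read, eval_add, eval_ofNat]; congr 1; omega

@[simp] theorem tame_ne : (ne e f).Tame ↔ e.Tame ∧ f.Tame := by
  simp only [ne, tame_add, tame_sub]; tauto

@[simp] theorem tame_idx : (idx e f).Tame ↔ e.Tame ∧ f.Tame := by simp [idx]

@[simp] theorem tame_numer : (numer e).Tame ↔ e.Tame := by simp [numer]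

@[simp] theorem tame_denom : (denom e).Tame ↔ e.Tame := by simp [denom]

@[simp] theorem tame_mul_numer : (e * numer f).Tame ↔ e.Tame ∧ f.Tame := by simp [numer]

@[simp] theorem tame_mul_denom : (e * denom f).Tame ↔ e.Tame ∧ f.Tame := by simp [denom]

end Expr

namespace Prog

open RAM.Expr

/-- Execution of a list of programs one after the other. -/
def block : List Prog → Prog
  | [] => skip
  | c :: l => seq c (block l)

@[simp] theorem run_block_nil (s : Store) : (block []).run s = s := rfl

@[simp] theorem run_block_cons (c : Prog) (l : List Prog) (s : Store) :
    (block (c :: l)).run s = (block l).run (c.run s) := rfl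

end Prog
end RAM

/-! ### Two-colouring a bipartite graph -/

namespace RAM
namespace Prog

open RAM.Expr

/-- Exchange the colour of the vertex `k` of the component `source` unless `differ` is nonzero. -/
def recolourVertex : Prog :=
  ite (ne (read Arr.comp (var Reg.k)) (var Reg.source)) skip <|
    ite (var Reg.differ) skip <|
      write Arr.colour (var Reg.k) (1 - read Arr.colour (var Reg.k))

/-- Move the vertex `k` of the component `source` to the component `target`. -/
def moveVertex : Prog :=
  ite (ne (read Arr.comp (var Reg.k)) (var Reg.source)) skip <|
    write Arr.comp (var Reg.k) (var Reg.target)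

/-- Merge the components of the vertices `i` and `j`. -/
def merge : Prog := block
  [assign Reg.target (read Arr.comp (var Reg.i)), assign Reg.source (read Arr.comp (var Reg.j)),
    assign Reg.differ
      (ne (1 - read Arr.colour (var Reg.i)) (1 - read Arr.colour (var Reg.j))),
    loop Reg.k recolourVertex, loop Reg.k moveVertex]

/-- Merge the components of the vertices `i` and `j` if they interact. -/
def mergeAdjacent : Prog :=
  ite (numer (idx (var Reg.i) (var Reg.j))) (ite (ne (var Reg.i) (var Reg.j)) merge skip) skip

/-- Colour the vertices such that the two ends of every interaction are distinguished by whether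
their colours are zero. -/
def colour : Prog := block
  [loop Reg.i (write Arr.comp (var Reg.i) (var Reg.i)), loop Reg.i (loop Reg.j mergeAdjacent)]

variable {n : ℕ} {s : Store}

theorem vec_loop_moveVertex (hn : s.arr 0 0 = n) (v : Fin n) :
    ((loop Reg.k moveVertex).run s).vec Arr.comp v =
      if s.vec Arr.comp v = s.var Reg.source then s.var Reg.target else s.vec Arr.comp v := by
  refine (run_loop_map (c := moveVertex) hn Arr.comp (fun v => v) Fin.val_injective
    (fun _ a => if a = s.var Reg.source then s.var Reg.target else a) fun v t ht hv _ => ?_).1 v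
  have hsource := ht.var (x := Reg.source) (by decide)
  have htarget := ht.var (x := Reg.target) (by decide)
  by_cases h : t.arr Arr.comp v = s.var Reg.source <;> simp [moveVertex, h, hv, hsource, htarget]

theorem vec_loop_recolourVertex (hn : s.arr 0 0 = n) (v : Fin n) :
    ((loop Reg.k recolourVertex).run s).vec Arr.colour v =
      if s.vec Arr.comp v = s.var Reg.source ∧ s.var Reg.differ = 0 then
        1 - s.vec Arr.colour v else s.vec Arr.colour v := by
  refine (run_loop_map (c := recolourVertex) hn Arr.colour (fun v => v) Fin.val_injective
    (fun v a => if s.vec Arr.comp v = s.var Reg.source ∧ s.var Reg.differ = 0 then 1 - a else a)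
    fun v t ht hv _ => ?_).1 v
  have hsource := ht.var (x := Reg.source) (by decide)
  have hdiffer := ht.var (x := Reg.differ) (by decide)
  have hcomp := ht.arr (k := Arr.comp) (by decide)
  by_cases h : s.arr Arr.comp v = s.var Reg.source <;> by_cases h' : s.var Reg.differ = 0 <;>
    simp [recolourVertex, Store.vec, h, h', hv, hsource, hdiffer, hcomp]

/-- Within each component, membership in `X` distinguishes the two sides of the bipartition `A`. -/
def Consistent {V : Type*} (A X : Set V) (comp : V → ℕ) : Prop :=
  ∀ u v, comp u = comp v → ((u ∈ X ↔ v ∈ X) ↔ (u ∈ A ↔ v ∈ A))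

theorem Consistent.merge {V : Type*} {A X X' : Set V} {comp comp' : V → ℕ}
    (h : Consistent A X comp) {i j : V} (hA : i ∈ A ↔ j ∉ A)
    (hcomp : ∀ v, comp' v = if comp v = comp j then comp i else comp v)
    (hX : ∀ v, v ∈ X' ↔ (v ∈ X ↔ ¬ (comp v = comp j ∧ (i ∈ X ↔ j ∈ X)))) :
    Consistent A X' comp' := by
  intro u v huv
  rw [hcomp u, hcomp v] at huv
  rw [hX u, hX v]
  have huv' := h u v
  have hui := h u i
  have huj := h u j
  have hvi := h v i
  have hvj := h v j
  grind

/-- The vertices of colour zero. -/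
def colourClass (n : ℕ) (s : Store) : Set (Fin n) := {v | s.vec Arr.colour v = 0}

theorem merge_spec (hn : s.arr 0 0 = n) {i j : Fin n} (hi : s.var Reg.i = i)
    (hj : s.var Reg.j = j) :
    (∀ v : Fin n, (merge.run s).vec Arr.comp v =
      if s.vec Arr.comp v = s.vec Arr.comp j then s.vec Arr.comp i else s.vec Arr.comp v) ∧
    ∀ v : Fin n, v ∈ colourClass n (merge.run s) ↔ (v ∈ colourClass n s ↔
      ¬ (s.vec Arr.comp v = s.vec Arr.comp j ∧ (i ∈ colourClass n s ↔ j ∈ colourClass n s))) := by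
  simp only [merge, run_block_cons, run_block_nil]
  set s₁ := (assign Reg.differ _).run _ with hs₁
  have hn₁ : s₁.arr 0 0 = n := hn
  have hsource : s₁.var Reg.source = s.vec Arr.comp j := by simp [hs₁, hj, Store.vec]
  have htarget : s₁.var Reg.target = s.vec Arr.comp i := by simp [hs₁, hi, Store.vec]
  have hdiffer : s₁.var Reg.differ = 0 ↔ 1 - s.vec Arr.colour i = 1 - s.vec Arr.colour j := by
    simp [hs₁, hi, hj, Store.vec]
  have hfr : Frame _ s₁ _ := frame_run (loop Reg.k recolourVertex) s₁
  refine ⟨fun v => ?_, fun v => ?_⟩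
  · rw [vec_loop_moveVertex (by rw [hfr.arr (by decide), hn₁]), hfr.var (by decide),
      hfr.var (by decide), hsource, htarget, hfr.vec Arr.comp]
    rfl
  · simp only [colourClass, Set.mem_ofPred_eq]
    rw [(frame_run (loop Reg.k moveVertex) _).vec Arr.colour,
      vec_loop_recolourVertex hn₁, hsource]
    simp only [hdiffer, show ∀ k (v : Fin n), s₁.vec k v = s.vec k v from fun _ _ => rfl]
    split_ifs <;> grind

/-- The vertices `i` and `j` interact, according to the input matrix. -/
def Adjacent (x : ℕ → ℕ) {n : ℕ} (i j : Fin n) : Prop := i ≠ j ∧ entryNum x i j ≠ 0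

theorem mergeAdjacent_spec (hn : s.arr 0 0 = n) {i j : Fin n} (hi : s.var Reg.i = i)
    (hj : s.var Reg.j = j) {A : Set (Fin n)} (hA : Adjacent (s.arr 0) i j → (i ∈ A ↔ j ∉ A))
    (h : Consistent A (colourClass n s) (s.vec Arr.comp)) :
    Consistent A (colourClass n (mergeAdjacent.run s)) ((mergeAdjacent.run s).vec Arr.comp) ∧
      (Adjacent (s.arr 0) i j →
        (mergeAdjacent.run s).vec Arr.comp i = (mergeAdjacent.run s).vec Arr.comp j) ∧
      ∀ u v : Fin n, s.vec Arr.comp u = s.vec Arr.comp v →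
        (mergeAdjacent.run s).vec Arr.comp u = (mergeAdjacent.run s).vec Arr.comp v := by
  by_cases hE : Adjacent (s.arr 0) i j
  · have hnum : s.arr 0 (3 * (i * n + j) + 2) ≠ 0 := hE.2
    have hrun : mergeAdjacent.run s = merge.run s := by
      simp [mergeAdjacent, hi, hj, hn, hnum, Fin.val_inj, hE.1]
    obtain ⟨hcomp, hX⟩ := merge_spec hn hi hj
    rw [hrun]
    exact ⟨h.merge (hA hE) hcomp hX, fun _ => by simp [hcomp],
      fun u v huv => by rw [hcomp, hcomp, huv]⟩
  · have hrun : mergeAdjacent.run s = s := by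
      rw [Adjacent, not_and_or, not_not, not_not, entryNum] at hE
      obtain rfl | h0 := hE
      · simp [mergeAdjacent, hi, hj]
      · simp [mergeAdjacent, hi, hj, hn, h0]
    rw [hrun]
    exact ⟨h, fun h' => absurd h' hE, fun _ _ huv => huv⟩

theorem colour_spec (hn : s.arr 0 0 = n) {A : Set (Fin n)}
    (hA : ∀ i j : Fin n, Adjacent (s.arr 0) i j → (i ∈ A ↔ j ∉ A)) {i j : Fin n}
    (hij : Adjacent (s.arr 0) i j) :
    i ∈ colourClass n (colour.run s) ↔ j ∉ colourClass n (colour.run s) := by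
  simp only [colour, run_block_cons, run_block_nil]
  set s₁ := (loop Reg.i _).run s
  have hs : Frame _ s s₁ := frame_run _ s
  have hcomp : ∀ v : Fin n, s₁.vec Arr.comp v = v :=
    (run_loop_map hn Arr.comp (fun v => v) Fin.val_injective (fun v _ => v)
      fun v t _ hv _ => by simp [hv]).1
  have hstart : Consistent A (colourClass n s₁) (s₁.vec Arr.comp) := by
    intro u v huv
    rw [hcomp, hcomp, Fin.val_inj] at huv
    simp [huv]
  obtain ⟨hcons, hsame⟩ := run_loop_loop_forall (x := Reg.i) (y := Reg.j) (c := mergeAdjacent)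
    (s := s₁) (by rw [hs.arr (by decide), hn])
    (fun t => Consistent A (colourClass n t) (t.vec Arr.comp))
    (fun i j t => Adjacent (s.arr 0) i j → t.vec Arr.comp i = t.vec Arr.comp j)
    (fun _ _ h => h) (fun _ _ h => h) (fun _ _ _ _ h => h) (fun _ _ _ _ h => h) hstart
    fun i j t ht hi hj hc => by
      have hin : t.arr 0 = s.arr 0 := (ht.arr (by decide)).trans (hs.arr (by decide))
      obtain ⟨h1, h2, h3⟩ := mergeAdjacent_spec (hin ▸ hn) hi hj (hin ▸ hA i j) hc
      exact ⟨h1, hin ▸ h2, fun i' j' _ h h' => h3 _ _ (h h')⟩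
  have := hcons i j (hsame i j hij)
  have := hA i j hij
  tauto

end Prog
end RAM

/-! ### Integral weights -/

namespace RAM
namespace Prog

open RAM.Expr

/-- Compute a common multiple of the denominators. -/
def commonMultiple : Prog := block
  [assign Reg.multiple 1,
    loop Reg.i <| loop Reg.j <|
      assign Reg.multiple (var Reg.multiple * denom (idx (var Reg.i) (var Reg.j)))]

/-- Write the integral weight of row `i` and column `j`. -/
def writeWeight : Prog :=
  ite (read Arr.colour (var Reg.i)) (write Arr.weight (idx (var Reg.i) (var Reg.j)) 0) <|
    ite (read Arr.colour (var Reg.j))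
      (write Arr.weight (idx (var Reg.i) (var Reg.j))
        (var Reg.multiple / denom (idx (var Reg.i) (var Reg.j)) *
          numer (idx (var Reg.i) (var Reg.j))))
      (write Arr.weight (idx (var Reg.i) (var Reg.j)) 0)

/-- Compute the weights of the assignment problem: the interactions between the two colour classes,
scaled to integers. -/
def weights : Prog := loop Reg.i (loop Reg.j writeWeight)

variable {n : ℕ} {s : Store}

theorem commonMultiple_spec (hn : s.arr 0 0 = n)
    (hpos : ∀ i j : Fin n, 0 < entryDen (s.arr 0) i j) :
    0 < (commonMultiple.run s).var Reg.multiple ∧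
      ∀ i j : Fin n, entryDen (s.arr 0) i j ∣ (commonMultiple.run s).var Reg.multiple := by
  refine run_loop_loop_forall (s := (assign Reg.multiple 1).run s) hn
    (fun t => 0 < t.var Reg.multiple) (fun i j t => entryDen (s.arr 0) i j ∣ t.var Reg.multiple)
    (fun _ _ h => h) (fun _ _ h => h) (fun _ _ _ _ h => h) (fun _ _ _ _ h => h) one_pos
    fun i j t ht hi hj h => ?_
  have hin : t.arr 0 = s.arr 0 := ht.arr (by decide)
  have hrun : ((assign Reg.multiple (var Reg.multiple *
      denom (idx (var Reg.i) (var Reg.j)))).run t).var Reg.multiple =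
      t.var Reg.multiple * entryDen (s.arr 0) i j := by
    simp [entryDen, hi, hj, hin, hn]
  rw [hrun]
  exact ⟨Nat.mul_pos h (hpos i j), Dvd.intro_left _ rfl, fun _ _ _ h' => h'.mul_right _⟩

theorem mat_weight_weights (hn : s.arr 0 0 = n) [DecidablePred (· ∈ colourClass n s)]
    (i j : Fin n) :
    (weights.run s).mat Arr.weight i j =
      if i ∈ colourClass n s ∧ j ∉ colourClass n s then
        s.var Reg.multiple / entryDen (s.arr 0) i j * entryNum (s.arr 0) i j else 0 := by
  let W (i j : Fin n) : ℕ := if i ∈ colourClass n s ∧ j ∉ colourClass n s then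
    s.var Reg.multiple / entryDen (s.arr 0) i j * entryNum (s.arr 0) i j else 0
  refine (run_loop_loop_forall hn (fun _ => True) (fun i j t => t.mat Arr.weight i j = W i j)
    (fun _ _ h => h) (fun _ _ h => h) (fun _ _ _ _ h => h) (fun _ _ _ _ h => h) trivial
    fun i j t ht hi hj _ => ?_).2 i j
  have hin : t.arr 0 = s.arr 0 := ht.arr (by decide)
  have hcol : t.arr Arr.colour = s.arr Arr.colour := ht.arr (by decide)
  have hmul : t.var Reg.multiple = s.var Reg.multiple := ht.var (by decide)
  have hrun : writeWeight.run t = t.setArr Arr.weight (i * n + j) (W i j) := by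
    by_cases hi0 : s.arr Arr.colour i = 0 <;> by_cases hj0 : s.arr Arr.colour j = 0 <;>
      simp [W, writeWeight, colourClass, Store.vec, entryNum, entryDen, hi, hj, hin, hn, hcol, hmul,
        hi0, hj0]
  rw [hrun]
  refine ⟨trivial, by simp [Store.mat], fun i' j' hne h => ?_⟩
  rw [← h]
  simp only [Store.mat, Store.setArr_arr, if_true]
  rw [update_of_ne (matPos_inj.not.2 (by simpa using hne))]

end Prog
end RAM

/-! ### The implementation of the Hungarian method -/

namespace RAM
namespace Prog

open RAM.Expr

/-- Increase the dual variable of row `i` by the weight of row `i` and column `j`. -/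
def addWeight : Prog :=
  write Arr.rowDual (var Reg.i)
    (read Arr.rowDual (var Reg.i) + read Arr.weight (idx (var Reg.i) (var Reg.j)))

/-- The slack of row `i` and column `j` in the dual problem. -/
def slack : Expr :=
  read Arr.rowDual (var Reg.i) + read Arr.colDual (var Reg.j) -
    read Arr.weight (idx (var Reg.i) (var Reg.j))

/-- Record row `i` and column `j` as the pair of least slack. -/
def choosePair : Prog := block
  [assign Reg.found 1, assign Reg.slack slack, assign Reg.row (var Reg.i),
    assign Reg.col (var Reg.j)]

/-- Compare the pair of row `i` and column `j` with the recorded pair. -/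
def comparePair : Prog :=
  ite (read Arr.rows (var Reg.i))
    (ite (read Arr.cols (var Reg.j)) skip
      (ite (var Reg.found) (ite (var Reg.slack - slack) choosePair skip) choosePair))
    skip

/-- Find a pair of least slack among the reached rows and the columns not reached. -/
def findMin : Prog := block
  [assign Reg.found 0, loop Reg.i (loop Reg.j comparePair)]

/-- Decrease the dual variable of row `i` if it is reached. -/
def decreaseRow : Prog :=
  ite (read Arr.rows (var Reg.i))
    (write Arr.rowDual (var Reg.i) (read Arr.rowDual (var Reg.i) - var Reg.slack)) skip

/-- Increase the dual variable of column `i` if it is reached. -/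
def increaseCol : Prog :=
  ite (read Arr.cols (var Reg.i))
    (write Arr.colDual (var Reg.i) (read Arr.colDual (var Reg.i) + var Reg.slack)) skip

/-- The dual update of the Hungarian method. -/
def updateDual : Prog := block [loop Reg.i decreaseRow, loop Reg.i increaseCol]

/-- Make a pair of least slack tight. -/
def tighten : Prog := block [findMin, updateDual]

/-- Copy an entry of the matching exposing the chosen row to the matching exposing the partner of
the chosen column. -/
def copyExposing : Prog :=
  write Arr.exposing (idx (var Reg.partner) (var Reg.i))
    (read Arr.exposing (idx (var Reg.row) (var Reg.i)))

/-- Match the chosen row to the chosen column in the matching exposing the partner of the column,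
and mark both the column and its partner as reached. -/
def reach : Prog := block
  [write Arr.exposing (idx (var Reg.partner) (var Reg.col)) (var Reg.row + 1),
    write Arr.cols (var Reg.col) 1,
    write Arr.rows (var Reg.partner) 1]

/-- Extend the search to the chosen column and its partner. -/
def grow : Prog := block
  [assign Reg.partner (read Arr.matching (var Reg.col) - 1), loop Reg.i copyExposing, reach]

/-- Copy an entry of the matching exposing the chosen row to the current matching. -/
def replaceMatching : Prog :=
  write Arr.matching (var Reg.i) (read Arr.exposing (idx (var Reg.row) (var Reg.i)))

/-- Match the chosen row to the chosen column in the matching that exposes the row. -/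
def augment : Prog := block
  [loop Reg.i replaceMatching,
    write Arr.matching (var Reg.col) (var Reg.row + 1),
    assign Reg.done 1]

/-- Extend the search to one more column, and finish it if the column is free. -/
def searchStep : Prog := block
  [tighten, ite (read Arr.matching (var Reg.col)) grow augment]

/-- Search until the matching is augmented. -/
def continueSearch : Prog := ite (var Reg.done) skip searchStep

/-- Mark row `i` as not reached. -/
def clearRow : Prog := write Arr.rows (var Reg.i) 0

/-- Mark column `i` as not reached. -/
def clearCol : Prog := write Arr.cols (var Reg.i) 0

/-- Copy an entry of the current matching to the matching exposing the root. -/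
def copyMatching : Prog :=
  write Arr.exposing (idx (var Reg.root) (var Reg.i)) (read Arr.matching (var Reg.i))

/-- Start the search at the root. -/
def startSearch : Prog := block
  [loop Reg.i clearRow, loop Reg.i clearCol, loop Reg.i copyMatching,
    write Arr.rows (var Reg.root) 1,
    assign Reg.done 0]

/-- Match one more row, the root. -/
def matchRoot : Prog := block [startSearch, loop Reg.step continueSearch]

/-- The Hungarian method. -/
def hungarian : Prog := block
  [loop Reg.i (loop Reg.j addWeight), loop Reg.root matchRoot]

variable {n : ℕ} {s : Store}

theorem addWeight_spec (hn : s.arr 0 0 = n) (i j : Fin n) :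
    s.mat Arr.weight i j ≤ ((loop Reg.i (loop Reg.j addWeight)).run s).vec Arr.rowDual i := by
  refine (run_loop_loop_forall hn (fun _ => True)
    (fun i j t => s.mat Arr.weight i j ≤ t.vec Arr.rowDual i)
    (fun _ _ h => h) (fun _ _ h => h) (fun _ _ _ _ h => h) (fun _ _ _ _ h => h) trivial
    fun i j t ht hi hj _ => ?_).2 i j
  have hin : t.arr 0 = s.arr 0 := ht.arr (by decide)
  have hw : t.arr Arr.weight = s.arr Arr.weight := ht.arr (by decide)
  have hrun : addWeight.run t =
      t.setArr Arr.rowDual i (t.vec Arr.rowDual i + s.mat Arr.weight i j) := by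
    simp [addWeight, Store.vec, Store.mat, hi, hj, hin, hw, hn]
  rw [hrun]
  refine ⟨trivial, by simp [Store.vec], fun i' j' _ h => h.trans ?_⟩
  simp only [Store.vec, Store.setArr_arr, if_true, update_apply]
  split_ifs with h'
  exacts [h' ▸ Nat.le_add_right _ _, le_rfl]

theorem comparePair_run {i j : Fin n} (hi : s.var Reg.i = i) (hj : s.var Reg.j = j) :
    comparePair.run s =
      if (s.vec Arr.rows i ≠ 0 ∧ s.vec Arr.cols j = 0) ∧
          (s.var Reg.found ≠ 0 → slack.eval s < s.var Reg.slack)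
        then choosePair.run s else s := by
  simp only [comparePair, run_ite, eval_read, eval_var, eval_sub, hi, hj, run_skip, Store.vec]
  grind

theorem findMin_spec (hn : s.arr 0 0 = n) {S T : Set (Fin n)}
    (hS : support (s.vec Arr.rows) = S) (hT : support (s.vec Arr.cols) = T)
    (hSne : S.Nonempty) (hTne : Tᶜ.Nonempty) :
    ∃ i j : Fin n, (findMin.run s).var Reg.row = i ∧ (findMin.run s).var Reg.col = j ∧
      Assignment.MinSlack (s.mat Arr.weight) (s.vec Arr.rowDual) (s.vec Arr.colDual) S T i j
        ((findMin.run s).var Reg.slack) := by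
  let sl (i j : Fin n) : ℕ := s.vec Arr.rowDual i + s.vec Arr.colDual j - s.mat Arr.weight i j
  have main := run_loop_loop_forall (x := Reg.i) (y := Reg.j) (c := comparePair)
    (s := (assign Reg.found 0).run s) hn
    (fun t => t.var Reg.found ≠ 0 → ∃ i j : Fin n, t.var Reg.row = i ∧ t.var Reg.col = j ∧
      i ∈ S ∧ j ∉ T ∧ t.var Reg.slack = sl i j)
    (fun i j t => i ∈ S → j ∉ T → t.var Reg.found ≠ 0 ∧ t.var Reg.slack ≤ sl i j)
    (fun _ _ h => h) (fun _ _ h => h) (fun _ _ _ _ h => h) (fun _ _ _ _ h => h)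
    (by simp) (fun i j t ht hi hj h => ?_)
  · obtain ⟨hpair, hmin⟩ := main
    obtain ⟨i₀, hi₀⟩ := hSne
    obtain ⟨j₀, hj₀⟩ := hTne
    obtain ⟨i, j, hi, hj, hiS, hjT, hsl⟩ := hpair (hmin i₀ j₀ hi₀ hj₀).1
    exact ⟨i, j, hi, hj, hiS, hjT, hsl, fun i' hi' j' hj' => (hmin i' j' hi' hj').2⟩
  · have hin : t.arr 0 = s.arr 0 := ht.arr (by decide)
    have hmem : (t.vec Arr.rows i ≠ 0 ∧ t.vec Arr.cols j = 0) ↔ i ∈ S ∧ j ∉ T := by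
      rw [← hS, ← hT, ht.vec Arr.rows, ht.vec Arr.cols]
      simp [Store.vec]
    have hsl : slack.eval t = sl i j := by
      have hw : t.arr Arr.weight = s.arr Arr.weight := ht.arr (by decide)
      have hu : t.arr Arr.rowDual = s.arr Arr.rowDual := ht.arr (by decide)
      have hv : t.arr Arr.colDual = s.arr Arr.colDual := ht.arr (by decide)
      simp [slack, sl, Store.vec, Store.mat, hi, hj, hin, hn, hw, hu, hv]
    have hchoose : (choosePair.run t).var Reg.found = 1 ∧
        (choosePair.run t).var Reg.slack = sl i j ∧
        (choosePair.run t).var Reg.row = i ∧ (choosePair.run t).var Reg.col = j := by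
      simp [choosePair, ← hsl, hi, hj, slack]
    rw [comparePair_run hi hj]
    split_ifs with hc <;> rw [hmem, hsl] at hc
    · obtain ⟨⟨hiS, hjT⟩, hlt⟩ := hc
      obtain ⟨h1, h2, h3, h4⟩ := hchoose
      refine ⟨fun _ => ⟨i, j, h3, h4, hiS, hjT, h2⟩, fun _ _ => ⟨by simp [h1], h2.le⟩,
        fun i' j' _ h' hi' hj' => ⟨by simp [h1], ?_⟩⟩
      obtain ⟨hf, hle⟩ := h' hi' hj'
      exact h2.trans_le ((hlt hf).le.trans hle)
    · refine ⟨h, fun hiS hjT => ?_, fun _ _ _ h' => h'⟩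
      by_contra! hc'
      exact hc ⟨⟨hiS, hjT⟩, hc'⟩

/-- The number that encodes a row or no row. -/
def code (o : Option (Fin n)) : ℕ := o.elim 0 (· + 1)

/-- The store `s` holds an optimal matching of the rows in `R`. -/
def Solved (s : Store) (R : Set (Fin n)) : Prop :=
  ∃ p : Fin n → Option (Fin n), (∀ j, s.vec Arr.matching j = code (p j)) ∧
    Assignment.Optimal R (s.mat Arr.weight) (s.vec Arr.rowDual) (s.vec Arr.colDual) p

/-- The store `s` holds the state of a search. -/
structure Searching (s : Store) (R : Set (Fin n)) (r : Fin n) (p : Fin n → Option (Fin n))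
    (m : Fin n → Fin n → Option (Fin n)) : Prop where
  matching : ∀ j, s.vec Arr.matching j = code (p j)
  exposing : ∀ i, s.vec Arr.rows i ≠ 0 → ∀ j, s.mat Arr.exposing i j = code (m i j)
  search : Assignment.Search R r (s.mat Arr.weight) p (s.vec Arr.rowDual) (s.vec Arr.colDual)
    (support (s.vec Arr.rows)) (support (s.vec Arr.cols)) m

/-- The store `s` holds a tight pair of a reached row `i` and a column `j` not reached. -/
structure TightPair (s : Store) (i j : Fin n) : Prop where
  row : s.var Reg.row = i
  col : s.var Reg.col = j
  row_mem : s.vec Arr.rows i ≠ 0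
  col_notMem : s.vec Arr.cols j = 0
  tight : s.mat Arr.weight i j = s.vec Arr.rowDual i + s.vec Arr.colDual j

theorem updateDual_spec (hn : s.arr 0 0 = n) (k : Fin n) :
    (updateDual.run s).vec Arr.rowDual k =
      (if s.vec Arr.rows k ≠ 0 then s.vec Arr.rowDual k - s.var Reg.slack
        else s.vec Arr.rowDual k) ∧
    (updateDual.run s).vec Arr.colDual k =
      if s.vec Arr.cols k ≠ 0 then s.vec Arr.colDual k + s.var Reg.slack
        else s.vec Arr.colDual k := by
  have hdec := frame_run (loop Reg.i decreaseRow) s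
  have hinc := frame_run (loop Reg.i increaseCol) ((loop Reg.i decreaseRow).run s)
  constructor
  · refine (congrFun (hinc.vec Arr.rowDual) k).trans ((run_loop_map hn Arr.rowDual Fin.val
      Fin.val_injective (fun k x => if s.vec Arr.rows k ≠ 0 then x - s.var Reg.slack else x)
      fun i t ht hi _ => ?_).1 k)
    have hrows : t.arr Arr.rows = s.arr Arr.rows := ht.arr (by decide)
    have hsl : t.var Reg.slack = s.var Reg.slack := ht.var (by decide)
    by_cases h : s.arr Arr.rows i = 0 <;> simp [decreaseRow, Store.vec, hi, hrows, hsl, h]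
  · rw [← hdec.vec Arr.colDual]
    refine (run_loop_map (by rw [hdec.arr (by decide), hn]) Arr.colDual Fin.val
      Fin.val_injective (fun k x => if s.vec Arr.cols k ≠ 0 then x + s.var Reg.slack else x)
      fun i t ht hi _ => ?_).1 k
    have hcols : t.arr Arr.cols = s.arr Arr.cols :=
      (ht.arr (by decide)).trans (hdec.arr (by decide))
    have hsl : t.var Reg.slack = s.var Reg.slack :=
      (ht.var (by decide)).trans (hdec.var (by decide))
    by_cases h : s.arr Arr.cols i = 0 <;> simp [increaseCol, Store.vec, hi, hcols, hsl, h]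

variable {R : Set (Fin n)} {r : Fin n} {p : Fin n → Option (Fin n)}
  {m : Fin n → Fin n → Option (Fin n)} {i j : Fin n}

theorem tighten_spec (hn : s.arr 0 0 = n) (h : Searching s R r p m) :
    Searching (tighten.run s) R r p m ∧ ∃ i j : Fin n, TightPair (tighten.run s) i j := by
  obtain ⟨j₀, hj₀, -⟩ := h.search.exists_free le_rfl
  obtain ⟨i, j, hi, hj, hδ⟩ := findMin_spec hn rfl rfl ⟨r, (h.search.mem_iff r).2 (.inl rfl)⟩
    ⟨j₀, hj₀⟩
  have hfr := frame_run tighten s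
  have hmin := frame_run findMin s
  have hdual := frame_run updateDual (findMin.run s)
  have hup := updateDual_spec (s := findMin.run s) (n := n) (by rw [hmin.arr (by decide), hn])
  rw [show updateDual.run (findMin.run s) = tighten.run s from rfl, hmin.vec Arr.rowDual,
    hmin.vec Arr.colDual, hmin.vec Arr.rows, hmin.vec Arr.cols] at hup
  obtain ⟨hsearch, htight⟩ := h.search.dualUpdate le_rfl hδ
    (u' := (tighten.run s).vec Arr.rowDual) (v' := (tighten.run s).vec Arr.colDual)
    (fun k => by simpa only [mem_support] using (hup k).1)
    (fun k => by simpa only [mem_support] using (hup k).2)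
  refine ⟨⟨?_, ?_, ?_⟩, i, j, ?_, ?_, ?_, ?_, ?_⟩
  · rw [hfr.vec Arr.matching]
    exact h.matching
  · rw [hfr.vec Arr.rows, hfr.mat Arr.exposing]
    exact h.exposing
  · rwa [hfr.mat Arr.weight, hfr.vec Arr.rows, hfr.vec Arr.cols]
  · exact (hdual.var (by decide)).trans hi
  · exact (hdual.var (by decide)).trans hj
  · rw [hfr.vec Arr.rows]
    exact hδ.row_mem
  · rw [hfr.vec Arr.cols]
    exact notMem_support.1 hδ.col_notMem
  · rwa [hfr.mat Arr.weight]

theorem mat_loop_copyExposing (hn : s.arr 0 0 = n) {i k : Fin n} (hi : s.var Reg.row = i)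
    (hk : s.var Reg.partner = k) (hik : i ≠ k) :
    ((loop Reg.i copyExposing).run s).mat Arr.exposing =
      update (s.mat Arr.exposing) k (s.mat Arr.exposing i) := by
  obtain ⟨hcopy, hrest⟩ := run_loop_map (x := Reg.i) (c := copyExposing) hn Arr.exposing
    (fun l : Fin n => (k : ℕ) * n + l)
    (fun l l' h => (matPos_inj.1 h).2) (fun l _ => s.mat Arr.exposing i l) fun l t ht hl hrest => by
      have hin : t.arr 0 = s.arr 0 := ht.arr (by decide)
      have hrow : t.var Reg.row = i := (ht.var (by decide)).trans hi
      have hpart : t.var Reg.partner = k := (ht.var (by decide)).trans hk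
      have hread : t.arr Arr.exposing (i * n + l) = s.arr Arr.exposing (i * n + l) :=
        hrest _ fun l' h => hik (matPos_inj.1 h).1
      simp [copyExposing, Store.mat, hl, hin, hn, hrow, hpart, hread]
  ext i' l
  obtain rfl | hne := eq_or_ne i' k
  · rw [update_self]
    exact hcopy l
  · rw [update_of_ne hne]
    exact hrest _ fun l' h => hne (matPos_inj.1 h).1

theorem reach_spec (hn : s.arr 0 0 = n) {i j k : Fin n} (hi : s.var Reg.row = i)
    (hj : s.var Reg.col = j) (hk : s.var Reg.partner = k) :
    (reach.run s).vec Arr.rows = update (s.vec Arr.rows) k 1 ∧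
      (reach.run s).vec Arr.cols = update (s.vec Arr.cols) j 1 ∧
      (reach.run s).mat Arr.exposing =
        update (s.mat Arr.exposing) k (update (s.mat Arr.exposing k) j (i + 1)) := by
  have hrun : reach.run s =
      ((s.setArr Arr.exposing (k * n + j) (i + 1)).setArr Arr.cols j 1).setArr Arr.rows k 1 := by
    simp [reach, hn, hi, hj, hk]
  rw [hrun]
  exact ⟨Store.vec_setArr _ _ _ _,
    Store.vec_setArr (s.setArr Arr.exposing (k * n + j) (i + 1)) Arr.cols j 1,
    Store.mat_setArr s Arr.exposing k j (i + 1)⟩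

theorem grow_spec (hn : s.arr 0 0 = n) (h : Searching s R r p m) (hij : TightPair s i j)
    {k : Fin n} (hk : p j = some k) :
    Searching (grow.run s) R r p (update m k (update (m i) j (some i))) ∧
      support ((grow.run s).vec Arr.cols) = insert j (support (s.vec Arr.cols)) := by
  have hjT : j ∉ support (s.vec Arr.cols) := notMem_support.2 hij.col_notMem
  have hkS : k ∉ support (s.vec Arr.rows) := h.search.notMem_of_notMem hjT hk
  have hik : i ≠ k := fun hik => hkS (hik ▸ hij.row_mem)
  have hpartner : s.arr Arr.matching j = k + 1 := (h.matching j).trans (by rw [hk]; rfl)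
  have hfr := frame_run grow s
  have hcopy := frame_run (loop Reg.i copyExposing) (s.setVar Reg.partner k)
  have hrun : grow.run s = reach.run ((loop Reg.i copyExposing).run (s.setVar Reg.partner k)) := by
    simp [grow, hij.col, hpartner]
  obtain ⟨hrows, hcols, hexp⟩ := reach_spec
    (s := (loop Reg.i copyExposing).run (s.setVar Reg.partner k)) (n := n) (i := i) (j := j)
    (k := k) ((congrFun (hcopy.arr (by decide)) 0).trans hn)
    ((hcopy.var (by decide)).trans hij.row) ((hcopy.var (by decide)).trans hij.col)
    (hcopy.var (by decide))
  rw [← hrun] at hrows hcols hexp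
  rw [mat_loop_copyExposing (s := s.setVar Reg.partner k) hn hij.row rfl hik, update_self,
    update_idem] at hexp
  rw [hcopy.vec Arr.rows] at hrows
  rw [hcopy.vec Arr.cols] at hcols
  have hsupp : ∀ (f : Fin n → ℕ) (a : Fin n), support (update f a 1) = insert a (support f) :=
    fun f a => support_update_of_ne_zero f a one_ne_zero
  refine ⟨⟨?_, fun i' hi' l => ?_, ?_⟩, by rw [hcols, hsupp]; rfl⟩
  · rw [hfr.vec Arr.matching]
    exact h.matching
  · rw [hexp]
    obtain rfl | hne := eq_or_ne i' k
    · simp only [update_self, update_apply]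
      split_ifs
      exacts [rfl, h.exposing i hij.row_mem l]
    · rw [hrows, update_of_ne hne] at hi'
      rw [update_of_ne hne, update_of_ne hne]
      exact h.exposing i' hi' l
  · rw [hfr.mat Arr.weight, hfr.vec Arr.rowDual, hfr.vec Arr.colDual, hrows, hcols, hsupp, hsupp]
    exact h.search.grow hij.row_mem hjT hij.tight hk

theorem vec_loop_replaceMatching (hn : s.arr 0 0 = n) (hi : s.var Reg.row = i) :
    ((loop Reg.i replaceMatching).run s).vec Arr.matching = s.mat Arr.exposing i := by
  ext l
  refine (run_loop_map hn Arr.matching Fin.val Fin.val_injective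
    (fun l _ => s.mat Arr.exposing i l) fun l t ht hl _ => ?_).1 l
  have hin : t.arr 0 = s.arr 0 := ht.arr (by decide)
  have hexp : t.arr Arr.exposing = s.arr Arr.exposing := ht.arr (by decide)
  have hrow : t.var Reg.row = i := (ht.var (by decide)).trans hi
  simp [replaceMatching, Store.mat, hl, hin, hn, hexp, hrow]

theorem augment_spec (hn : s.arr 0 0 = n) (h : Searching s R r p m) (hij : TightPair s i j)
    (hj : p j = none) : Solved (augment.run s) (insert r R) := by
  refine ⟨update (m i) j (some i), fun l => ?_, ?_⟩
  · have hfr := frame_run (loop Reg.i replaceMatching) s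
    have hrun : (augment.run s).vec Arr.matching = update (s.mat Arr.exposing i) j (i + 1) := by
      rw [← vec_loop_replaceMatching hn hij.row, ← Store.vec_setArr, ← hij.row, ← hij.col,
        ← hfr.var (x := Reg.row) (by decide), ← hfr.var (x := Reg.col) (by decide)]
      rfl
    rw [hrun, update_apply, update_apply]
    split_ifs
    exacts [rfl, h.exposing i hij.row_mem l]
  · have hfr := frame_run augment s
    rw [hfr.mat Arr.weight, hfr.vec Arr.rowDual, hfr.vec Arr.colDual]
    exact h.search.augment hij.row_mem hij.tight hj

theorem searchStep_spec (hn : s.arr 0 0 = n) (hdone : s.var Reg.done = 0)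
    (h : Searching s R r p m) :
    ((searchStep.run s).var Reg.done = 0 ∧ ∃ m', Searching (searchStep.run s) R r p m' ∧
      (support ((searchStep.run s).vec Arr.cols : Fin n → ℕ)).ncard =
        (support (s.vec Arr.cols : Fin n → ℕ)).ncard + 1) ∨
    (searchStep.run s).var Reg.done ≠ 0 ∧ Solved (searchStep.run s) (insert r R) := by
  obtain ⟨ht, i, j, hij⟩ := tighten_spec hn h
  have hfr := frame_run tighten s
  have hn' : (tighten.run s).arr 0 0 = n := by rw [hfr.arr (by decide), hn]
  have hread : (read Arr.matching (var Reg.col)).eval (tighten.run s) = code (p j) := by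
    simpa [hij.col, Store.vec] using ht.matching j
  cases hj : p j with
  | none =>
    have hrun : searchStep.run s = augment.run (tighten.run s) := by
      simp only [searchStep, run_block_cons, run_block_nil, run_ite, hread, hj, code]
      rfl
    rw [hrun]
    exact .inr ⟨one_ne_zero, augment_spec hn' ht hij hj⟩
  | some k =>
    have hrun : searchStep.run s = grow.run (tighten.run s) := by
      simp only [searchStep, run_block_cons, run_block_nil, run_ite, hread, hj, code]
      rfl
    obtain ⟨hg, hcols⟩ := grow_spec hn' ht hij hj
    have hgrow := frame_run grow (tighten.run s)
    rw [hrun]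
    refine .inl ⟨?_, _, hg, ?_⟩
    · rw [hgrow.var (by decide), hfr.var (by decide), hdone]
    · rw [hcols, hfr.vec Arr.cols, Set.ncard_insert_of_notMem]
      rw [← hfr.vec Arr.cols]
      exact notMem_support.2 hij.col_notMem

theorem vec_loop_clearRow (hn : s.arr 0 0 = n) :
    (((loop Reg.i clearRow).run s).vec Arr.rows : Fin n → ℕ) = 0 :=
  funext (run_loop_map hn Arr.rows Fin.val Fin.val_injective (fun _ _ => 0)
    fun i t _ hi _ => by simp [clearRow, hi]).1

theorem vec_loop_clearCol (hn : s.arr 0 0 = n) :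
    (((loop Reg.i clearCol).run s).vec Arr.cols : Fin n → ℕ) = 0 :=
  funext (run_loop_map hn Arr.cols Fin.val Fin.val_injective (fun _ _ => 0)
    fun i t _ hi _ => by simp [clearCol, hi]).1

theorem mat_loop_copyMatching (hn : s.arr 0 0 = n) (hr : s.var Reg.root = r) :
    ((loop Reg.i copyMatching).run s).mat Arr.exposing r = (s.vec Arr.matching : Fin n → ℕ) :=
  funext (run_loop_map hn Arr.exposing (fun l : Fin n => (r : ℕ) * n + l)
    (fun l l' h => (matPos_inj.1 h).2) (fun l _ => s.vec Arr.matching l) fun l t ht hl _ => by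
      have hin : t.arr 0 = s.arr 0 := ht.arr (by decide)
      have hmatch : t.arr Arr.matching = s.arr Arr.matching := ht.arr (by decide)
      have hroot : t.var Reg.root = r := (ht.var (by decide)).trans hr
      simp [copyMatching, Store.vec, hl, hin, hn, hmatch, hroot]).1

theorem startSearch_spec (hn : s.arr 0 0 = n) (hr : s.var Reg.root = r) (hrR : r ∉ R)
    (h : Solved s R) :
    ∃ p m, Searching (startSearch.run s) R r p m ∧
      support ((startSearch.run s).vec Arr.cols : Fin n → ℕ) = ∅ := by
  obtain ⟨p, hp, hopt⟩ := h
  let s₁ := (loop Reg.i clearRow).run s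
  let s₂ := (loop Reg.i clearCol).run s₁
  let s₃ := (loop Reg.i copyMatching).run s₂
  have h₁ : Frame _ s s₁ := frame_run _ _
  have h₂ : Frame _ s₁ s₂ := frame_run _ _
  have h₃ : Frame _ s₂ s₃ := frame_run _ _
  have hfr := frame_run startSearch s
  have hn₁ : s₁.arr 0 0 = n := by rw [h₁.arr (by decide), hn]
  have hn₂ : s₂.arr 0 0 = n := by rw [h₂.arr (by decide), hn₁]
  have hr₂ : s₂.var Reg.root = r := by rw [h₂.var (by decide), h₁.var (by decide), hr]
  have hrun : startSearch.run s = (s₃.setArr Arr.rows r 1).setVar Reg.done 0 := by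
    simp [startSearch, ← hr₂, ← h₃.var (x := Reg.root) (by decide), s₁, s₂, s₃]
  have hrows : (startSearch.run s).vec Arr.rows = update (0 : Fin n → ℕ) r 1 := by
    rw [hrun, ← vec_loop_clearRow hn, ← h₂.vec Arr.rows, ← h₃.vec Arr.rows]
    exact Store.vec_setArr s₃ Arr.rows r 1
  have hcols : ((startSearch.run s).vec Arr.cols : Fin n → ℕ) = 0 := by
    rw [hrun, ← vec_loop_clearCol hn₁, ← h₃.vec Arr.cols]
    rfl
  have hexp : (startSearch.run s).mat Arr.exposing r = (s.vec Arr.matching : Fin n → ℕ) := by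
    rw [hrun, ← h₁.vec Arr.matching, ← h₂.vec Arr.matching, ← mat_loop_copyMatching hn₂ hr₂]
    rfl
  refine ⟨p, fun _ => p, ⟨?_, fun i hi j => ?_, ?_⟩, by rw [hcols, support_zero]⟩
  · rw [hfr.vec Arr.matching]
    exact hp
  · obtain rfl : i = r := by
      by_contra hne
      exact hi (by rw [hrows, update_of_ne hne, Pi.zero_apply])
    rw [hexp, hp]
  · rw [hfr.mat Arr.weight, hfr.vec Arr.rowDual, hfr.vec Arr.colDual, hrows, hcols,
      support_update_of_ne_zero _ _ one_ne_zero, support_zero, insert_empty_eq]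
    exact hopt.search hrR rfl

theorem matchRoot_spec (hn : s.arr 0 0 = n) (hr : s.var Reg.root = r) (hrR : r ∉ R)
    (h : Solved s R) : Solved (matchRoot.run s) (insert r R) := by
  obtain ⟨p, m, hsearch, hcols⟩ := startSearch_spec hn hr hrR h
  have hn' : (startSearch.run s).arr 0 0 = n := by
    rw [(frame_run startSearch s).arr (by decide), hn]
  have main := run_loop_induct (x := Reg.step) (c := continueSearch) hn'
    (fun l t => (t.var Reg.done = 0 ∧ ∃ m', Searching t R r p m' ∧
      (support (t.vec Arr.cols : Fin n → ℕ)).ncard = l) ∨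
      t.var Reg.done ≠ 0 ∧ Solved t (insert r R))
    (fun _ _ _ h => h.imp_left fun ⟨hdone, m', h', hcard⟩ =>
      ⟨hdone, m', ⟨h'.1, h'.2, h'.3⟩, hcard⟩)
    (.inl ⟨rfl, m, hsearch, by rw [hcols, Set.ncard_empty]⟩)
    (fun l t ht _ h => ?_)
  · obtain ⟨-, m', h', hcard⟩ | ⟨-, h'⟩ := main
    · exact absurd hcard (by simpa using (h'.search.ncard_lt le_rfl).ne)
    · exact h'
  · have hnt : t.arr 0 0 = n := by rw [ht.arr (by decide), hn']
    rw [continueSearch, run_ite, eval_var, run_skip]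
    obtain ⟨hdone, m', h', hcard⟩ | ⟨hdone, h'⟩ := h
    · rw [if_pos hdone, ← hcard]
      exact searchStep_spec hnt hdone h'
    · rw [if_neg hdone]
      exact .inr ⟨hdone, h'⟩

theorem hungarian_spec (hn : s.arr 0 0 = n) (hcolDual : s.arr Arr.colDual = 0)
    (hmatching : s.arr Arr.matching = 0) : Solved (hungarian.run s) (Set.univ : Set (Fin n)) := by
  let s₁ := (loop Reg.i (loop Reg.j addWeight)).run s
  have hfr : Frame _ s s₁ := frame_run (loop Reg.i (loop Reg.j addWeight)) s
  have hstart : Solved s₁ (∅ : Set (Fin n)) := by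
    refine ⟨fun _ => none, fun j => ?_, fun i j => ?_, fun j _ => ?_, ⟨by simp, by simp⟩,
      fun _ _ h => by simp at h⟩
    · rw [hfr.vec Arr.matching, Store.vec, hmatching]; rfl
    · rw [hfr.mat Arr.weight]; exact le_add_right (addWeight_spec hn i j)
    · rw [hfr.vec Arr.colDual, Store.vec, hcolDual]; rfl
  have main := run_loop_induct (x := Reg.root) (c := matchRoot) (s := s₁) (n := n)
    (by rw [hfr.arr (by decide), hn]) (fun k t => Solved t {i : Fin n | i < k}) (fun _ _ _ h => h)
    (by simpa using hstart) (fun i t ht hi h => ?_)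
  · rwa [show {i : Fin n | (i : ℕ) < n} = Set.univ by simp] at main
  · have hnt : t.arr 0 0 = n := by rw [ht.arr (by decide), hfr.arr (by decide), hn]
    convert matchRoot_spec hnt hi (by simp) h using 1
    ext k
    simp [Order.lt_add_one_iff, le_iff_eq_or_lt, Fin.val_inj]

end Prog
end RAM

/-! ### The described state -/

namespace Quantum

/-- The number `0`. -/
def algZero : AlgReal := ⟨[0, 1], 0, 0⟩

/-- The number `1`. -/
def algOne : AlgReal := ⟨[-1, 1], 1, 1⟩

/-- The number `(1 + √s) / 2` for `s = (√5 - 1) / 2`. -/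
def algMajor : AlgReal := ⟨[1, -12, 28, -32, 16], 1 / 2, 1⟩

/-- The number `(1 - √s) / 2` for `s = (√5 - 1) / 2`. -/
def algMinor : AlgReal := ⟨[1, -12, 28, -32, 16], 0, 1 / 2⟩

/-- The number `-s / 2` for `s = (√5 - 1) / 2`. -/
def algCross : AlgReal := ⟨[-1, -2, 4], -1, 0⟩

/-- A real algebraic number as a complex one. -/
def AlgReal.toComplex (a : AlgReal) : AlgComplex := ⟨a, algZero⟩

/-- The entries of `|c⟩⟨c|`. -/
def singleEntries (c : Fin 2) : List AlgComplex :=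
  (if c = 0 then [algOne, algZero, algZero, algZero]
    else [algZero, algZero, algZero, algOne]).map AlgReal.toComplex

/-- The entries of the projection onto `√((1 + √s) / 2) |01⟩ - √((1 - √s) / 2) |10⟩`. A basis state
has its first qubit as the least significant bit, so `|01⟩` is at position 2 and `|10⟩` at 1. -/
def pairEntries : List AlgComplex :=
  [algZero, algZero, algZero, algZero, algZero, algMinor, algCross, algZero,
    algZero, algCross, algMajor, algZero, algZero, algZero, algZero, algZero].map AlgReal.toComplex

/-- A colouring of the qubits by 0 and 1 together with a matching of qubits of different colours. -/
structure PairedColouring (n : ℕ) where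
  col : Fin n → Fin 2
  mate : Fin n → Option (Fin n)
  symm : ∀ {i j}, mate i = some j → mate j = some i
  bichromatic : ∀ {i j}, mate i = some j → col i ≠ col j

namespace PairedColouring

variable {n : ℕ} (G : PairedColouring n)

/-- The blocks that belong to qubit `i`: pairs belong to their qubit of colour 0. -/
def blocks (i : Fin n) : List (Block n) :=
  match G.mate i with
  | none => [⟨[i], singleEntries (G.col i)⟩]
  | some j => if G.col i = 0 then [⟨[i, j], pairEntries⟩] else []

/-- The description of the product state in which every unmatched qubit is in the basis state of its
colour and every matched pair is in a tilted singlet. -/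
def description : Description n := (List.finRange n).flatMap G.blocks

/-- The weight of the matching. -/
def weight (w : Matrix (Fin n) (Fin n) ℚ) : ℝ :=
  ∑ i with G.col i = 0, (G.mate i).elim 0 fun j => (w i j : ℝ)

/-- `G` is a proper colouring with a matching of maximum weight, certified by a dual solution. -/
structure Optimal (w : Matrix (Fin n) (Fin n) ℚ) : Prop where
  proper : ∀ i j, i ≠ j → w i j ≠ 0 → G.col i ≠ G.col j
  dual : ∃ y : Fin n → ℝ, (∀ i, 0 ≤ y i) ∧ (∀ i j, i ≠ j → (w i j : ℝ) ≤ y i + y j) ∧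
    ∑ i, y i ≤ G.weight w

end PairedColouring
end Quantum

/-! ### The matched pairs -/

namespace Assignment

variable {ι : Type*}

/-- The matching `p` matches the column `k` to the row `l` along a pair of positive weight. -/
def Paired (a : ι → ι → ℕ) (p : ι → Option ι) (k l : ι) : Prop := p k = some l ∧ a l k ≠ 0

theorem update_update_eq_some_iff [DecidableEq ι] {m : ι → Option ι} {S : ι → ι → Prop}
    (hm : ∀ k l, m k = some l ↔ S k l) {i j : ι} (hij : i ≠ j) (hi : ∀ l, ¬ S i l)
    (hj : ∀ l, ¬ S j l) (k l : ι) :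
    update (update m j (some i)) i (some j) k = some l ↔
      S k l ∨ (k = j ∧ l = i) ∨ (k = i ∧ l = j) := by
  have hk := hm k l
  rcases eq_or_ne k i with rfl | hki
  · simp [hi, hij, eq_comm]
  rcases eq_or_ne k j with rfl | hkj
  · simp [hki, hj, eq_comm]
  · simp [hki, hkj, hk]

end Assignment

namespace RAM
namespace Prog

open RAM.Expr
open Assignment

/-- Record the pair that the matching has in column `i`, if its weight is positive. -/
def recordMate : Prog :=
  ite (read Arr.matching (var Reg.i))
    (ite (read Arr.weight (idx (read Arr.matching (var Reg.i) - 1) (var Reg.i)))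
      (block [write Arr.mate (var Reg.i) (read Arr.matching (var Reg.i)),
        write Arr.mate (read Arr.matching (var Reg.i) - 1) (var Reg.i + 1)]) skip) skip

/-- Record the pairs of positive weight of the matching. -/
def mates : Prog := loop Reg.i recordMate

variable {n : ℕ} {s : Store} {p : Fin n → Option (Fin n)}

theorem vec_mate_recordMate (hn : s.arr 0 0 = n) (hp : ∀ j, s.vec Arr.matching j = code (p j))
    {j : Fin n} (hj : s.var Reg.i = j) :
    (∀ i, Paired (s.mat Arr.weight) p j i → (recordMate.run s).vec Arr.mate =
        update (update (s.vec Arr.mate) j (code (some i))) i (code (some j))) ∧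
      ((∀ i, ¬ Paired (s.mat Arr.weight) p j i) → recordMate.run s = s) := by
  have hpj := hp j
  rw [Store.vec] at hpj
  simp only [recordMate, run_ite, eval_read, eval_var, hj, hpj]
  cases hpj' : p j with
  | none => simp [Paired, hpj', code]
  | some i₀ =>
    have hmat : s.mat Arr.weight i₀ j = s.arr Arr.weight (i₀ * n + j) := rfl
    refine ⟨fun i hi => ?_, fun h => ?_⟩
    · obtain rfl : i₀ = i := by simpa [hpj'] using hi.1
      have hw := hi.2
      rw [hmat] at hw
      simp [code, hn, hj, hpj, hpj', hw, Store.vec_setArr]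
    · have hw : s.arr Arr.weight (i₀ * n + j) = 0 := by simpa [Paired, hpj', hmat] using h i₀
      simp [code, hn, hj, hpj, hpj', hw]

theorem exists_vec_mate_recordMate (hn : s.arr 0 0 = n)
    (hp : ∀ j, s.vec Arr.matching j = code (p j))
    (hinj : ∀ {i j j'}, p j = some i → p j' = some i → j = j')
    {C : Set (Fin n)} (hC : ∀ i j, s.mat Arr.weight i j ≠ 0 → i ∈ C ∧ j ∉ C)
    {R : Fin n → Fin n → Prop} (hR : R = Paired (s.mat Arr.weight) p)
    {j : Fin n} (hj : s.var Reg.i = j) {m : Fin n → Option (Fin n)}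
    (hm : ∀ i, s.vec Arr.mate i = code (m i))
    (hm' : ∀ k l, m k = some l ↔ ((k : ℕ) < j ∧ R k l) ∨ ((l : ℕ) < j ∧ R l k)) :
    ∃ m' : Fin n → Option (Fin n), (∀ i, (recordMate.run s).vec Arr.mate i = code (m' i)) ∧
      ∀ k l, m' k = some l ↔ ((k : ℕ) < j + 1 ∧ R k l) ∨ ((l : ℕ) < j + 1 ∧ R l k) := by
  obtain ⟨hpaired, hfree⟩ := vec_mate_recordMate hn hp hj
  subst hR
  set R : Fin n → Fin n → Prop := Paired (s.mat Arr.weight) p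
  have hlt (k : Fin n) : (k : ℕ) < j + 1 ↔ (k : ℕ) < j ∨ k = j := by
    rw [Nat.lt_succ_iff_lt_or_eq, Fin.ext_iff]
  by_cases hji : ∃ i, R j i
  · obtain ⟨i, hji⟩ := hji
    obtain ⟨hiC, hjC⟩ := hC i j hji.2
    have hrow (l : Fin n) (h : R i l) : False := (hC l i h.2).2 hiC
    have hcol (l : Fin n) (h : R l j) : False := hjC (hC j l h.2).1
    have hunique {l : Fin n} (h : R l i) : l = j := hinj h.1 hji.1
    have hnext (k l : Fin n) : (k : ℕ) < j + 1 ∧ R k l ↔ (k : ℕ) < j ∧ R k l ∨ k = j ∧ l = i := by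
      have heq : k = j → (R k l ↔ l = i) := by
        rintro rfl
        exact ⟨fun h => Option.some.inj (h.1.symm.trans hji.1), fun h => h ▸ hji⟩
      rw [hlt]
      tauto
    refine ⟨update (update m j (some i)) i (some j), fun k => ?_, fun k l => ?_⟩
    · rw [hpaired i hji]
      simp only [update_apply, hm]
      split_ifs <;> rfl
    · rw [update_update_eq_some_iff hm' (by rintro rfl; exact hjC hiC) (fun l => ?_) (fun l => ?_),
        hnext, hnext]
      · tauto
      · rintro (⟨-, h⟩ | ⟨hl, h⟩)
        exacts [hrow l h, hl.ne (by rw [hunique h])]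
      · rintro (⟨hl, -⟩ | ⟨-, h⟩)
        exacts [lt_irrefl _ hl, hcol l h]
  · have hnone := not_exists.1 hji
    have hnext (k l : Fin n) : (k : ℕ) < j + 1 ∧ R k l ↔ (k : ℕ) < j ∧ R k l := by
      have heq : k = j → ¬ R k l := by rintro rfl; exact hnone l
      rw [hlt]
      tauto
    exact ⟨m, by rwa [hfree hnone], fun k l => by rw [hm', hnext, hnext]⟩

theorem vec_mate_mates (hn : s.arr 0 0 = n) (hmate : s.arr Arr.mate = 0)
    (hp : ∀ j, s.vec Arr.matching j = code (p j))
    (hinj : ∀ {i j j'}, p j = some i → p j' = some i → j = j')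
    {C : Set (Fin n)} (hC : ∀ i j, s.mat Arr.weight i j ≠ 0 → i ∈ C ∧ j ∉ C) :
    ∃ m : Fin n → Option (Fin n), (∀ i, (mates.run s).vec Arr.mate i = code (m i)) ∧
      ∀ k l, m k = some l ↔
        Paired (s.mat Arr.weight) p k l ∨ Paired (s.mat Arr.weight) p l k := by
  have main := run_loop_induct (x := Reg.i) (c := recordMate) hn
    (fun q t => ∃ m : Fin n → Option (Fin n), (∀ i, t.vec Arr.mate i = code (m i)) ∧
      ∀ k l, m k = some l ↔ ((k : ℕ) < q ∧ Paired (s.mat Arr.weight) p k l) ∨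
        ((l : ℕ) < q ∧ Paired (s.mat Arr.weight) p l k))
    (fun _ _ _ h => h) ⟨fun _ => none, by simp [Store.vec, hmate, code], by simp⟩
    fun j t ht hj ⟨m, hm, hm'⟩ => exists_vec_mate_recordMate (by rw [ht.arr (by decide), hn])
      (by rwa [ht.vec Arr.matching]) hinj (by rwa [ht.mat Arr.weight])
      (by rw [ht.mat Arr.weight]) hj hm hm'
  simpa [mates] using main

end Prog
end RAM

/-! ### The output -/

namespace RAM

theorem Store.output_setVar (s : Store) {x : ℕ} (hx : x ≠ 1) (v : ℕ) :
    (s.setVar x v).output = s.output := by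
  simp [output, hx.symm]

theorem Store.output_setArr_zero {s : Store} {a : ℕ} {l : List ℕ} (h : s.output = a :: l) (v : ℕ) :
    (s.setArr 1 0 v).output = v :: l := by
  unfold output at h ⊢
  cases hv : s.var 1 with
  | zero => simp [hv] at h
  | succ m =>
    simp only [hv, List.range_succ_eq_map, List.map_cons, List.map_map, List.cons.injEq] at h
    simp [hv, List.range_succ_eq_map, ← h.2, comp_def]

namespace Prog

open RAM.Expr Quantum

/-- Append the value of an expression to the output. -/
def emit (e : Expr) : Prog := block [write 1 (var 1) e, assign 1 (var 1 + 1)]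

/-- Append a list of constants to the output. -/
def emitList (l : List ℕ) : Prog := block (l.map fun c => emit (const c))

/-- Append the block of the unmatched qubit `i` in the basis state `c`. -/
def emitSingle (c : Fin 2) : Prog :=
  block [emit 1, emit (var Reg.i), emitList (Enc.list Enc.algComplex (singleEntries c))]

/-- Append the block of qubit `i` and its mate. -/
def emitPair : Prog :=
  block [emit 2, emit (var Reg.i), emit (read Arr.mate (var Reg.i) - 1),
    emitList (Enc.list Enc.algComplex pairEntries)]

/-- Append the block that belongs to qubit `i`, if there is one, and count it. -/
def emitBlock : Prog :=
  ite (read Arr.mate (var Reg.i))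
    (ite (read Arr.colour (var Reg.i)) skip
      (block [emitPair, assign Reg.blocks (var Reg.blocks + 1)]))
    (block [ite (read Arr.colour (var Reg.i)) (emitSingle 1) (emitSingle 0),
      assign Reg.blocks (var Reg.blocks + 1)])

/-- Write all blocks; their number, which comes first, is filled in at the end. -/
def emitBlocks : Prog :=
  block [assign 1 0, emit 0, assign Reg.blocks 0, loop Reg.i emitBlock, write 1 0 (var Reg.blocks)]

theorem modVars_block_subset {L : List Prog} {V : List ℕ} (h : ∀ c ∈ L, c.modVars ⊆ V) :
    (block L).modVars ⊆ V := by
  induction L with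
  | nil => simp [block, modVars]
  | cons c L ih =>
    simp only [List.forall_mem_cons] at h
    simpa [block, modVars] using ⟨h.1, ih h.2⟩

theorem modArrs_block_subset {L : List Prog} {V : List ℕ} (h : ∀ c ∈ L, c.modArrs ⊆ V) :
    (block L).modArrs ⊆ V := by
  induction L with
  | nil => simp [block, modArrs]
  | cons c L ih =>
    simp only [List.forall_mem_cons] at h
    simpa [block, modArrs] using ⟨h.1, ih h.2⟩

theorem modVars_emitList_subset (l : List ℕ) : (emitList l).modVars ⊆ [1] :=
  modVars_block_subset (by simp [emit, block, modVars])

theorem modArrs_emitList_subset (l : List ℕ) : (emitList l).modArrs ⊆ [1] :=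
  modArrs_block_subset (by simp [emit, block, modArrs])

theorem modVars_emitBlock_subset : emitBlock.modVars ⊆ [1, Reg.blocks] := by
  have h (l : List ℕ) : (emitList l).modVars ⊆ [1, Reg.blocks] :=
    List.Subset.trans (modVars_emitList_subset l) (by simp)
  simp [emitBlock, emitSingle, emitPair, emit, block, modVars, h]

theorem modArrs_emitBlock_subset : emitBlock.modArrs ⊆ [1] := by
  simp [emitBlock, emitSingle, emitPair, emit, block, modArrs, modArrs_emitList_subset]

theorem var_run_emit (e : Expr) (s : Store) {x : ℕ} (hx : x ≠ 1) :
    ((emit e).run s).var x = s.var x :=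
  run_var _ _ (by simpa [emit, block, modVars])

theorem arr_run_emit (e : Expr) (s : Store) {k : ℕ} (hk : k ≠ 1) :
    ((emit e).run s).arr k = s.arr k :=
  run_arr _ _ (by simpa [emit, block, modArrs])

theorem var_run_emitList (l : List ℕ) (s : Store) {x : ℕ} (hx : x ≠ 1) :
    ((emitList l).run s).var x = s.var x :=
  run_var _ _ fun h => hx (by simpa using modVars_emitList_subset l h)

theorem output_emit (e : Expr) (s : Store) : ((emit e).run s).output = s.output ++ [e.eval s] := by
  have hmap : (List.range (s.var 1)).map (update (s.arr 1) (s.var 1) (e.eval s)) =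
      (List.range (s.var 1)).map (s.arr 1) :=
    List.map_congr_left fun i hi => update_of_ne (List.mem_range.1 hi).ne _ _
  simp [emit, Store.output, List.range_succ, hmap]

theorem output_emitList (l : List ℕ) (s : Store) :
    ((emitList l).run s).output = s.output ++ l := by
  induction l generalizing s with
  | nil => simp [emitList]
  | cons a l ih =>
    rw [emitList, List.map_cons, run_block_cons, ← emitList, ih, output_emit]
    simp

/-- The store `s` holds the colours and mates of `G`. -/
def Holds {n : ℕ} (s : Store) (G : PairedColouring n) : Prop :=
  (∀ i, s.vec Arr.colour i = 0 ↔ G.col i = 0) ∧ ∀ i, s.vec Arr.mate i = code (G.mate i)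

variable {n : ℕ} {s : Store} {G : PairedColouring n}

theorem output_emitBlock (hG : Holds s G) {i : Fin n} (hi : s.var Reg.i = i) :
    (emitBlock.run s).output = s.output ++ (G.blocks i).flatMap Enc.block ∧
      (emitBlock.run s).var Reg.blocks = s.var Reg.blocks + (G.blocks i).length := by
  have hcol := hG.1 i
  have hmate := hG.2 i
  simp only [Store.vec] at hcol hmate
  cases hj : G.mate i with
  | none =>
    rcases Fin.exists_fin_two.1 ⟨G.col i, rfl⟩ with hc | hc <;>
      simp_all [emitBlock, emitSingle, PairedColouring.blocks, Enc.block, Enc.list, code,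
        Store.output_setVar, output_emit, output_emitList, var_run_emit, var_run_emitList]
  | some j =>
    rcases Fin.exists_fin_two.1 ⟨G.col i, rfl⟩ with hc | hc <;>
      simp_all [emitBlock, emitPair, PairedColouring.blocks, Enc.block, Enc.list, code,
        Store.output_setVar, output_emit, output_emitList, var_run_emit, arr_run_emit,
        var_run_emitList]

theorem output_emitBlocks (hn : s.arr 0 0 = n) (hG : Holds s G) :
    (emitBlocks.run s).output = Enc.description G.description := by
  let start : Store := (block [assign 1 0, emit 0, assign Reg.blocks 0]).run s
  let D (q : ℕ) : Description n := ((List.finRange n).take q).flatMap G.blocks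
  have harr (k : ℕ) (hk : k ≠ 1) : start.arr k = s.arr k :=
    run_arr _ _ (by simpa [block, emit, modArrs])
  have hmodVars : Reg.i ∉ emitBlock.modVars := fun h => by simpa using modVars_emitBlock_subset h
  have hstart : start.output = [0] := by
    simp only [start, run_block_cons, run_block_nil, run_assign]
    rw [Store.output_setVar _ (by decide), output_emit]
    simp [Store.output]
  have main := run_loop_induct (x := Reg.i) (c := emitBlock) (s := start) (n := n)
    (by rw [harr 0 (by decide), hn])
    (fun q t => t.output = 0 :: (D q).flatMap Enc.block ∧ t.var Reg.blocks = (D q).length)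
    (fun q t v h => by rwa [Store.output_setVar _ (by decide)])
    ⟨hstart, by simp [start, D]⟩
    (fun i t ht hi h => ?_) hmodVars
  · have hD : D n = G.description := by
      simp [D, PairedColouring.description, List.take_of_length_le]
    rw [hD] at main
    refine (Store.output_setArr_zero main.1 _).trans ?_
    rw [Enc.description, Enc.list, ← main.2]
    rfl
  · have hmodArrs (k : ℕ) (hk : k ≠ 1) : t.arr k = s.arr k := by
      rw [ht.arr fun h => hk (by simpa using modArrs_emitBlock_subset h), harr k hk]
    have hGt : Holds t G := by
      simpa only [Holds, Store.vec, hmodArrs Arr.colour (by decide),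
        hmodArrs Arr.mate (by decide)] using hG
    have hD : D (i + 1) = D i ++ G.blocks i := by
      simp [D, List.take_add_one]
    obtain ⟨houtput, hcount⟩ := output_emitBlock hGt hi
    rw [houtput, hcount, h.1, h.2, hD]
    simp

theorem tame_block {L : List Prog} (h : ∀ c ∈ L, c.Tame) : (block L).Tame := by
  induction L with
  | nil => trivial
  | cons c L ih =>
    rw [List.forall_mem_cons] at h
    exact ⟨h.1, ih h.2⟩

theorem tame_emit {e : Expr} (he : e.Tame) : (emit e).Tame := by
  simp [emit, block, Tame, he]

theorem tame_emitList (l : List ℕ) : (emitList l).Tame :=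
  tame_block (by simp [tame_emit])

theorem tame_emitBlock : emitBlock.Tame := by
  simp [emitBlock, emitSingle, emitPair, block, Tame, tame_emit, tame_emitList]

theorem tame_emitBlocks : emitBlocks.Tame := by
  have hmodVars : Reg.i ∉ emitBlock.modVars := fun h => by simpa using modVars_emitBlock_subset h
  simp [emitBlocks, block, Tame, tame_emit, tame_emitBlock, hmodVars]

/-- Set up the assignment problem between the colour classes of the graph of the interactions. -/
def prepare : Prog := block [colour, commonMultiple, weights]

/-- Write out the product state that belongs to a matching of maximum weight. -/
def algorithm : Prog := block [prepare, hungarian, mates, emitBlocks]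

theorem tame_colour : colour.Tame := by
  simp [colour, mergeAdjacent, merge, moveVertex, recolourVertex, block, Tame, modVars]

theorem tame_commonMultiple : commonMultiple.Tame := by
  simp [commonMultiple, block, Tame, modVars]

theorem tame_weights : weights.Tame := by
  simp [weights, writeWeight, Tame, modVars]

theorem tame_tighten : tighten.Tame := by
  simp [tighten, findMin, comparePair, choosePair, slack, updateDual, decreaseRow, increaseCol,
    block, Tame, modVars]

theorem tame_searchStep : searchStep.Tame := by
  simp [searchStep, tame_tighten, grow, copyExposing, reach, augment, replaceMatching, block, Tame,
    modVars]

theorem tame_matchRoot : matchRoot.Tame := by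
  have hmodVars : Reg.step ∉ searchStep.modVars := by decide
  simp [matchRoot, startSearch, clearRow, clearCol, copyMatching, continueSearch, tame_searchStep,
    hmodVars, block, Tame, modVars]

theorem tame_hungarian : hungarian.Tame := by
  have hmodVars : Reg.root ∉ matchRoot.modVars := by decide
  simp [hungarian, addWeight, tame_matchRoot, hmodVars, block, Tame, modVars]

theorem tame_mates : mates.Tame := by
  simp [mates, recordMate, block, Tame, modVars]

theorem tame_prepare : prepare.Tame :=
  tame_block (by simp [tame_colour, tame_commonMultiple, tame_weights])

theorem tame_algorithm : algorithm.Tame :=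
  tame_block (by simp [tame_prepare, tame_hungarian, tame_mates, tame_emitBlocks])

end Prog
end RAM

/-! ### Correctness of the algorithm -/

namespace Enc

theorem getD_flatMap {α : Type*} {l : List α} {f : α → List ℕ} {L : ℕ} (hf : ∀ a, (f a).length = L)
    {i t : ℕ} (hi : i < l.length) (ht : t < L) :
    (l.flatMap f).getD (i * L + t) 0 = (f l[i]).getD t 0 := by
  induction l generalizing i with
  | nil => simp at hi
  | cons a l ih =>
    rw [List.flatMap_cons]
    cases i with
    | zero =>
      rw [List.getD_append _ _ _ _ (by rw [hf]; omega)]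
      simp
    | succ i =>
      rw [List.getD_append_right _ _ _ _ (by rw [hf]; nlinarith), hf,
        show (i + 1) * L + t - L = i * L + t by rw [add_mul, one_mul]; omega,
        ih (by simpa using hi)]
      simp

theorem getD_matrix {n : ℕ} (w : Matrix (Fin n) (Fin n) ℚ) (i j : Fin n) {t : ℕ} (ht : t < 3) :
    (matrix w).getD (3 * ((i : ℕ) * n + j) + t + 1) 0 = (rat (w i j)).getD t 0 := by
  have hrat (q : ℚ) : (rat q).length = 3 := rfl
  have hrow (i : Fin n) : ((List.finRange n).flatMap fun j => rat (w i j)).length = n * 3 := by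
    simp [List.length_flatMap, hrat]
  have hj := j.2
  rw [matrix, List.getD_cons_succ,
    show 3 * ((i : ℕ) * n + j) + t = i * (n * 3) + (j * 3 + t) by ring,
    getD_flatMap hrow (by simp) (by nlinarith), getD_flatMap (fun _ => hrat _) (by simp) ht]
  simp

end Enc

namespace Quantum
namespace PairedColouring

open Assignment

variable {n : ℕ} {a : Fin n → Fin n → ℕ} {p : Fin n → Option (Fin n)}

theorem exists_of_paired {C : Set (Fin n)} {m : Fin n → Option (Fin n)}
    (ha : ∀ i j, a i j ≠ 0 → i ∈ C ∧ j ∉ C)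
    (hm : ∀ k l, m k = some l ↔ Paired a p k l ∨ Paired a p l k) :
    ∃ G : PairedColouring n, G.mate = m ∧ ∀ i, G.col i = 0 ↔ i ∈ C := by
  classical
  refine ⟨{ col i := if i ∈ C then 0 else 1
            mate := m
            symm {i j} h := (hm j i).2 ((hm i j).1 h).symm
            bichromatic {i j} h := ?_ }, rfl, fun i => by simp⟩
  rcases (hm i j).1 h with h | h <;> simp [ha _ _ h.2]

variable (G : PairedColouring n)

theorem sum_elim_eq_sum_col_eq_zero (ha : ∀ i j, a i j ≠ 0 → G.col i = 0 ∧ G.col j ≠ 0)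
    (hmate : ∀ k l, G.mate k = some l ↔ Paired a p k l ∨ Paired a p l k) :
    ∑ j, (p j).elim 0 (a · j) = ∑ i with G.col i = 0, (G.mate i).elim 0 (a i) := by
  have helim (o : Option (Fin n)) (f : Fin n → ℕ) :
      o.elim 0 f = ∑ i, if o = some i then f i else 0 := by
    cases o <;> simp
  have hterm (i j : Fin n) : (if p j = some i then a i j else 0) =
      if G.col i = 0 then (if G.mate i = some j then a i j else 0) else 0 := by
    rcases eq_or_ne (a i j) 0 with h0 | h0
    · simp [h0]
    · have hcol := ha i j h0
      have hji : a j i = 0 := by_contra fun h => (ha j i h).2 hcol.1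
      simp [hmate, Paired, hcol, h0, hji]
  simp only [helim, hterm]
  rw [Finset.sum_comm, Finset.sum_filter]
  exact Finset.sum_congr rfl fun i _ => by split_ifs <;> simp

theorem optimal_of_assignment {w : Matrix (Fin n) (Fin n) ℚ} (hw : IsInteraction w)
    {u v : Fin n → ℕ} {P : ℕ} (hP : 0 < P)
    (proper : ∀ i j, i ≠ j → w i j ≠ 0 → G.col i ≠ G.col j)
    (ha : ∀ i j, (a i j : ℝ) = if G.col i = 0 ∧ G.col j ≠ 0 then P * (w i j : ℝ) else 0)
    (hopt : Assignment.Optimal Set.univ a u v p)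
    (hmate : ∀ k l, G.mate k = some l ↔ Paired a p k l ∨ Paired a p l k) : G.Optimal w := by
  have hP' : (0 : ℝ) < P := by exact_mod_cast hP
  have hcol (i j : Fin n) (h : a i j ≠ 0) : G.col i = 0 ∧ G.col j ≠ 0 := by
    by_contra hc
    exact h (by simpa [hc] using ha i j)
  have hle (i j : Fin n) (hi : G.col i = 0) (hj : G.col j ≠ 0) :
      (w i j : ℝ) ≤ u i / P + v j / P := by
    rw [← add_div, le_div_iff₀' hP']
    calc P * (w i j : ℝ) = a i j := by rw [ha, if_pos ⟨hi, hj⟩]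
      _ ≤ u i + v j := by exact_mod_cast hopt.le i j
  refine ⟨proper, fun i => if G.col i = 0 then u i / P else v i / P,
    fun i => by dsimp only; split_ifs <;> positivity, fun i j hij => ?_, ?_⟩
  · rcases eq_or_ne (w i j) 0 with h0 | h0
    · rw [h0, Rat.cast_zero]
      dsimp only
      split_ifs <;> positivity
    · have hne := proper i j hij h0
      dsimp only
      by_cases hi : G.col i = 0
      · rw [if_pos hi, if_neg (hi ▸ hne.symm)]
        exact hle i j hi (hi ▸ hne.symm)
      · have hj : G.col j = 0 := by omega
        rw [if_neg hi, if_pos hj, ← hw.1.apply i j, add_comm]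
        exact hle j i hj hi
  · have hweight : ((∑ i with G.col i = 0, (G.mate i).elim 0 (a i) : ℕ) : ℝ) = G.weight w * P := by
      rw [weight, Finset.sum_mul, Nat.cast_sum]
      refine Finset.sum_congr rfl fun i hi => ?_
      have hi := (Finset.mem_filter.1 hi).2
      cases hj : G.mate i with
      | none => simp
      | some j => simp [ha, hi, hi ▸ (G.bichromatic hj).symm, mul_comm]
    rw [← mul_le_mul_iff_left₀ hP', ← hweight, ← G.sum_elim_eq_sum_col_eq_zero hcol hmate,
      hopt.sum_eq, Finset.sum_mul, ← Finset.sum_add_distrib, Nat.cast_sum]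
    refine Finset.sum_le_sum fun i _ => ?_
    split_ifs <;> simp [hP'.ne']

end PairedColouring
end Quantum

namespace RAM
namespace Prog

open Quantum

theorem cast_div_den_mul_natAbs_num {q : ℚ} (hq : 0 ≤ q) {P : ℕ} (h : q.den ∣ P) :
    ((P / q.den * q.num.natAbs : ℕ) : ℚ) = P * q := by
  have hden : (q.den : ℚ) ≠ 0 := by exact_mod_cast q.den_nz
  rw [Nat.cast_mul, Nat.cast_div h hden, Nat.cast_natAbs, abs_of_nonneg (Rat.num_nonneg.2 hq)]
  nth_rw 3 [← q.num_div_den]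
  ring

variable {n : ℕ} {w : Matrix (Fin n) (Fin n) ℚ}

theorem entryNum_initStore (i j : Fin n) :
    entryNum ((initStore (Enc.matrix w)).arr 0) i j = (w i j).num.natAbs :=
  Enc.getD_matrix w i j (t := 1) (by decide)

theorem entryDen_initStore (i j : Fin n) :
    entryDen ((initStore (Enc.matrix w)).arr 0) i j = (w i j).den :=
  Enc.getD_matrix w i j (t := 2) (by decide)

open Classical in
theorem prepare_spec (hw : IsInteraction w) (hb : IsBipartite w) {s : Store}
    (hs : s = prepare.run (initStore (Enc.matrix w))) :
    (∀ i j, i ≠ j → w i j ≠ 0 → (i ∈ colourClass n s ↔ j ∉ colourClass n s)) ∧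
      ∃ P : ℕ, 0 < P ∧ ∀ i j, (s.mat Arr.weight i j : ℝ) =
        if i ∈ colourClass n s ∧ j ∉ colourClass n s then P * (w i j : ℝ) else 0 := by
  obtain ⟨A, hA⟩ := hb
  set s₀ := initStore (Enc.matrix w)
  have hn : s₀.arr 0 0 = n := rfl
  let s₁ := colour.run s₀
  let s₂ := commonMultiple.run s₁
  have h₁ : s₁.arr 0 = s₀.arr 0 := run_arr _ _ (by decide)
  have h₂ : s₂.arr 0 = s₀.arr 0 := (run_arr _ _ (by decide)).trans h₁
  have hclass : colourClass n s = colourClass n s₁ := by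
    have harr : s.arr Arr.colour = s₁.arr Arr.colour := by
      rw [hs]
      exact run_arr (block [commonMultiple, weights]) s₁ (by decide)
    simp only [colourClass, Store.vec, harr]
  have hclass₂ : colourClass n s₂ = colourClass n s₁ := by
    have harr : s₂.arr Arr.colour = s₁.arr Arr.colour := run_arr _ _ (by decide)
    simp only [colourClass, Store.vec, harr]
  obtain ⟨hP, hdvd⟩ := commonMultiple_spec (n := n) (s := s₁) (by rw [h₁, hn])
    fun i j => by rw [h₁, entryDen_initStore]; exact (w i j).den_pos
  refine ⟨fun i j hij hne => ?_, s₂.var Reg.multiple, hP, fun i j => ?_⟩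
  · rw [hclass]
    refine colour_spec hn (A := A) (fun i j h => ?_) ⟨hij, ?_⟩
    · have hne : w i j ≠ 0 := by simpa [s₀, entryNum_initStore] using h.2
      by_contra hc
      exact hne (hA i j h.1 (by tauto))
    · simpa [s₀, entryNum_initStore]
  · have hs₂ : s = weights.run s₂ := hs
    have hdvd := hdvd i j
    rw [h₁, entryDen_initStore] at hdvd
    rw [hclass, hs₂, mat_weight_weights (by rw [h₂, hn]), hclass₂, h₂, entryDen_initStore,
      entryNum_initStore]
    split_ifs
    · exact_mod_cast cast_div_den_mul_natAbs_num (hw.2 i j) hdvd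
    · simp

theorem algorithm_spec (hw : IsInteraction w) (hb : IsBipartite w) :
    ∃ G : PairedColouring n, G.Optimal w ∧
      (algorithm.run (initStore (Enc.matrix w))).output = Enc.description G.description := by
  classical
  set s₀ := initStore (Enc.matrix w)
  obtain ⟨s, hs⟩ : ∃ s, s = prepare.run s₀ := ⟨_, rfl⟩
  obtain ⟨proper, P, hP, hweight⟩ := prepare_spec hw hb hs
  have h₀ : prepare.Frame s₀ s := hs ▸ frame_run prepare s₀
  have hn : s.arr 0 0 = n := congrFun (h₀.arr (by decide)) 0
  obtain ⟨p, hp, hopt⟩ := hungarian_spec hn (h₀.arr (by decide)) (h₀.arr (by decide))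
  have h₁ : hungarian.Frame s (hungarian.run s) := frame_run _ _
  rw [h₁.mat Arr.weight] at hopt
  have hC (i j : Fin n) (h : s.mat Arr.weight i j ≠ 0) :
      i ∈ colourClass n s ∧ j ∉ colourClass n s := by
    by_contra hc
    exact h (by simpa only [if_neg hc, Nat.cast_eq_zero] using hweight i j)
  obtain ⟨m, hm, hpaired⟩ := vec_mate_mates (by rw [h₁.arr (by decide), hn])
    ((h₁.arr (by decide)).trans (h₀.arr (by decide))) hp hopt.matching.inj
    (C := colourClass n s) (by rwa [h₁.mat Arr.weight])
  rw [h₁.mat Arr.weight] at hpaired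
  obtain ⟨G, rfl, hcol⟩ := PairedColouring.exists_of_paired hC hpaired
  refine ⟨G, G.optimal_of_assignment hw hP (fun i j hij h hc => ?_) (fun i j => ?_) hopt hpaired,
    ?_⟩
  · have hne := proper i j hij h
    rw [← hcol i, ← hcol j, hc] at hne
    exact iff_not_self hne
  · simp only [hweight, ne_eq, hcol]
  · have h₂ : mates.Frame (hungarian.run s) (mates.run (hungarian.run s)) := frame_run _ _
    have hrun : algorithm.run s₀ = emitBlocks.run (mates.run (hungarian.run s)) := by
      rw [hs]
      rfl
    rw [hrun]
    refine output_emitBlocks (by rw [h₂.arr (by decide), h₁.arr (by decide), hn]) ⟨fun i => ?_, hm⟩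
    rw [h₂.vec Arr.colour, h₁.vec Arr.colour]
    exact (hcol i).symm

end Prog
end RAM

/-! ### The upper bound on the energy -/

namespace Quantum

section Exchange

variable {ι : Type*} [DecidableEq ι]

/-- Exchange of the qubits `i` and `j` in a basis state. -/
def exch (i j : ι) (x : ι → Fin 2) : ι → Fin 2 := x ∘ Equiv.swap i j

@[simp]
theorem exch_apply_left (i j : ι) (x : ι → Fin 2) : exch i j x i = x j := by simp [exch]

@[simp]
theorem exch_apply_right (i j : ι) (x : ι → Fin 2) : exch i j x j = x i := by simp [exch]

theorem exch_apply_of_ne {i j k : ι} (hi : k ≠ i) (hj : k ≠ j) (x : ι → Fin 2) :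
    exch i j x k = x k := by
  simp [exch, Equiv.swap_apply_of_ne_of_ne hi hj]

theorem involutive_exch (i j : ι) : Involutive (exch i j) := fun x => by
  funext k
  simp [exch]

theorem exch_comm (i j : ι) (x : ι → Fin 2) : exch i j x = exch j i x := by
  rw [exch, Equiv.swap_comm, exch]

theorem exch_eq_self {i j : ι} {x : ι → Fin 2} (h : x i = x j) : exch i j x = x := by
  funext k
  by_cases hi : k = i
  · rw [hi, exch_apply_left, h]
  by_cases hj : k = j
  · rw [hj, exch_apply_right, h]
  exact exch_apply_of_ne hi hj x

theorem exch_exch {i j l : ι} (hil : i ≠ l) (hjl : j ≠ l) (x : ι → Fin 2) :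
    exch i j (exch i l x) = exch j l (exch i j x) := by
  funext k
  simp only [exch, comp_apply, Equiv.swap_apply_def]
  grind

/-- Two of the three bits agree. -/
theorem antisymm_eq_zero {M : Type*} [AddCommGroup M] (ψ : (ι → Fin 2) → M) {i j l : ι}
    (hij : i ≠ j) (hil : i ≠ l) (hjl : j ≠ l) (x : ι → Fin 2) :
    ψ x - ψ (exch i j x) - ψ (exch i l x) - ψ (exch j l x) + ψ (exch i l (exch i j x)) +
      ψ (exch i j (exch i l x)) = 0 := by
  have pigeonhole : x i = x j ∨ x i = x l ∨ x j = x l := by omega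
  have hj : exch i j (exch i l x) = exch j l (exch i j x) := exch_exch hil hjl x
  have hl : exch i l (exch i j x) = exch j l (exch i l x) := by
    rw [exch_exch hij hjl.symm, exch_comm l j]
  rcases pigeonhole with h | h | h
  · rw [hj, exch_eq_self h]
    abel
  · rw [hl, exch_eq_self h]
    abel
  · have hj' : exch i j (exch i l x) = exch i l x := by
      rw [exch_comm i l, ← exch_exch hjl.symm hij, exch_comm l j, exch_eq_self h]
    have hl' : exch i l (exch i j x) = exch i j x := by
      rw [exch_comm i j, ← exch_exch hjl hil, exch_eq_self h]
    rw [hj', hl', exch_eq_self h]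
    abel

variable [Fintype ι]

theorem sum_exch {M : Type*} [AddCommMonoid M] (i j : ι) (f : (ι → Fin 2) → M) :
    ∑ x, f (exch i j x) = ∑ x, f x :=
  Equiv.sum_comp (involutive_exch i j).toPerm f

/-- The expectation of the exchange of the qubits `i` and `j` in the pure state `ψ`. -/
def exchSum (ψ : (ι → Fin 2) → ℝ) (i j : ι) : ℝ := ∑ x, ψ x * ψ (exch i j x)

variable (ψ : (ι → Fin 2) → ℝ)

theorem exchSum_comm (i j : ι) : exchSum ψ i j = exchSum ψ j i := by
  simp only [exchSum, exch_comm i j]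

theorem exchSum_le (i j : ι) : exchSum ψ i j ≤ ∑ x, ψ x ^ 2 := by
  have amgm : 2 * exchSum ψ i j ≤ ∑ x, ψ x ^ 2 + ∑ x, ψ (exch i j x) ^ 2 := by
    rw [exchSum, Finset.mul_sum, ← Finset.sum_add_distrib]
    refine Finset.sum_le_sum fun x _ => ?_
    rw [← mul_assoc]
    exact two_mul_le_add_sq _ _
  rw [sum_exch i j fun x => ψ x ^ 2] at amgm
  linarith

theorem two_mul_sum_exch_mul_exch {i j l : ι} (hij : i ≠ j) (hil : i ≠ l) (hjl : j ≠ l) :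
    2 * ∑ x, ψ (exch i j x) * ψ (exch i l x) =
      exchSum ψ i j + exchSum ψ i l + exchSum ψ j l - ∑ x, ψ x ^ 2 := by
  have hl : ∑ x, ψ x * ψ (exch i l (exch i j x)) = ∑ x, ψ (exch i j x) * ψ (exch i l x) := by
    rw [← sum_exch i j]
    simp only [involutive_exch i j _]
  have hj : ∑ x, ψ x * ψ (exch i j (exch i l x)) = ∑ x, ψ (exch i j x) * ψ (exch i l x) := by
    rw [← sum_exch i l]
    simp only [involutive_exch i l _]
    exact Finset.sum_congr rfl fun x _ => mul_comm _ _
  have antisymm : ∑ x, ψ x * (ψ x - ψ (exch i j x) - ψ (exch i l x) - ψ (exch j l x) +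
      ψ (exch i l (exch i j x)) + ψ (exch i j (exch i l x))) = 0 :=
    Finset.sum_eq_zero fun x _ => by rw [antisymm_eq_zero ψ hij hil hjl, mul_zero]
  simp only [mul_add, mul_sub, Finset.sum_add_distrib, Finset.sum_sub_distrib] at antisymm
  rw [hl, hj] at antisymm
  simp only [exchSum, sq]
  linarith

theorem sum_add_sum_exch_sq (i : ι) (T : Finset ι) :
    ∑ x, (ψ x + ∑ j ∈ T, ψ (exch i j x)) ^ 2 =
      ∑ x, ψ x ^ 2 + 2 * ∑ j ∈ T, exchSum ψ i j +
        ∑ j ∈ T, ∑ l ∈ T, ∑ x, ψ (exch i j x) * ψ (exch i l x) := by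
  simp only [exchSum, Finset.sum_comm (s := T) (t := Finset.univ), ← Finset.mul_sum,
    ← Finset.sum_mul]
  rw [Finset.mul_sum, ← Finset.sum_add_distrib, ← Finset.sum_add_distrib]
  exact Finset.sum_congr rfl fun x _ => by ring

theorem sum_exch_mul_exch_le {i j l : ι} (hij : i ≠ j) (hil : i ≠ l) :
    ∑ x, ψ (exch i j x) * ψ (exch i l x) ≤
      (exchSum ψ i j + exchSum ψ i l) / 2 +
        if j = l then ∑ x, ψ x ^ 2 - exchSum ψ i j else 0 := by
  by_cases hjl : j = l
  · subst hjl
    rw [if_pos rfl, sum_exch i j fun x => ψ x * ψ x]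
    simp only [sq]
    linarith
  · rw [if_neg hjl]
    linarith [two_mul_sum_exch_mul_exch ψ hij hil hjl, exchSum_le ψ j l]

/-- Monogamy of entanglement. -/
theorem sum_neg_exchSum_le {i : ι} {T : Finset ι} (hT : i ∉ T) :
    ∑ j ∈ T, -exchSum ψ i j ≤ ∑ x, ψ x ^ 2 := by
  set N := ∑ x, ψ x ^ 2
  set J := ∑ j ∈ T, exchSum ψ i j with hJ
  have hne : ∀ {j}, j ∈ T → i ≠ j := by
    rintro j hj rfl
    exact hT hj
  have cross : ∑ j ∈ T, ∑ l ∈ T, ∑ x, ψ (exch i j x) * ψ (exch i l x) ≤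
      T.card * J + (T.card * N - J) :=
    calc ∑ j ∈ T, ∑ l ∈ T, ∑ x, ψ (exch i j x) * ψ (exch i l x)
        ≤ ∑ j ∈ T, ∑ l ∈ T, ((exchSum ψ i j + exchSum ψ i l) / 2 +
            if j = l then N - exchSum ψ i j else 0) :=
          Finset.sum_le_sum fun j hj => Finset.sum_le_sum fun l hl =>
            sum_exch_mul_exch_le ψ (hne hj) (hne hl)
      _ = ∑ j ∈ T, ((T.card * exchSum ψ i j + J) / 2 + (N - exchSum ψ i j)) :=
          Finset.sum_congr rfl fun j hj => by
            rw [Finset.sum_add_distrib, Finset.sum_ite_eq, if_pos hj, ← Finset.sum_div,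
              Finset.sum_add_distrib, Finset.sum_const, nsmul_eq_mul]
      _ = T.card * J + (T.card * N - J) := by
          simp only [Finset.sum_add_distrib, Finset.sum_sub_distrib, Finset.sum_const,
            nsmul_eq_mul, ← Finset.sum_div, ← Finset.mul_sum, ← hJ]
          ring
  have square : 0 ≤ N + 2 * J + ∑ j ∈ T, ∑ l ∈ T, ∑ x, ψ (exch i j x) * ψ (exch i l x) :=
    (Finset.sum_nonneg fun x _ => sq_nonneg _).trans_eq (sum_add_sum_exch_sq ψ i T)
  have hNJ : 0 ≤ N + J := by
    refine nonneg_of_mul_nonneg_right (a := (T.card : ℝ) + 1) ?_ (by positivity)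
    linarith
  rw [Finset.sum_neg_distrib]
  linarith

end Exchange

variable {n : ℕ}

theorem sum_lt_add_mul {f : Fin n → Fin n → ℝ} (hf : ∀ i j, f i j = f j i) (y : Fin n → ℝ) :
    ∑ i, ∑ j with i < j, (y i + y j) * f i j = ∑ i, y i * ∑ j with j ≠ i, f i j := by
  simp only [add_mul, Finset.sum_add_distrib, Finset.sum_filter]
  rw [Finset.sum_comm (f := fun i j => if i < j then y j * f i j else 0),
    ← Finset.sum_add_distrib]
  refine Finset.sum_congr rfl fun i _ => ?_
  rw [← Finset.sum_add_distrib, Finset.mul_sum]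
  refine Finset.sum_congr rfl fun j _ => ?_
  rcases lt_trichotomy i j with h | rfl | h
  · simp [h, h.not_gt, h.ne']
  · simp
  · simp [h, h.not_gt, h.ne, hf i j]

/-- Charging every edge to the dual weights of its ends leaves one star bound per qubit. -/
theorem sum_mul_neg_exchSum_le (ψ : (Fin n → Fin 2) → ℝ) {w : Fin n → Fin n → ℝ}
    (hw : ∀ i j, 0 ≤ w i j) {y : Fin n → ℝ} (hy : ∀ i, 0 ≤ y i)
    (hwy : ∀ i j, i ≠ j → w i j ≤ y i + y j) :
    ∑ i, ∑ j with i < j, w i j * -exchSum ψ i j ≤ (∑ i, y i) * ∑ x, ψ x ^ 2 := by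
  have star_bound (i : Fin n) : ∑ j with j ≠ i, max (-exchSum ψ i j) 0 ≤ ∑ x, ψ x ^ 2 := by
    refine le_of_eq_of_le ?_ (sum_neg_exchSum_le ψ (i := i)
      (T := {j ∈ ({j | j ≠ i} : Finset (Fin n)) | 0 < -exchSum ψ i j}) (by simp))
    rw [Finset.sum_filter (fun j => 0 < -exchSum ψ i j)]
    refine Finset.sum_congr rfl fun j _ => ?_
    split_ifs with h
    · exact max_eq_left h.le
    · exact max_eq_right (not_lt.1 h)
  calc ∑ i, ∑ j with i < j, w i j * -exchSum ψ i j
      ≤ ∑ i, ∑ j with i < j, (y i + y j) * max (-exchSum ψ i j) 0 := by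
        refine Finset.sum_le_sum fun i _ => Finset.sum_le_sum fun j hj => ?_
        have hij : w i j ≤ y i + y j := hwy i j (Finset.mem_filter.1 hj).2.ne
        exact (mul_le_mul_of_nonneg_left (le_max_left _ 0) (hw i j)).trans
          (mul_le_mul_of_nonneg_right hij (le_max_right _ _))
    _ = ∑ i, y i * ∑ j with j ≠ i, max (-exchSum ψ i j) 0 :=
        sum_lt_add_mul (fun i j => by rw [exchSum_comm]) y
    _ ≤ ∑ i, y i * ∑ x, ψ x ^ 2 :=
        Finset.sum_le_sum fun i _ => mul_le_mul_of_nonneg_left (star_bound i) (hy i)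
    _ = (∑ i, y i) * ∑ x, ψ x ^ 2 := (Finset.sum_mul _ _ _).symm

theorem singlet_mul_star (a b c d : Fin 2) :
    singlet (a, b) * star (singlet (c, d)) =
      ((if c = a ∧ d = b then 1 else 0) - (if c = b ∧ d = a then 1 else 0)) / 2 := by
  have hsq : ((√2 : ℝ) : ℂ) * ((√2 : ℝ) : ℂ) = 2 := by
    rw [← Complex.ofReal_mul, Real.mul_self_sqrt zero_le_two, Complex.ofReal_ofNat]
  have hinv : (((√2 : ℝ) : ℂ))⁻¹ * (((√2 : ℝ) : ℂ))⁻¹ = 2⁻¹ := by rw [← mul_inv, hsq]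
  fin_cases a <;> fin_cases b <;> fin_cases c <;> fin_cases d <;>
    simp [singlet, div_eq_mul_inv, hinv]

theorem singletProj_apply (i j : Fin n) (x y : Fin n → Fin 2) :
    singletProj i j x y = ((if y = x then 1 else 0) - (if y = exch i j x then 1 else 0)) / 2 := by
  have eq_iff {z : Fin n → Fin 2} (h : ∀ k, k ≠ i → k ≠ j → z k = y k) :
      y = z ↔ y i = z i ∧ y j = z j := by
    refine ⟨fun e => e ▸ ⟨rfl, rfl⟩, fun ⟨hi, hj⟩ => funext fun k => ?_⟩
    by_cases hki : k = i
    · rw [hki, hi]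
    by_cases hkj : k = j
    · rw [hkj, hj]
    exact (h k hki hkj).symm
  by_cases h : ∀ k, k ≠ i → k ≠ j → x k = y k
  · have hexch : ∀ k, k ≠ i → k ≠ j → exch i j x k = y k := fun k hi hj =>
      (exch_apply_of_ne hi hj x).trans (h k hi hj)
    rw [singletProj, Matrix.of_apply, if_pos h, singlet_mul_star]
    simp only [eq_iff h, eq_iff hexch, exch_apply_left, exch_apply_right]
  · have hx : y ≠ x := by
      rintro rfl
      exact h fun _ _ _ => rfl
    have hexch : y ≠ exch i j x := by
      rintro rfl
      exact h fun k hi hj => (exch_apply_of_ne hi hj x).symm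
    simp [singletProj, h, hx, hexch]

theorem singletProj_mulVec (i j : Fin n) (v : (Fin n → Fin 2) → ℂ) (x : Fin n → Fin 2) :
    (singletProj i j).mulVec v x = (v x - v (exch i j x)) / 2 := by
  simp only [Matrix.mulVec, dotProduct, singletProj_apply, sub_div, sub_mul,
    Finset.sum_sub_distrib, div_mul_eq_mul_div, ite_mul, one_mul, zero_mul, ← Finset.sum_div,
    Finset.sum_ite_eq', Finset.mem_univ, if_true]

theorem qmcHamiltonian_mulVec (w : Matrix (Fin n) (Fin n) ℚ) (v : (Fin n → Fin 2) → ℂ)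
    (x : Fin n → Fin 2) :
    (qmcHamiltonian w).mulVec v x =
      ∑ i, ∑ j with i < j, (w i j : ℂ) * ((v x - v (exch i j x)) / 2) := by
  simp only [qmcHamiltonian, Matrix.sum_mulVec, Finset.sum_apply, Matrix.smul_mulVec,
    Pi.smul_apply, singletProj_mulVec, smul_eq_mul]

/-- The sum of the weights of all pairs of qubits. -/
def totalWeight (w : Matrix (Fin n) (Fin n) ℚ) : ℝ := ∑ i, ∑ j with i < j, (w i j : ℝ)

theorem sum_mul_sub_exchSum (w : Matrix (Fin n) (Fin n) ℚ) (ψ : (Fin n → Fin 2) → ℝ) :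
    ∑ x, ψ x * ∑ i, ∑ j with i < j, (w i j : ℝ) * ((ψ x - ψ (exch i j x)) / 2) =
      (totalWeight w * ∑ x, ψ x ^ 2 +
        ∑ i, ∑ j with i < j, (w i j : ℝ) * -exchSum ψ i j) / 2 := by
  simp only [totalWeight, Finset.sum_mul (_ : Finset (Fin n)), ← Finset.sum_add_distrib,
    Finset.sum_div, Finset.mul_sum (_ : Finset (Fin n))]
  rw [Finset.sum_comm]
  refine Finset.sum_congr rfl fun i _ => ?_
  rw [Finset.sum_comm]
  refine Finset.sum_congr rfl fun j _ => ?_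
  rw [exchSum, ← Finset.sum_neg_distrib, ← mul_add, ← Finset.sum_add_distrib, mul_div_assoc,
    Finset.sum_div, Finset.mul_sum]
  exact Finset.sum_congr rfl fun x _ => by ring

theorem eigenvalue_le {w : Matrix (Fin n) (Fin n) ℚ} (hw : ∀ i j, 0 ≤ w i j) {y : Fin n → ℝ}
    (hy : ∀ i, 0 ≤ y i) (hwy : ∀ i j, i ≠ j → (w i j : ℝ) ≤ y i + y j) {μ : ℝ}
    {ψ : (Fin n → Fin 2) → ℝ} (hψ : ψ ≠ 0)
    (h : ∀ x, μ * ψ x = ∑ i, ∑ j with i < j, (w i j : ℝ) * ((ψ x - ψ (exch i j x)) / 2)) :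
    μ ≤ (totalWeight w + ∑ i, y i) / 2 := by
  have hpos : 0 < ∑ x, ψ x ^ 2 := by
    obtain ⟨x, hx⟩ := ne_iff.1 hψ
    exact Finset.sum_pos' (fun x _ => sq_nonneg _) ⟨x, Finset.mem_univ x, sq_pos_of_ne_zero hx⟩
  have rayleigh := sum_mul_sub_exchSum w ψ
  simp only [← h, mul_left_comm _ μ, ← Finset.mul_sum, ← sq] at rayleigh
  have bound := sum_mul_neg_exchSum_le ψ (w := fun i j => (w i j : ℝ))
    (fun i j => Rat.cast_nonneg.2 (hw i j)) hy hwy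
  refine le_of_mul_le_mul_right ?_ hpos
  rw [rayleigh]
  linarith

theorem lambdaMax_le {w : Matrix (Fin n) (Fin n) ℚ} (hw : ∀ i j, 0 ≤ w i j) {y : Fin n → ℝ}
    (hy : ∀ i, 0 ≤ y i) (hwy : ∀ i j, i ≠ j → (w i j : ℝ) ≤ y i + y j) :
    lambdaMax (qmcHamiltonian w) ≤ (totalWeight w + ∑ i, y i) / 2 := by
  have hW : 0 ≤ totalWeight w :=
    Finset.sum_nonneg fun i _ => Finset.sum_nonneg fun j _ => Rat.cast_nonneg.2 (hw i j)
  refine Real.sSup_le (fun μ hμ => ?_)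
    (div_nonneg (add_nonneg hW (Finset.sum_nonneg fun i _ => hy i)) zero_le_two)
  rw [spectrum.mem_iff, Matrix.isUnit_iff_isUnit_det, isUnit_iff_ne_zero, not_not,
    ← Matrix.exists_mulVec_eq_zero_iff] at hμ
  obtain ⟨v, hv, h⟩ := hμ
  have eigen (x) : (μ : ℂ) * v x =
      ∑ i, ∑ j with i < j, (w i j : ℂ) * ((v x - v (exch i j x)) / 2) := by
    have := congrFun h x
    rw [Algebra.algebraMap_eq_smul_one, Matrix.sub_mulVec, Matrix.smul_mulVec, Matrix.one_mulVec,
      Pi.sub_apply, Pi.smul_apply, qmcHamiltonian_mulVec, Pi.zero_apply, sub_eq_zero] at this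
    rw [← this, Complex.real_smul]
  by_cases hre : (fun x => (v x).re) = 0
  · have him : (fun x => (v x).im) ≠ 0 := fun him =>
      hv (funext fun x => Complex.ext (congrFun hre x) (congrFun him x))
    refine eigenvalue_le hw hy hwy him fun x => ?_
    simpa using congrArg Complex.im (eigen x)
  · refine eigenvalue_le hw hy hwy hre fun x => ?_
    simpa using congrArg Complex.re (eigen x)

end Quantum

/-! ### The states of the blocks -/

namespace Quantum

/-- `sin 2θ` for the angle `θ` of the tilted singlet `cos θ |01⟩ - sin θ |10⟩` on a matched pair. -/
def sinTwo : ℝ := Real.goldenRatio⁻¹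

/-- `cos 2θ` for the angle `θ` of the tilted singlet `cos θ |01⟩ - sin θ |10⟩` on a matched pair. -/
def cosTwo : ℝ := √sinTwo

theorem sinTwo_eq : sinTwo = (√5 - 1) / 2 := by
  rw [sinTwo, Real.inv_goldenRatio, Real.goldenConj]
  ring

theorem sinTwo_sq_add : sinTwo ^ 2 + sinTwo = 1 := by
  rw [sinTwo, Real.inv_goldenRatio]
  linear_combination Real.goldenConj_sq

theorem sinTwo_pos : 0 < sinTwo := inv_pos.2 Real.goldenRatio_pos

theorem sinTwo_lt_one : sinTwo < 1 := inv_lt_one_of_one_lt₀ Real.one_lt_goldenRatio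

theorem cosTwo_sq : cosTwo ^ 2 = sinTwo := Real.sq_sqrt sinTwo_pos.le

theorem cosTwo_nonneg : 0 ≤ cosTwo := Real.sqrt_nonneg _

theorem cosTwo_le_one : cosTwo ≤ 1 := Real.sqrt_le_one.2 sinTwo_lt_one.le

/-- The amplitude `cos θ` of `|01⟩` in the tilted singlet. -/
def cosAmp : ℝ := √((1 + cosTwo) / 2)

/-- The amplitude `sin θ` of `-|10⟩` in the tilted singlet. -/
def sinAmp : ℝ := √((1 - cosTwo) / 2)

theorem cosAmp_sq : cosAmp ^ 2 = (1 + cosTwo) / 2 := Real.sq_sqrt (by linarith [cosTwo_nonneg])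

theorem sinAmp_sq : sinAmp ^ 2 = (1 - cosTwo) / 2 := Real.sq_sqrt (by linarith [cosTwo_le_one])

theorem cosAmp_mul_sinAmp : cosAmp * sinAmp = sinTwo / 2 := by
  have hsq : (1 + cosTwo) / 2 * ((1 - cosTwo) / 2) = (sinTwo / 2) ^ 2 := by
    linear_combination -cosTwo_sq / 4 - sinTwo_sq_add / 4
  rw [cosAmp, sinAmp, ← Real.sqrt_mul (by linarith [cosTwo_nonneg]), hsq]
  exact Real.sqrt_sq (by linarith [sinTwo_pos])

theorem algZero_represents : algZero.Represents 0 := fun y => by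
  have eval : algZero.polyEval y = y := by simp [algZero, AlgReal.polyEval]
  rw [eval]
  simp only [algZero, Rat.cast_zero]
  grind

theorem algOne_represents : algOne.Represents 1 := fun y => by
  have eval : algOne.polyEval y = -1 + y := by simp [algOne, AlgReal.polyEval]
  rw [eval]
  simp only [algOne, Rat.cast_one]
  grind

/-- The roots of the quartic are `(1 ± √s) / 2` for the two roots `s` of `s² + s = 1`. -/
theorem quartic_eq_zero_iff (y : ℝ) :
    1 + y * (-12 + y * (28 + y * (-32 + y * 16))) = 0 ↔
      y = (1 + cosTwo) / 2 ∨ y = (1 - cosTwo) / 2 := by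
  have factors : 1 + y * (-12 + y * (28 + y * (-32 + y * 16))) =
      4 * (y - (1 + cosTwo) / 2) * (y - (1 - cosTwo) / 2) * ((2 * y - 1) ^ 2 + sinTwo + 1) := by
    linear_combination sinTwo_sq_add + ((2 * y - 1) ^ 2 + sinTwo + 1) * cosTwo_sq
  have hpos : (2 * y - 1) ^ 2 + sinTwo + 1 ≠ 0 := by
    have := sinTwo_pos
    positivity
  simp only [factors, mul_eq_zero, hpos, or_false, OfNat.ofNat_ne_zero, false_or, sub_eq_zero]

theorem algMajor_represents : algMajor.Represents ((1 + cosTwo) / 2) := fun y => by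
  have eval : algMajor.polyEval y = 1 + y * (-12 + y * (28 + y * (-32 + y * 16))) := by
    simp [algMajor, AlgReal.polyEval]
  have hpos : 0 < cosTwo := Real.sqrt_pos.2 sinTwo_pos
  have hle := cosTwo_le_one
  rw [eval, quartic_eq_zero_iff]
  norm_num only [algMajor]
  grind

theorem algMinor_represents : algMinor.Represents ((1 - cosTwo) / 2) := fun y => by
  have eval : algMinor.polyEval y = 1 + y * (-12 + y * (28 + y * (-32 + y * 16))) := by
    simp [algMinor, AlgReal.polyEval]
  have hpos : 0 < cosTwo := Real.sqrt_pos.2 sinTwo_pos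
  have hle := cosTwo_le_one
  rw [eval, quartic_eq_zero_iff]
  norm_num only [algMinor]
  grind

theorem algCross_represents : algCross.Represents (-sinTwo / 2) := fun y => by
  have eval : algCross.polyEval y = (2 * y + sinTwo) * (2 * y - sinTwo - 1) := by
    simp only [algCross, AlgReal.polyEval]
    norm_num
    linear_combination sinTwo_sq_add
  have hpos := sinTwo_pos
  have hlt := sinTwo_lt_one
  rw [eval, mul_eq_zero]
  norm_num only [algCross]
  grind

theorem AlgReal.Represents.toComplex {a : AlgReal} {r : ℝ} (h : a.Represents r) :
    a.toComplex.Represents (r : ℂ) :=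
  ⟨h, algZero_represents⟩

/-- The amplitudes of the basis state `|c⟩` of one qubit. -/
def singleAmp (c a : Fin 2) : ℝ := if a = c then 1 else 0

/-- The amplitudes of the tilted singlet. -/
def pairAmp (a b : Fin 2) : ℝ := if a = b then 0 else if a = 0 then cosAmp else -sinAmp

/-- The amplitudes of the state of a block with the given qubits. -/
def blockAmp {n : ℕ} (col : Fin n → Fin 2) : (l : List (Fin n)) → (Fin l.length → Fin 2) → ℝ
  | [i] => fun z => singleAmp (col i) (z 0)
  | [_, _] => fun z => pairAmp (z 0) (z 1)
  | _ => fun _ => 0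

/-- The pure state with given real amplitudes. -/
def pureState {k : ℕ} (φ : (Fin k → Fin 2) → ℝ) : Operator k :=
  Matrix.of fun x y => ((φ x * φ y : ℝ) : ℂ)

open scoped ComplexOrder in
theorem isState_pureState {k : ℕ} {φ : (Fin k → Fin 2) → ℝ} (h : ∑ x, φ x ^ 2 = 1) :
    IsState (pureState φ) := by
  constructor
  · have outer : pureState φ =
        Matrix.vecMulVec (fun x => (φ x : ℂ)) (star fun x => (φ x : ℂ)) := by
      ext x y
      simp [pureState, Matrix.vecMulVec_apply]
    rw [outer]
    exact Matrix.posSemidef_vecMulVec_self_star _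
  · simp only [Matrix.trace, Matrix.diag_apply, pureState, Matrix.of_apply, ← sq]
    exact_mod_cast h

theorem sum_fin_one {M : Type*} [AddCommMonoid M] (f : (Fin 1 → Fin 2) → M) :
    ∑ z, f z = f ![0] + f ![1] := by
  rw [← (Equiv.funUnique (Fin 1) (Fin 2)).symm.sum_comp f, Fin.sum_univ_two]
  congr 2 <;> ext a <;> fin_cases a <;> rfl

theorem sum_fin_two {M : Type*} [AddCommMonoid M] (f : (Fin 2 → Fin 2) → M) :
    ∑ z, f z = f ![0, 0] + f ![0, 1] + (f ![1, 0] + f ![1, 1]) := by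
  rw [← (finTwoArrowEquiv (Fin 2)).symm.sum_comp f, Fintype.sum_prod_type, Fin.sum_univ_two,
    Fin.sum_univ_two, Fin.sum_univ_two]
  rfl

theorem basisIndex_one (z : Fin 1 → Fin 2) : basisIndex z = (z 0 : ℕ) :=
  (finFunctionFinEquiv_apply z).trans (by simp)

theorem basisIndex_two (z : Fin 2 → Fin 2) : basisIndex z = (z 0 : ℕ) + (z 1 : ℕ) * 2 :=
  (finFunctionFinEquiv_apply z).trans (by simp [Fin.sum_univ_two])

theorem singleEntries_represents (c a b : Fin 2) :
    ∃ z, (singleEntries c)[(a : ℕ) * 2 ^ 1 + b]? = some z ∧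
      z.Represents ((singleAmp c a * singleAmp c b : ℝ) : ℂ) := by
  have zero := algZero_represents.toComplex
  have one := algOne_represents.toComplex
  fin_cases c <;> fin_cases a <;> fin_cases b <;>
    simpa [singleEntries, singleAmp]

theorem pairEntries_represents (a a' b b' : Fin 2) :
    ∃ z, pairEntries[((a : ℕ) + a' * 2) * 2 ^ 2 + (b + b' * 2)]? = some z ∧
      z.Represents ((pairAmp a a' * pairAmp b b' : ℝ) : ℂ) := by
  have zero := algZero_represents.toComplex
  have major := algMajor_represents.toComplex
  have minor := algMinor_represents.toComplex
  have cross := algCross_represents.toComplex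
  rw [← cosAmp_sq, sq] at major
  rw [← sinAmp_sq, sq] at minor
  rw [neg_div, ← cosAmp_mul_sinAmp] at cross
  have cross' := cross
  rw [mul_comm] at cross'
  simp only [Complex.ofReal_mul, Complex.ofReal_zero] at zero major minor
  simp only [Complex.ofReal_neg, Complex.ofReal_mul] at cross cross'
  fin_cases a <;> fin_cases a' <;> fin_cases b <;> fin_cases b' <;>
    simpa [pairEntries, pairAmp]

theorem describes_single {n : ℕ} (col : Fin n → Fin 2) (i : Fin n) :
    (⟨[i], singleEntries (col i)⟩ : Block n).Describes (pureState (blockAmp col [i])) := by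
  refine ⟨isState_pureState ?_, ?_, fun x y => ?_⟩
  · refine (sum_fin_one fun z => singleAmp (col i) (z 0) ^ 2).trans ?_
    simp only [singleAmp, Matrix.cons_val_zero]
    generalize col i = c
    fin_cases c <;> simp
  · simp only [singleEntries, List.length_map]
    split_ifs <;> rfl
  · rw [basisIndex_one x, basisIndex_one y]
    exact singleEntries_represents (col i) (x 0) (y 0)

theorem describes_pair {n : ℕ} (col : Fin n → Fin 2) (i j : Fin n) :
    (⟨[i, j], pairEntries⟩ : Block n).Describes (pureState (blockAmp col [i, j])) := by
  refine ⟨isState_pureState ?_, rfl, fun x y => ?_⟩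
  · refine (sum_fin_two fun z => pairAmp (z 0) (z 1) ^ 2).trans ?_
    simp [pairAmp, cosAmp_sq, sinAmp_sq]
    ring
  · rw [basisIndex_two x, basisIndex_two y]
    exact pairEntries_represents (x 0) (x 1) (y 0) (y 1)

end Quantum

/-! ### The product state -/

namespace Quantum

section Description

variable {n : ℕ} {D : Description n}

/-- The blocks of a description together enumerate the qubits. -/
def siteEquiv (hD : (D.flatMap Block.qubits).Perm (List.finRange n)) :
    (Σ b : Fin D.length, Fin (D.get b).qubits.length) ≃ Fin n :=
  Equiv.ofBijective (fun s => (D.get s.1).qubits.get s.2) <| by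
    rw [Fintype.bijective_iff_surjective_and_card]
    constructor
    · intro i
      obtain ⟨B, hB, hi⟩ := List.mem_flatMap.1 (hD.mem_iff.2 (List.mem_finRange i))
      obtain ⟨b, rfl⟩ := List.mem_iff_get.1 hB
      obtain ⟨a, rfl⟩ := List.mem_iff_get.1 hi
      exact ⟨⟨b, a⟩, rfl⟩
    · have hlen := hD.length_eq
      rw [List.length_flatMap, List.length_finRange] at hlen
      simp only [Fintype.card_sigma, Fintype.card_fin]
      exact (Fin.sum_univ_fun_getElem D fun B => B.qubits.length).trans hlen

theorem prod_prod_blocks (hD : (D.flatMap Block.qubits).Perm (List.finRange n)) (f : Fin n → ℝ) :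
    ∏ b : Fin D.length, ∏ a, f ((D.get b).qubits.get a) = ∏ i, f i := by
  rw [← (siteEquiv hD).prod_comp, Fintype.prod_sigma]
  rfl

theorem sum_prod_blocks (hD : (D.flatMap Block.qubits).Perm (List.finRange n))
    (f : (b : Fin D.length) → (Fin (D.get b).qubits.length → Fin 2) → ℝ) :
    ∑ x : Fin n → Fin 2, ∏ b, f b (fun a => x ((D.get b).qubits.get a)) = ∏ b, ∑ z, f b z := by
  rw [Finset.prod_univ_sum, Fintype.piFinset_univ]
  exact (((siteEquiv hD).symm.arrowCongr (Equiv.refl (Fin 2))).trans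
    (Equiv.piCurry fun _ _ => Fin 2)).sum_comp fun z => ∏ b, f b (z b)

end Description

namespace PairedColouring

variable {n : ℕ} (G : PairedColouring n)

/-- The qubit `i` or its mate, whichever has colour `0`; this is the `k` such that `i` lies in a
block of `G.blocks k`. -/
def rep (i : Fin n) : Fin n :=
  match G.mate i with
  | none => i
  | some j => if G.col i = 0 then i else j

variable {G} {i j k a : Fin n}

theorem rep_of_none (h : G.mate i = none) : G.rep i = i := by simp only [rep, h]

theorem rep_of_some (h : G.mate i = some j) : G.rep i = if G.col i = 0 then i else j := by
  simp only [rep, h]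

theorem blocks_of_none (h : G.mate i = none) :
    G.blocks i = [⟨[i], singleEntries (G.col i)⟩] := by simp only [blocks, h]

theorem blocks_of_some (h : G.mate i = some j) :
    G.blocks i = if G.col i = 0 then [⟨[i, j], pairEntries⟩] else [] := by simp only [blocks, h]

theorem mate_ne (h : G.mate i = some j) : i ≠ j := by
  rintro rfl
  exact G.bichromatic h rfl

theorem col_mate_eq_zero (h : G.mate i = some j) (hi : G.col i ≠ 0) : G.col j = 0 := by
  have := G.bichromatic h
  omega

theorem rep_eq_iff_of_none (hk : G.mate k = none) : G.rep a = k ↔ a = k := by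
  cases ha : G.mate a with
  | none => rw [rep_of_none ha]
  | some b => grind [rep_of_some ha, G.symm ha]

theorem rep_eq_iff_of_some (hk : G.mate k = some j) (hc : G.col k = 0) :
    G.rep a = k ↔ a = k ∨ a = j := by
  have hjk := G.symm hk
  have hcj := G.bichromatic hk
  cases ha : G.mate a with
  | none => grind [rep_of_none ha]
  | some b => grind [rep_of_some ha, G.symm ha]

theorem rep_ne_of_some (hk : G.mate k = some j) (hc : G.col k ≠ 0) (a : Fin n) :
    G.rep a ≠ k := by
  cases ha : G.mate a with
  | none => grind [rep_of_none ha]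
  | some b => grind [rep_of_some ha, col_mate_eq_zero ha]

theorem rep_ne_rep (hij : i ≠ j) (hm : G.mate i ≠ some j) : G.rep i ≠ G.rep j := by
  have hm' : G.mate j ≠ some i := fun h => hm (G.symm h)
  intro h
  cases hk : G.mate (G.rep i) with
  | none => grind [rep_eq_iff_of_none hk]
  | some l =>
    by_cases hc : G.col (G.rep i) = 0
    · grind [rep_eq_iff_of_some hk hc]
    · exact rep_ne_of_some hk hc i rfl

theorem mem_flatMap_qubits_blocks : a ∈ (G.blocks k).flatMap Block.qubits ↔ G.rep a = k := by
  cases hk : G.mate k with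
  | none => simp [blocks_of_none hk, rep_eq_iff_of_none hk]
  | some j =>
    by_cases hc : G.col k = 0
    · simp [blocks_of_some hk, hc, rep_eq_iff_of_some hk hc]
    · simp [blocks_of_some hk, hc, rep_ne_of_some hk hc]

theorem nodup_flatMap_qubits_blocks (k : Fin n) : ((G.blocks k).flatMap Block.qubits).Nodup := by
  cases hk : G.mate k with
  | none => simp [blocks_of_none hk]
  | some j =>
    rw [blocks_of_some hk]
    split_ifs <;> simp [mate_ne hk]

variable (G) in
theorem flatMap_qubits_perm : (G.description.flatMap Block.qubits).Perm (List.finRange n) := by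
  rw [description, List.flatMap_assoc, List.perm_ext_iff_of_nodup _ (List.nodup_finRange n)]
  · refine fun a => iff_of_true (List.mem_flatMap.2 ?_) (List.mem_finRange a)
    exact ⟨G.rep a, List.mem_finRange _, mem_flatMap_qubits_blocks.2 rfl⟩
  · refine List.nodup_flatMap.2 ⟨fun k _ => nodup_flatMap_qubits_blocks k, ?_⟩
    refine (List.nodup_finRange n).pairwise_of_forall_ne fun k _ l _ hkl a hk hl => hkl ?_
    exact (mem_flatMap_qubits_blocks.1 hk).symm.trans (mem_flatMap_qubits_blocks.1 hl)

variable (G) in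
theorem prod_description (F : Block n → ℝ) :
    ∏ b, F (G.description.get b) = ∏ k, ((G.blocks k).map F).prod := by
  refine (Fin.prod_univ_fun_getElem G.description F).trans ?_
  rw [description, List.map_flatMap, Fin.prod_univ_def]
  induction List.finRange n with
  | nil => rfl
  | cons k l ih =>
    simp only [List.flatMap_cons, List.prod_append, ih, List.map_cons, List.prod_cons]

variable (G)

/-- The factor of the amplitude of `|x⟩` that comes from the block of `k`; it is `1` if that block
is represented by the mate of `k`. -/
def siteAmp (x : Fin n → Fin 2) (k : Fin n) : ℝ :=
  match G.mate k with
  | none => singleAmp (G.col k) (x k)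
  | some j => if G.col k = 0 then pairAmp (x k) (x j) else 1

/-- The amplitudes of the product state. -/
def amp (x : Fin n → Fin 2) : ℝ := ∏ k, G.siteAmp x k

/-- The state described by the output of the algorithm. -/
def state : Operator n := pureState G.amp

variable {G} {x y : Fin n → Fin 2}

theorem siteAmp_of_none (h : G.mate k = none) :
    G.siteAmp x k = singleAmp (G.col k) (x k) := by simp only [siteAmp, h]

theorem siteAmp_of_some (h : G.mate k = some j) :
    G.siteAmp x k = if G.col k = 0 then pairAmp (x k) (x j) else 1 := by simp only [siteAmp, h]

theorem siteAmp_congr (h : ∀ a, G.rep a = k → x a = y a) : G.siteAmp x k = G.siteAmp y k := by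
  cases hk : G.mate k with
  | none => rw [siteAmp_of_none hk, siteAmp_of_none hk, h k (rep_of_none hk)]
  | some j =>
    rw [siteAmp_of_some hk, siteAmp_of_some hk]
    split_ifs with hc
    · rw [h k ((rep_eq_iff_of_some hk hc).2 (.inl rfl)),
        h j ((rep_eq_iff_of_some hk hc).2 (.inr rfl))]
    · rfl

variable (G) in
theorem amp_eq_prod_blocks (x : Fin n → Fin 2) :
    G.amp x = ∏ b, blockAmp G.col (G.description.get b).qubits
      fun a => x ((G.description.get b).qubits.get a) := by
  rw [G.prod_description fun B => blockAmp G.col B.qubits fun a => x (B.qubits.get a)]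
  refine Finset.prod_congr rfl fun k _ => ?_
  cases hk : G.mate k with
  | none => simp [blocks_of_none hk, siteAmp_of_none hk, blockAmp]
  | some j =>
    rw [blocks_of_some hk, siteAmp_of_some hk]
    split_ifs <;> simp [blockAmp]

theorem describes_block {B : Block n} (hB : B ∈ G.description) :
    B.Describes (pureState (blockAmp G.col B.qubits)) := by
  obtain ⟨k, -, hk⟩ := List.mem_flatMap.1 hB
  cases hm : G.mate k with
  | none =>
    rw [blocks_of_none hm, List.mem_singleton] at hk
    exact hk ▸ describes_single G.col k
  | some j =>
    rw [blocks_of_some hm] at hk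
    split_ifs at hk with hc
    · exact List.mem_singleton.1 hk ▸ describes_pair G.col k j
    · exact absurd hk List.not_mem_nil

variable (G) in
theorem describes_state : Describes G.description G.state := by
  refine ⟨G.flatMap_qubits_perm, fun b => pureState (blockAmp G.col (G.description.get b).qubits),
    fun b => describes_block (List.get_mem _ _), fun x y => ?_⟩
  simp only [state, pureState, Matrix.of_apply, amp_eq_prod_blocks, ← Finset.prod_mul_distrib]
  push_cast
  rfl

/-! ### Expectations in the product state -/

variable (G) in
/-- The expectation of the product of `h a (x a)` over the qubits `a` of the block of `k`, for `x`
drawn with probability `amp x ^ 2`. -/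
def siteExp (h : Fin n → Fin 2 → ℝ) (k : Fin n) : ℝ :=
  match G.mate k with
  | none => h k (G.col k)
  | some j => if G.col k = 0 then
      (1 + cosTwo) / 2 * (h k 0 * h j 1) + (1 - cosTwo) / 2 * (h k 1 * h j 0) else 1

variable {h : Fin n → Fin 2 → ℝ}

theorem siteExp_of_none (hk : G.mate k = none) : G.siteExp h k = h k (G.col k) := by
  simp only [siteExp, hk]

theorem siteExp_of_some (hk : G.mate k = some j) :
    G.siteExp h k = if G.col k = 0 then
      (1 + cosTwo) / 2 * (h k 0 * h j 1) + (1 - cosTwo) / 2 * (h k 1 * h j 0) else 1 := by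
  simp only [siteExp, hk]

variable (G) in
theorem sum_amp_sq_mul_prod (h : Fin n → Fin 2 → ℝ) :
    ∑ x, G.amp x ^ 2 * ∏ k, h k (x k) = ∏ k, G.siteExp h k := by
  calc
    _ = ∑ x : Fin n → Fin 2, ∏ b, (blockAmp G.col (G.description.get b).qubits
          (fun a => x ((G.description.get b).qubits.get a)) ^ 2 *
        ∏ a, h ((G.description.get b).qubits.get a) (x ((G.description.get b).qubits.get a))) := by
      refine Finset.sum_congr rfl fun x _ => ?_
      rw [Finset.prod_mul_distrib, amp_eq_prod_blocks, Finset.prod_pow,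
        prod_prod_blocks G.flatMap_qubits_perm fun i => h i (x i)]
    _ = ∏ k, ((G.blocks k).map fun B => ∑ z, blockAmp G.col B.qubits z ^ 2 *
        ∏ a, h (B.qubits.get a) (z a)).prod := by
      rw [← G.prod_description]
      exact sum_prod_blocks G.flatMap_qubits_perm fun b z =>
        blockAmp G.col (G.description.get b).qubits z ^ 2 *
          ∏ a, h ((G.description.get b).qubits.get a) (z a)
    _ = ∏ k, G.siteExp h k := Finset.prod_congr rfl fun k _ => ?_
  cases hk : G.mate k with
  | none =>
    rw [blocks_of_none hk, siteExp_of_none hk, List.map_singleton, List.prod_singleton]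
    refine (sum_fin_one _).trans ?_
    generalize hc : G.col k = c
    fin_cases c <;> simp [blockAmp, singleAmp, hc]
  | some j =>
    rw [blocks_of_some hk, siteExp_of_some hk]
    split_ifs with hc
    · rw [List.map_singleton, List.prod_singleton]
      refine (sum_fin_two _).trans ?_
      simp [blockAmp, pairAmp, cosAmp_sq, sinAmp_sq]
    · rfl

theorem siteExp_eq_one (h1 : ∀ a, G.rep a = k → h a = 1) : G.siteExp h k = 1 := by
  cases hk : G.mate k with
  | none => rw [siteExp_of_none hk, h1 k (rep_of_none hk), Pi.one_apply]
  | some j =>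
    rw [siteExp_of_some hk]
    split_ifs with hc
    · rw [h1 k ((rep_eq_iff_of_some hk hc).2 (.inl rfl)),
        h1 j ((rep_eq_iff_of_some hk hc).2 (.inr rfl))]
      simp only [Pi.one_apply]
      ring
    · rfl

variable (G) in
theorem sum_amp_sq : ∑ x, G.amp x ^ 2 = 1 := by
  have main := G.sum_amp_sq_mul_prod 1
  simp only [Pi.one_apply, Finset.prod_const_one, mul_one] at main
  rw [main]
  exact Finset.prod_eq_one fun k _ => siteExp_eq_one fun _ _ => rfl

variable (G) in
theorem isState_state : IsState G.state := isState_pureState G.sum_amp_sq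

variable (G) in
/-- The expectation of `f (x i)` for `x` drawn with probability `amp x ^ 2`. -/
def marginal (i : Fin n) (f : Fin 2 → ℝ) : ℝ :=
  match G.mate i with
  | none => f (G.col i)
  | some _ => (1 + cosTwo) / 2 * f (G.col i) + (1 - cosTwo) / 2 * f (G.col i + 1)

theorem marginal_of_none {f : Fin 2 → ℝ} (hi : G.mate i = none) :
    G.marginal i f = f (G.col i) := by simp only [marginal, hi]

theorem marginal_of_some {f : Fin 2 → ℝ} (hi : G.mate i = some j) :
    G.marginal i f = (1 + cosTwo) / 2 * f (G.col i) + (1 - cosTwo) / 2 * f (G.col i + 1) := by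
  simp only [marginal, hi]

theorem siteExp_rep (h1 : ∀ j, G.mate i = some j → h j = 1) :
    G.siteExp h (G.rep i) = G.marginal i (h i) := by
  cases hi : G.mate i with
  | none => rw [rep_of_none hi, siteExp_of_none hi, marginal_of_none hi]
  | some j =>
    rw [rep_of_some hi, marginal_of_some hi]
    split_ifs with hc
    · rw [siteExp_of_some hi, if_pos hc, h1 j hi, hc]
      simp
    · rw [siteExp_of_some (G.symm hi), if_pos (col_mate_eq_zero hi hc), h1 j hi,
        Fin.eq_one_of_ne_zero _ hc]
      simp

theorem sum_amp_sq_mul (i : Fin n) (f : Fin 2 → ℝ) :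
    ∑ x, G.amp x ^ 2 * f (x i) = G.marginal i f := by
  have hprod (x : Fin n → Fin 2) : ∏ k, update (1 : Fin n → Fin 2 → ℝ) i f k (x k) = f (x i) := by
    rw [Finset.prod_eq_single i] <;> simp +contextual
  have main := G.sum_amp_sq_mul_prod (update 1 i f)
  simp only [hprod] at main
  rw [main, Finset.prod_eq_single (G.rep i), siteExp_rep, update_self]
  · exact fun j hj => update_of_ne (mate_ne hj).symm _ _
  · exact fun k _ hk => siteExp_eq_one fun a ha => update_of_ne (by grind) _ _
  · exact fun hi => absurd (Finset.mem_univ _) hi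

theorem sum_amp_sq_mul_mul (hij : i ≠ j) (hm : G.mate i ≠ some j) (f g : Fin 2 → ℝ) :
    ∑ x, G.amp x ^ 2 * (f (x i) * g (x j)) = G.marginal i f * G.marginal j g := by
  set h : Fin n → Fin 2 → ℝ := update (update 1 i f) j g with h_def
  have hi : h i = f := by rw [h_def, update_of_ne hij, update_self]
  have hj : h j = g := update_self ..
  have hne (k : Fin n) (hki : k ≠ i) (hkj : k ≠ j) : h k = 1 := by
    rw [h_def, update_of_ne hkj, update_of_ne hki, Pi.one_apply]
  have hprod (x : Fin n → Fin 2) : ∏ k, h k (x k) = f (x i) * g (x j) := by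
    rw [Finset.prod_eq_mul i j hij (fun k _ hk => by rw [hne k hk.1 hk.2, Pi.one_apply])
      (by simp) (by simp), hi, hj]
  have main := G.sum_amp_sq_mul_prod h
  simp only [hprod] at main
  rw [main, Finset.prod_eq_mul (G.rep i) (G.rep j) (rep_ne_rep hij hm)
    (fun k _ hk => siteExp_eq_one fun a ha => hne a (by grind) (by grind)) (by simp) (by simp),
    siteExp_rep fun k hk => hne k (mate_ne hk).symm (by grind),
    siteExp_rep fun k hk => hne k (by grind [G.symm hk]) (mate_ne hk).symm, hi, hj]

/-! ### Exchange correlations of the product state -/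

theorem eq_col_of_amp_ne_zero (h : G.amp x ≠ 0) (hk : G.mate k = none) : x k = G.col k := by
  have hfactor := Finset.prod_ne_zero_iff.1 h k (Finset.mem_univ k)
  rw [siteAmp_of_none hk, singleAmp] at hfactor
  by_contra hne
  exact hfactor (if_neg hne)

theorem ne_of_amp_ne_zero (h : G.amp x ≠ 0) (hk : G.mate k = some j) : x k ≠ x j := by
  wlog hc : G.col k = 0 generalizing k j
  · exact (this (G.symm hk) (col_mate_eq_zero hk hc)).symm
  intro heq
  have hfactor := Finset.prod_ne_zero_iff.1 h k (Finset.mem_univ k)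
  rw [siteAmp_of_some hk, if_pos hc, pairAmp] at hfactor
  exact hfactor (if_pos heq)

theorem amp_mul_amp_exch_of_ne (hm : G.mate i ≠ some j) (hx : x i ≠ x j) :
    G.amp x * G.amp (exch i j x) = 0 := by
  by_contra hne
  obtain ⟨hamp, hexch⟩ := mul_ne_zero_iff.1 hne
  cases hi : G.mate i with
  | none =>
    have h₁ := eq_col_of_amp_ne_zero hamp hi
    have h₂ := eq_col_of_amp_ne_zero hexch hi
    rw [exch_apply_left] at h₂
    exact hx (h₁.trans h₂.symm)
  | some l =>
    have h₁ := ne_of_amp_ne_zero hamp hi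
    have h₂ := ne_of_amp_ne_zero hexch hi
    rw [exch_apply_left, exch_apply_of_ne (mate_ne hi).symm (by grind)] at h₂
    omega

/-- `1` for `|0⟩` and `-1` for `|1⟩`. -/
def spin (a : Fin 2) : ℝ := if a = 0 then 1 else -1

theorem spin_mul_spin (a b : Fin 2) : spin a * spin b = if a = b then 1 else -1 := by
  fin_cases a <;> fin_cases b <;> simp [spin]

theorem exchSum_of_ne_mate (hij : i ≠ j) (hm : G.mate i ≠ some j) :
    exchSum G.amp i j = (1 + G.marginal i spin * G.marginal j spin) / 2 := by
  have hterm (x : Fin n → Fin 2) : G.amp x * G.amp (exch i j x) =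
      (G.amp x ^ 2 + G.amp x ^ 2 * (spin (x i) * spin (x j))) / 2 := by
    rw [spin_mul_spin]
    split_ifs with hx
    · rw [exch_eq_self hx]
      ring
    · rw [amp_mul_amp_exch_of_ne hm hx]
      ring
  rw [exchSum, Finset.sum_congr rfl fun x _ => hterm x, ← Finset.sum_div, Finset.sum_add_distrib,
    G.sum_amp_sq, sum_amp_sq_mul_mul hij hm]

theorem marginal_spin (i : Fin n) :
    G.marginal i spin = spin (G.col i) * if G.mate i = none then 1 else cosTwo := by
  cases hi : G.mate i with
  | none => simp [marginal_of_none hi]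
  | some j =>
    rw [marginal_of_some hi]
    generalize G.col i = c
    fin_cases c <;> simp [spin] <;> ring

theorem exchSum_le_of_ne_mate (hc : G.col i ≠ G.col j) (hm : G.mate i ≠ some j) :
    exchSum G.amp i j ≤ (1 - sinTwo) / 2 := by
  have hcos := cosTwo_sq
  have hmul : sinTwo ≤ (if G.mate i = none then 1 else cosTwo) *
      if G.mate j = none then 1 else cosTwo := by
    split_ifs <;> nlinarith [cosTwo_nonneg, cosTwo_le_one]
  rw [exchSum_of_ne_mate (ne_of_apply_ne _ hc) hm, marginal_spin, marginal_spin, mul_mul_mul_comm,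
    spin_mul_spin, if_neg hc]
  linarith

/-- Exchanging a matched pair multiplies the amplitude by a function of one of its qubits, so that
the exchange correlation is a one-qubit expectation. -/
theorem amp_exch_of_mate (hij : G.mate i = some j) (hi : G.col i = 0) (x : Fin n → Fin 2) :
    G.amp (exch i j x) =
      G.amp x * if x i = 0 then -(sinAmp / cosAmp) else -(cosAmp / sinAmp) := by
  have hpos : 0 < cosAmp * sinAmp := by rw [cosAmp_mul_sinAmp]; exact half_pos sinTwo_pos
  have hcos : cosAmp ≠ 0 := left_ne_zero_of_mul hpos.ne'
  have hsin : sinAmp ≠ 0 := right_ne_zero_of_mul hpos.ne'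
  have hsite : G.siteAmp (exch i j x) i =
      G.siteAmp x i * if x i = 0 then -(sinAmp / cosAmp) else -(cosAmp / sinAmp) := by
    rw [siteAmp_of_some hij, siteAmp_of_some hij, if_pos hi, if_pos hi, exch_apply_left,
      exch_apply_right]
    generalize x i = a, x j = b
    fin_cases a <;> fin_cases b <;> simp [pairAmp] <;> field_simp
  have hrest : ∏ k ∈ Finset.univ.erase i, G.siteAmp (exch i j x) k =
      ∏ k ∈ Finset.univ.erase i, G.siteAmp x k := by
    refine Finset.prod_congr rfl fun k hk => siteAmp_congr fun a ha => exch_apply_of_ne ?_ ?_ x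
    all_goals grind [rep_eq_iff_of_some hij hi (a := a)]
  rw [amp, amp, ← Finset.mul_prod_erase _ _ (Finset.mem_univ i), hsite, hrest,
    ← Finset.mul_prod_erase _ _ (Finset.mem_univ i)]
  ring

theorem exchSum_of_mate (hij : G.mate i = some j) : exchSum G.amp i j = -sinTwo := by
  wlog hi : G.col i = 0 generalizing i j
  · rw [exchSum_comm, this (G.symm hij) (col_mate_eq_zero hij hi)]
  have hterm (x : Fin n → Fin 2) : G.amp x * G.amp (exch i j x) = G.amp x ^ 2 *
      if x i = 0 then -(sinAmp / cosAmp) else -(cosAmp / sinAmp) := by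
    rw [amp_exch_of_mate hij hi]
    ring
  rw [exchSum, Finset.sum_congr rfl fun x _ => hterm x,
    sum_amp_sq_mul i fun a => if a = 0 then -(sinAmp / cosAmp) else -(cosAmp / sinAmp),
    marginal_of_some hij, hi, ← cosAmp_sq, ← sinAmp_sq]
  have hmul := cosAmp_mul_sinAmp
  have hpos : 0 < cosAmp * sinAmp := by rw [hmul]; exact half_pos sinTwo_pos
  have hcos : cosAmp ≠ 0 := left_ne_zero_of_mul hpos.ne'
  have hsin : sinAmp ≠ 0 := right_ne_zero_of_mul hpos.ne'
  simp only [if_true, zero_add, one_ne_zero, if_false]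
  field_simp [hcos, hsin]
  linarith

end PairedColouring

end Quantum

/-! ### The energy of the product state -/

namespace Quantum

theorem energy_pureState {n : ℕ} (w : Matrix (Fin n) (Fin n) ℚ) {φ : (Fin n → Fin 2) → ℝ}
    (hφ : ∑ x, φ x ^ 2 = 1) :
    energy (pureState φ) (qmcHamiltonian w) =
      (totalWeight w + ∑ i, ∑ j with i < j, (w i j : ℝ) * -exchSum φ i j) / 2 := by
  have trace_eq : (pureState φ * qmcHamiltonian w).trace =
      ∑ y, (φ y : ℂ) * (qmcHamiltonian w).mulVec (fun x => (φ x : ℂ)) y := by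
    rw [Matrix.trace_mul_comm, Matrix.trace]
    refine Finset.sum_congr rfl fun y _ => ?_
    rw [Matrix.diag_apply, Matrix.mul_apply, Matrix.mulVec, dotProduct, Finset.mul_sum]
    refine Finset.sum_congr rfl fun x _ => ?_
    rw [pureState, Matrix.of_apply]
    push_cast
    ring
  have main := sum_mul_sub_exchSum w φ
  rw [hφ, mul_one] at main
  rw [energy, trace_eq, ← main, ← Complex.ofReal_re (∑ x, φ x * _)]
  simp only [qmcHamiltonian_mulVec]
  push_cast
  rfl

namespace PairedColouring

variable {n : ℕ} {G : PairedColouring n} {w : Matrix (Fin n) (Fin n) ℚ}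

theorem sum_lt_ite_mate (hw : w.IsSymm) :
    ∑ i, ∑ j with i < j, (w i j : ℝ) * (if G.mate i = some j then 1 else 0) = G.weight w := by
  let y : Fin n → ℝ := fun i => if G.col i = 0 then 1 else 0
  have hsymm (i j : Fin n) : (w i j : ℝ) * (if G.mate i = some j then 1 else 0) =
      w j i * if G.mate j = some i then 1 else 0 := by
    rw [hw.apply i j]
    exact congrArg _ (if_congr ⟨G.symm, G.symm⟩ rfl rfl)
  have hone {i j : Fin n} (h : G.mate i = some j) : y i + y j = 1 := by
    have hne := G.bichromatic h
    have hzero := col_mate_eq_zero h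
    grind
  calc
    _ = ∑ i, ∑ j with i < j,
        (y i + y j) * ((w i j : ℝ) * if G.mate i = some j then 1 else 0) := by
      refine Finset.sum_congr rfl fun i _ => Finset.sum_congr rfl fun j _ => ?_
      split_ifs with h
      · rw [hone h, one_mul]
      · rw [mul_zero, mul_zero]
    _ = ∑ i, y i * ∑ j with j ≠ i, (w i j : ℝ) * if G.mate i = some j then 1 else 0 :=
      sum_lt_add_mul hsymm y
    _ = ∑ i with G.col i = 0, ∑ j with j ≠ i,
        (w i j : ℝ) * if G.mate i = some j then 1 else 0 := by
      simp only [y, ite_mul, one_mul, zero_mul, Finset.sum_filter (fun i => G.col i = 0)]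
    _ = G.weight w := Finset.sum_congr rfl fun i _ => ?_
  cases hi : G.mate i with
  | none => simp
  | some j =>
    rw [Finset.sum_eq_single_of_mem j (by simpa using (mate_ne hi).symm)
      fun k _ hk => by simp [hk.symm]]
    simp

theorem edge_le_one_sub_exchSum {i j : Fin n} (hc : G.col i ≠ G.col j) :
    (1 + sinTwo) / 2 * (1 + if G.mate i = some j then 1 else 0) ≤ 1 - exchSum G.amp i j := by
  split_ifs with hm
  · rw [exchSum_of_mate hm]
    linarith
  · linarith [exchSum_le_of_ne_mate hc hm]

theorem le_energy_state (hw : IsInteraction w)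
    (proper : ∀ i j, i ≠ j → w i j ≠ 0 → G.col i ≠ G.col j) :
    (1 + sinTwo) / 2 * ((totalWeight w + G.weight w) / 2) ≤
      energy G.state (qmcHamiltonian w) := by
  rw [state, energy_pureState w G.sum_amp_sq, ← mul_div_assoc, ← sum_lt_ite_mate hw.1, totalWeight]
  refine div_le_div_of_nonneg_right ?_ zero_le_two
  simp only [← Finset.sum_add_distrib, Finset.mul_sum]
  refine Finset.sum_le_sum fun i _ => Finset.sum_le_sum fun j hj => ?_
  by_cases h : w i j = 0
  · simp [h]
  have hle := mul_le_mul_of_nonneg_left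
    (edge_le_one_sub_exchSum (proper i j (Finset.mem_filter.1 hj).2.ne h))
    (Rat.cast_nonneg (K := ℝ).2 (hw.2 i j))
  linarith

theorem Optimal.approx (hG : G.Optimal w) (hw : IsInteraction w) :
    (1 + √5) / 4 * lambdaMax (qmcHamiltonian w) ≤ energy G.state (qmcHamiltonian w) := by
  obtain ⟨y, hy, hwy, hsum⟩ := hG.dual
  have ratio : (1 + √5) / 4 = (1 + sinTwo) / 2 := by
    rw [sinTwo_eq]
    ring
  calc
    _ ≤ (1 + sinTwo) / 2 * ((totalWeight w + ∑ i, y i) / 2) := by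
      rw [ratio]
      exact mul_le_mul_of_nonneg_left (lambdaMax_le hw.2 hy hwy) (by linarith [sinTwo_pos])
    _ ≤ (1 + sinTwo) / 2 * ((totalWeight w + G.weight w) / 2) := by
      have := sinTwo_pos
      gcongr
    _ ≤ _ := le_energy_state hw hG.proper

end PairedColouring

end Quantum

/-! ### The running time -/

namespace RAM

theorem size_le_bitLength {l : List ℕ} {a : ℕ} (h : a ∈ l) : a.size ≤ bitLength l :=
  (Nat.le_succ _).trans (List.single_le_sum (by simp) _ (List.mem_map_of_mem h))

theorem length_le_bitLength (l : List ℕ) : l.length ≤ bitLength l := by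
  calc
    l.length = (l.map fun a => a.size + 1).length • 1 := by simp
    _ ≤ bitLength l := List.card_nsmul_le_sum _ 1 (by simp)

theorem within_initStore {l : List ℕ} {X : ℕ} (hX : bitLength l ≤ X) (h : l.getD 0 0 < X) :
    (initStore l).Within X (bitLength l) := by
  have hsize (k i : ℕ) : ((initStore l).arr k i).size ≤ bitLength l := by
    simp only [initStore]
    split_ifs
    · by_cases hi : i < l.length
      · rw [List.getD_eq_getElem _ _ hi]
        exact size_le_bitLength (List.getElem_mem hi)
      · rw [List.getD_eq_default _ _ (not_lt.1 hi), Nat.size_zero]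
        exact Nat.zero_le _
    · simp
  refine ⟨h, fun i => (hsize 0 i).trans hX, fun x => ?_, hsize⟩
  simp only [initStore]
  split_ifs
  · exact (Nat.size_le.2 Nat.lt_two_pow_self).trans (length_le_bitLength l)
  · simp

theorem Store.Within.bitLength_output_le {s : Store} {X B : ℕ} (h : s.Within X B) :
    bitLength s.output ≤ s.output.length * (B + 1) := by
  refine (List.sum_le_card_nsmul _ (B + 1) fun a ha => ?_).trans (by simp)
  simp only [Store.output, List.map_map, List.mem_map] at ha
  obtain ⟨i, -, rfl⟩ := ha
  exact Nat.succ_le_succ (h.arr 1 i)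

theorem Prog.Tame.computes {c : Prog} (hc : c.Tame) :
    ∃ p : Polynomial ℕ, ∀ l output : List ℕ, l.getD 0 0 ≤ bitLength l →
      (c.run (initStore l)).output = output →
      ∃ t, Computes c.compile l output t ∧ t ≤ p.eval (bitLength l) * (output.length + 1) := by
  obtain ⟨q, hq⟩ := hc.runsWithin
  refine ⟨(q.comp (.X + 1) + 1) * (.X + q.comp (.X + 1) + 1), fun l output h hout => ?_⟩
  obtain ⟨t, hexec, ht, hwithin⟩ :=
    hq _ (within_initStore (Nat.le_succ _) (Nat.lt_succ_of_le h))
  have hlen := hwithin.bitLength_output_le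
  rw [hout] at hlen
  refine ⟨t + bitLength output, ⟨t, _, hexec, hout, rfl⟩, ?_⟩
  simp only [Polynomial.eval_mul, Polynomial.eval_add, Polynomial.eval_comp, Polynomial.eval_X,
    Polynomial.eval_one]
  generalize q.eval (bitLength l + 1) = K at *
  calc
    t + bitLength output
      ≤ K * (bitLength l + 1) + output.length * (bitLength l + K + 1) := add_le_add ht hlen
    _ ≤ K * (bitLength l + K + 1) + (K + 1) * output.length * (bitLength l + K + 1) := by
      gcongr <;> nlinarith
    _ ≤ (K + 1) * (bitLength l + K + 1) * (output.length + 1) := by nlinarith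

end RAM

theorem Enc.le_length_matrix {n : ℕ} (w : Matrix (Fin n) (Fin n) ℚ) :
    n ≤ (Enc.matrix w).length := by
  have hrat (q : ℚ) : (Enc.rat q).length = 3 := rfl
  simp only [Enc.matrix, List.length_cons, List.length_flatMap, hrat, List.map_const',
    List.length_finRange, List.sum_replicate, smul_eq_mul]
  nlinarith [Nat.le_mul_self n]

namespace Quantum.PairedColouring

variable {n : ℕ} (G : PairedColouring n)

theorem length_list_singleEntries_le (c : Fin 2) :
    (Enc.list Enc.algComplex (singleEntries c)).length ≤
      (Enc.list Enc.algComplex pairEntries).length := by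
  have hsingle : (Enc.list Enc.algComplex (singleEntries c)).length = 89 := by
    unfold singleEntries
    split_ifs <;> rfl
  have hzero : (Enc.algComplex algZero.toComplex).length = 22 := rfl
  rw [hsingle]
  simp only [pairEntries, Enc.list, List.map_cons, List.length_cons, List.flatMap_cons,
    List.length_append, hzero]
  omega

theorem length_flatMap_blocks_le (i : Fin n) :
    ((G.blocks i).flatMap Enc.block).length ≤
      3 + (Enc.list Enc.algComplex pairEntries).length := by
  cases hm : G.mate i with
  | none =>
    have := length_list_singleEntries_le (G.col i)
    simp only [blocks_of_none hm, List.flatMap_singleton, Enc.block, List.length_append]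
    rw [show (Enc.list _ [i]).length = 2 from rfl]
    omega
  | some j =>
    rw [blocks_of_some hm]
    split_ifs
    · simp only [List.flatMap_singleton, Enc.block, List.length_append]
      rfl
    · exact Nat.zero_le _

theorem length_description_le :
    (Enc.description G.description).length ≤
      1 + n * (3 + (Enc.list Enc.algComplex pairEntries).length) := by
  rw [Enc.description, Enc.list, description, List.flatMap_assoc, List.length_cons,
    List.length_flatMap, add_comm]
  refine Nat.add_le_add_left ((List.sum_le_card_nsmul _ _ fun a ha => ?_).trans
    (by rw [List.length_map, List.length_finRange, smul_eq_mul])) 1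
  obtain ⟨i, -, rfl⟩ := List.mem_map.1 ha
  exact G.length_flatMap_blocks_le i

end Quantum.PairedColouring

open RAM Quantum in
theorem RAM.Prog.algorithm_computes :
    ∃ p : Polynomial ℕ, ∀ (n : ℕ) (w : Matrix (Fin n) (Fin n) ℚ),
      IsInteraction w → IsBipartite w →
      ∃ (t : ℕ) (G : PairedColouring n), G.Optimal w ∧
        Computes algorithm.compile (Enc.matrix w) (Enc.description G.description) t ∧
        t ≤ p.eval (bitLength (Enc.matrix w)) := by
  obtain ⟨p, hp⟩ := tame_algorithm.computes
  refine ⟨p * (1 + .X * .C (3 + (Enc.list Enc.algComplex pairEntries).length) + 1),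
    fun n w hw hb => ?_⟩
  obtain ⟨G, hG, hout⟩ := algorithm_spec hw hb
  have hn : n ≤ bitLength (Enc.matrix w) := (Enc.le_length_matrix w).trans (length_le_bitLength _)
  obtain ⟨t, hcomp, ht⟩ := hp (Enc.matrix w) _ hn hout
  refine ⟨t, G, hG, hcomp, ht.trans ?_⟩
  simp only [Polynomial.eval_mul, Polynomial.eval_add, Polynomial.eval_X, Polynomial.eval_C,
    Polynomial.eval_one]
  have hlen := G.length_description_le
  gcongr
  exact hlen.trans (by gcongr)

end

theorem corollary2 :
    ∃ c : RAM.Cmd,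
      IsPolyTimeApproxAlgorithm ((1 + √5) / 4)
        (fun _ w => Quantum.IsInteraction w ∧ Quantum.IsBipartite w)
        (fun _ w => Quantum.qmcHamiltonian w) c := by
  obtain ⟨p, hp⟩ := RAM.Prog.algorithm_computes
  refine ⟨RAM.Prog.algorithm.compile, p, fun n w ⟨hw, hb⟩ => ?_⟩
  obtain ⟨t, G, hG, hcomp, ht⟩ := hp n w hw hb
  exact ⟨t, G.description, G.state, hcomp, ht, G.describes_state, G.isState_state, hG.approx hw⟩
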